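/- Let $\mathcal{B}$ be an additive category. For an integer $N\ge 1$, an $N$-complex in $\mathcal{B}$ is a sequence $(X^i,d^i:X^i\to X^{i+1})_{i\in\mathbb{Z}}$ all of whose $N$-fold composites $d^{i+N-1}\cdots d^{i+1}d^i$ vanish; morphisms are commutative ladders. A morphism $f:X\to Y$ of $N$-complexes is null-homotopic if there are $s^i:X^i\to Y^{i-N+1}$ with $$f^i=\sum_{j=1}^{N}d_Y^{i-1}\cdots d_Y^{i-N+j}\,s^{i+j-1}\,d_X^{i+j-2}\cdots d_X^{i}\qquad(i\in\mathbb{Z}),$$ and $\mathsf{K}_N(\mathcal{B})$ is the category of $N$-complexes modulo null-homotopic morphisms (so $\mathsf{K}_1(\mathcal{B})=0$). It is a triangulated category as follows. The mapping cone of $f:X\to Y$ is $C(f)^m=Y^m\oplus\bigoplus_{a=m+1}^{m+N-1}X^a$, whose differential is $d_Y$ on $Y^m$, maps $X^{m+1}$ to $Y^{m+1}$ by $f$, maps $X^a$ identically to $X^a$ for $m+1<a<m+N$, maps $X^a$ to $X^{m+N}$ by $-d_X^{m+N-1}\cdots d_X^{a}$ for $m<a<m+N$, and has all other components zero; for $N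 = 1$ it is $Y$ with zero differential. The suspension is $\Sigma X=C(X\to 0)$, and the distinguished triangles are those isomorphic in $\mathsf{K}_N(\mathcal{B})$ to some $X\xrightarrow{f}Y\to C(f)\to\Sigma X$, with the canonical inclusion and projection. For $M\ge1$ and $s\in\mathbb{Z}$ define $\iota_s^{(M)},\rho_s^{(M+1)}:\mathbb{Z}\to\mathbb{Z}$ by $$\iota_s^{(M)}(s+i+k(M+1))=\begin{cases}s+kM&(i=0)\\ s+i-1+kM&(0<i<M+1)\end{cases}\qquad \rho_s^{(M+1)}(s+i+kM)=\begin{cases}s+k(M+1)&(i=0)\\ s+i+1+k(M+1)&(0<i<M).\end{cases}$$ The prolongation functor $\underline{I}_s^{(M)}:\mathsf{K}_M(\mathcal{B})\to\mathsf{K}_{M+1}(\mathcal{B})$ is induced by $I_s(X)^i=X^{\iota_s(i)}$, with differential at $i$ equal to $d^{\iota_s(i)}$ if $\iota_s(i)<\iota_s(i+1)$ and to $1$ if $\iota_s(i)=\iota_s(i+1)$; the contraction functor $\underline{J}_s^{(M+1)}:\mathsf{K}_{M+1}(\mathcal{B})\to\mathsf{K}_M(\mathcal{B})$ is induced by $J_s(Y)^i=Y^{\rho_s(i)}$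 with differential $d^{\rho_s(i+1)-1}\cdots d^{\rho_s(i)}$. For $1\le M\le N$ put $$\underline{I}_s^{\Uparrow_M^N}=\underline{I}_s^{(N-1)}\cdots\underline{I}_s^{(M)}:\mathsf{K}_M(\mathcal{B})\to\mathsf{K}_N(\mathcal{B}),\qquad \underline{J}_s^{\Downarrow_M^N}=\underline{J}_s^{(M+1)}\cdots\underline{J}_s^{(N)}:\mathsf{K}_N(\mathcal{B})\to\mathsf{K}_M(\mathcal{B}).$$ **Corollary.** Let $N$, $r$ be integers with $1\le r<N$ and let $s\in\mathbb{Z}$. Put $$i_s^*=\underline{J}_{s-1}^{\Downarrow_{N-r}^N},\quad i_{s*}=\underline{I}_s^{\Uparrow_{N-r}^N},\quad i_s^!=\underline{J}_s^{\Downarrow_{N-r}^N},\quad j_{s!}=\underline{I}_{r+s}^{\Uparrow_{r+1}^N},\quad j_s^*=\underline{J}_{r+s}^{\Downarrow_{r+1}^N},\quad j_{s*}=\underline{I}_{r+s+1}^{\Uparrow_{r+1}^N}.$$ Then these functors form a recollement of $\mathsf{K}_N(\mathcal{B})$ with $\mathsf{K}_{N-r}(\mathcal{B})$ on the left and $\mathsf{K}_{r+1}(\mathcal{B})$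 on the right. That is: the three categories are triangulated and the six functors are triangle functors; $i_{s*}$, $j_{s!}$, $j_{s*}$ are fully faithful; $(i_s^*,i_{s*})$, $(i_{s*},i_s^!)$, $(j_{s!},j_s^*)$, $(j_s^*,j_{s*})$ are adjoint pairs; and the essential images satisfy $\operatorname{Im}j_{s!}=\operatorname{Ker}i_s^*$, $\operatorname{Im}i_{s*}=\operatorname{Ker}j_s^*$, $\operatorname{Im}j_{s*}=\operatorname{Ker}i_s^!$. -/

import Mathlib

open CategoryTheory CategoryTheory.Limits

noncomputable section

namespace NCpx

universe v u

variable {B : Type u} [Category.{v} B] [Preadditive B]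

/-! ### `N`-complexes and their homotopy category -/

/-- A sequence `⋯ ⟶ X i ⟶ X (i+1) ⟶ ⋯` indexed by `ℤ` is a functor from the poset `ℤ`; for `a ≤ b`
the map `X a ⟶ X b` is the composite `d^{b-1} ⋯ d^{a+1} d^a` of differentials. The sequence is an
`N`-complex if all composites of `N` consecutive differentials vanish. -/
def isNComplex (B : Type u) [Category.{v} B] [Preadditive B] (N : ℕ) : ObjectProperty (ℤ ⥤ B) :=
  fun X => ∀ i : ℤ, X.map (homOfLE (show i ≤ i + (N : ℤ) by omega)) = 0

/-- The category `C_N(B)` of `N`-complexes in `B`. -/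
abbrev Cpx (B : Type u) [Category.{v} B] [Preadditive B] (N : ℕ) := (isNComplex B N).FullSubcategory

/-- The composite `X a ⟶ X b` of differentials if `a ≤ b`, and zero otherwise. -/
def dd (X : ℤ ⥤ B) (a b : ℤ) : X.obj a ⟶ X.obj b :=
  if h : a ≤ b then X.map (homOfLE h) else 0

lemma dd_of_le (X : ℤ ⥤ B) {a b : ℤ} (h : a ≤ b) : dd X a b = X.map (homOfLE h) := dif_pos h

lemma dd_of_lt (X : ℤ ⥤ B) {a b : ℤ} (h : b < a) : dd X a b = 0 := dif_neg (by omega)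

@[simp] lemma dd_self (X : ℤ ⥤ B) (a : ℤ) : dd X a a = 𝟙 _ := by
  rw [dd_of_le X le_rfl]; exact X.map_id a

lemma dd_comp (X : ℤ ⥤ B) {a b c : ℤ} (h : a ≤ b) (h' : b ≤ c) :
    dd X a b ≫ dd X b c = dd X a c := by
  rw [dd_of_le X h, dd_of_le X h', dd_of_le X (h.trans h'), ← X.map_comp]; rfl

lemma dd_comp_assoc (X : ℤ ⥤ B) {a b c : ℤ} (h : a ≤ b) (h' : b ≤ c) {Z : B} (k : X.obj c ⟶ Z) :
    dd X a b ≫ dd X b c ≫ k = dd X a c ≫ k := by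
  rw [← Category.assoc, dd_comp X h h']

lemma dd_naturality {X Y : ℤ ⥤ B} (f : X ⟶ Y) (a b : ℤ) :
    dd X a b ≫ f.app b = f.app a ≫ dd Y a b := by
  unfold dd; split_ifs <;> simp

lemma dd_eq_zero {N : ℕ} (X : Cpx B N) {a b : ℤ} (h : a + N ≤ b) : dd X.obj a b = 0 := by
  have h1 : a ≤ a + (N : ℤ) := by omega
  rw [← dd_comp X.obj h1 h, dd_of_le X.obj h1, X.property a, zero_comp]

/-- A morphism `f` of `N`-complexes is null-homotopic if there are `s^n : X^n ⟶ Y^{n-N+1}` with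
`f^i = ∑_{n=i}^{i+N-1} d_Y^{i-1} ⋯ d_Y^{n-N+1} s^n d_X^{n-1} ⋯ d_X^i` for all `i`. -/
def NullHomotopic {N : ℕ} {X Y : Cpx B N} (f : X ⟶ Y) : Prop :=
  ∃ s : ∀ n : ℤ, X.obj.obj n ⟶ Y.obj.obj (n - N + 1), ∀ i : ℤ,
    f.hom.app i = ∑ n ∈ Finset.Ico i (i + N), dd X.obj i n ≫ s n ≫ dd Y.obj (n - N + 1) i

lemma NullHomotopic.zero {N : ℕ} (X Y : Cpx B N) : NullHomotopic (0 : X ⟶ Y) :=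
  ⟨fun _ => 0, fun i => by simp⟩

lemma NullHomotopic.add {N : ℕ} {X Y : Cpx B N} {f g : X ⟶ Y} (hf : NullHomotopic f)
    (hg : NullHomotopic g) : NullHomotopic (f + g) := by
  obtain ⟨s, hs⟩ := hf
  obtain ⟨t, ht⟩ := hg
  refine ⟨fun n => s n + t n, fun i => ?_⟩
  have : (f + g).hom.app i = f.hom.app i + g.hom.app i := rfl
  rw [this, hs, ht, ← Finset.sum_add_distrib]
  simp

lemma NullHomotopic.neg {N : ℕ} {X Y : Cpx B N} {f : X ⟶ Y} (hf : NullHomotopic f) :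
    NullHomotopic (-f) := by
  obtain ⟨s, hs⟩ := hf
  refine ⟨fun n => - s n, fun i => ?_⟩
  have : (-f).hom.app i = - f.hom.app i := rfl
  rw [this, hs, ← Finset.sum_neg_distrib]
  simp

lemma NullHomotopic.precomp {N : ℕ} {X Y Z : Cpx B N} (f : X ⟶ Y) {g : Y ⟶ Z}
    (hg : NullHomotopic g) : NullHomotopic (f ≫ g) := by
  obtain ⟨s, hs⟩ := hg
  refine ⟨fun n => f.hom.app n ≫ s n, fun i => ?_⟩
  have : (f ≫ g).hom.app i = f.hom.app i ≫ g.hom.app i := rfl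
  rw [this, hs, Preadditive.comp_sum]
  refine Finset.sum_congr rfl fun n _ => ?_
  rw [← Category.assoc, ← dd_naturality]
  simp

lemma NullHomotopic.postcomp {N : ℕ} {X Y Z : Cpx B N} {f : X ⟶ Y} (g : Y ⟶ Z)
    (hf : NullHomotopic f) : NullHomotopic (f ≫ g) := by
  obtain ⟨s, hs⟩ := hf
  refine ⟨fun n => s n ≫ g.hom.app _, fun i => ?_⟩
  have : (f ≫ g).hom.app i = f.hom.app i ≫ g.hom.app i := rfl
  rw [this, hs, Preadditive.sum_comp]
  refine Finset.sum_congr rfl fun n _ => ?_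
  simp [dd_naturality]

/-- Two morphisms of `N`-complexes are homotopic if their difference is null-homotopic. -/
def homotopyRel (B : Type u) [Category.{v} B] [Preadditive B] (N : ℕ) : HomRel (Cpx B N) :=
  fun _ _ f g => NullHomotopic (f - g)

instance (N : ℕ) : Congruence (homotopyRel B N) where
  comp_left f g g' h := by
    have := NullHomotopic.precomp f h
    rwa [Preadditive.comp_sub] at this
  comp_right g h := by
    have := NullHomotopic.postcomp g h
    rwa [Preadditive.sub_comp] at this
  equivalence :=
    { refl := fun f => by
        unfold homotopyRel
        rw [sub_self]
        exact NullHomotopic.zero _ _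
      symm := fun {f g} h => by
        have := NullHomotopic.neg h
        rwa [neg_sub] at this
      trans := fun {f g k} h h' => by
        have := NullHomotopic.add h h'
        rwa [sub_add_sub_cancel] at this }

/-- The homotopy category `K_N(B)` of `N`-complexes. -/
abbrev K (B : Type u) [Category.{v} B] [Preadditive B] (N : ℕ) := CategoryTheory.Quotient (homotopyRel B N)

instance (N : ℕ) : Preadditive (K B N) :=
  CategoryTheory.Quotient.preadditive (homotopyRel B N) (fun _ _ f₁ f₂ g₁ g₂ h h' => by
    have := NullHomotopic.add h h'
    have e : f₁ - f₂ + (g₁ - g₂) = f₁ + g₁ - (f₂ + g₂) := by abel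
    rwa [e] at this)

/-- The projection `C_N(B) ⥤ K_N(B)`. -/
abbrev toK (B : Type u) [Category.{v} B] [Preadditive B] (N : ℕ) : Cpx B N ⥤ K B N :=
  CategoryTheory.Quotient.functor (homotopyRel B N)

/-- An additive functor between categories of complexes that preserves null-homotopic morphisms
induces a functor between the homotopy categories. -/
def liftK {N M : ℕ} (F : Cpx B N ⥤ Cpx B M)
    (hsub : ∀ ⦃X Y : Cpx B N⦄ (f g : X ⟶ Y), F.map (f - g) = F.map f - F.map g)
    (hF : ∀ ⦃X Y : Cpx B N⦄ (f : X ⟶ Y), NullHomotopic f → NullHomotopic (F.map f)) :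
    K B N ⥤ K B M :=
  CategoryTheory.Quotient.lift _ (F ⋙ toK B M) (fun X Y f g h => CategoryTheory.Quotient.sound _ (by
    have := hF _ h
    rwa [hsub] at this))

/-! ### Prolongation and contraction -/

/-- Restriction of an `N`-complex along a monotone map `φ` with `φ (i + P) = φ i + N`. -/
def reindexC {N P : ℕ} (φ : ℤ → ℤ) (hφ : Monotone φ) (h : ∀ i, φ (i + P) = φ i + N) :
    Cpx B N ⥤ Cpx B P where
  obj X := ⟨hφ.functor ⋙ X.obj, fun i => by
    have e := dd_eq_zero X (a := φ i) (b := φ (i + P)) (h i).ge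
    rwa [dd_of_le X.obj (hφ (by omega))] at e⟩
  map f := ObjectProperty.homMk (Functor.whiskerLeft hφ.functor f.hom)

lemma dd_reindexC {N P : ℕ} {φ : ℤ → ℤ} (hφ : Monotone φ) (h : ∀ i, φ (i + P) = φ i + N)
    (X : Cpx B N) {a b : ℤ} (hab : a ≤ b) :
    dd ((reindexC φ hφ h).obj X).obj a b = dd X.obj (φ a) (φ b) := by
  rw [dd_of_le _ hab, dd_of_le _ (hφ hab)]; rfl

lemma sum_Ico_add {A : Type*} [AddCommGroup A] {a b c : ℤ} (hab : a ≤ b) (hbc : b ≤ c)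
    (g : ℤ → A) : ∑ m ∈ Finset.Ico a c, g m =
      ∑ m ∈ Finset.Ico a b, g m + ∑ m ∈ Finset.Ico b c, g m := by
  rw [← Finset.sum_union (Finset.disjoint_left.2 fun x hx hx' => by
    simp only [Finset.mem_Ico] at hx hx'; omega)]
  refine Finset.sum_congr ?_ fun _ _ => rfl
  ext x; simp only [Finset.mem_Ico, Finset.mem_union]; omega

lemma sum_Ico_reindex {A : Type*} [AddCommGroup A] (φ : ℤ → ℤ) (hφ : Monotone φ) (g : ℤ → A)
    (i : ℤ) (k : ℕ) : ∑ n ∈ Finset.Ico i (i + k), ∑ m ∈ Finset.Ico (φ n) (φ (n + 1)), g m =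
      ∑ m ∈ Finset.Ico (φ i) (φ (i + k)), g m := by
  induction k with
  | zero => simp
  | succ k ih =>
    rw [sum_Ico_add (b := i + k) (c := i + (k + 1 : ℕ)) (by omega) (by omega), ih,
      sum_Ico_add (a := φ i) (b := φ (i + k)) (c := φ (i + (k + 1 : ℕ))) (hφ (by omega)) (hφ (by omega))]
    congr 1
    have : Finset.Ico (i + (k : ℤ)) (i + (k + 1 : ℕ)) = {i + (k : ℤ)} := by
      ext x; simp only [Finset.mem_Ico, Finset.mem_singleton]; omega
    rw [this, Finset.sum_singleton]
    congr 3
    push_cast; ring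

lemma NullHomotopic.reindex {N P : ℕ} {φ : ℤ → ℤ} (hφ : Monotone φ)
    (h : ∀ i, φ (i + P) = φ i + N) {X Y : Cpx B N} {f : X ⟶ Y} (hf : NullHomotopic f) :
    NullHomotopic ((reindexC φ hφ h).map f) := by
  obtain ⟨s, hs⟩ := hf
  refine ⟨fun i => ∑ n ∈ Finset.Ico (φ i) (φ (i + 1)),
    dd X.obj (φ i) n ≫ s n ≫ dd Y.obj (n - N + 1) (φ (i - P + 1)), fun i => ?_⟩
  have e : ((reindexC φ hφ h).map f).hom.app i = f.hom.app (φ i) := rfl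
  rw [e, hs, ← h, ← sum_Ico_reindex φ hφ]
  refine Finset.sum_congr rfl fun n hn => ?_
  rw [Finset.mem_Ico] at hn
  rw [dd_reindexC hφ h X hn.1, dd_reindexC hφ h Y (by omega)]
  erw [Preadditive.sum_comp, Preadditive.comp_sum]
  refine Finset.sum_congr rfl fun m hm => ?_
  rw [Finset.mem_Ico] at hm
  have e1 := h (n - P + 1)
  rw [show n - P + 1 + (P : ℤ) = n + 1 by ring] at e1
  have h1 : φ i ≤ φ n := hφ hn.1
  have h2 : φ (n - P + 1) ≤ φ i := hφ (by omega)
  have key : dd X.obj (φ i) m ≫ s m ≫ dd Y.obj (m - N + 1) (φ i) = dd X.obj (φ i) (φ n) ≫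
      (dd X.obj (φ n) m ≫ s m ≫ dd Y.obj (m - N + 1) (φ (n - P + 1))) ≫
        dd Y.obj (φ (n - P + 1)) (φ i) := by
    simp only [Category.assoc]
    rw [dd_comp Y.obj (by omega) h2, dd_comp_assoc X.obj h1 hm.1]
  exact key

/-- Restriction along `φ` on homotopy categories. -/
def reindex {N P : ℕ} (φ : ℤ → ℤ) (hφ : Monotone φ) (h : ∀ i, φ (i + P) = φ i + N) :
    K B N ⥤ K B P :=
  liftK (reindexC φ hφ h) (fun _ _ _ _ => rfl) (fun _ _ _ hf => hf.reindex hφ h)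

/-- The function `ι_s^{(M)}`: for `0 ≤ i < M + 1` it sends `s + i + k (M + 1)` to `s + k M` if
`i = 0` and to `s + i - 1 + k M` otherwise. -/
def iotaFun (s : ℤ) (M : ℕ) (n : ℤ) : ℤ :=
  if (n - s) % (M + 1) = 0 then s + (n - s) / (M + 1) * M
  else s + (n - s) % (M + 1) - 1 + (n - s) / (M + 1) * M

/-- The function `ρ_s^{(M+1)}`: for `0 ≤ i < M` it sends `s + i + k M` to `s + k (M + 1)` if
`i = 0` and to `s + i + 1 + k (M + 1)` otherwise. -/
def rhoFun (s : ℤ) (M : ℕ) (n : ℤ) : ℤ :=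
  if (n - s) % M = 0 then s + (n - s) / M * (M + 1)
  else s + (n - s) % M + 1 + (n - s) / M * (M + 1)

lemma iotaFun_add (s : ℤ) (M : ℕ) (n : ℤ) :
    iotaFun s M (n + (M + 1 : ℕ)) = iotaFun s M n + M := by
  have e : n + ((M + 1 : ℕ) : ℤ) - s = n - s + (M + 1 : ℤ) * 1 := by push_cast; ring
  unfold iotaFun
  rw [e, Int.add_mul_emod_self_left, Int.add_mul_ediv_left _ _ (by omega)]
  split_ifs <;> ring

lemma rhoFun_add (s : ℤ) (M : ℕ) (hM : 0 < M) (n : ℤ) :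
    rhoFun s M (n + M) = rhoFun s M n + (M + 1 : ℕ) := by
  have e : n + (M : ℤ) - s = n - s + (M : ℤ) * 1 := by ring
  unfold rhoFun
  rw [e, Int.add_mul_emod_self_left, Int.add_mul_ediv_left _ _ (by omega)]
  split_ifs <;> push_cast <;> ring

lemma emod_ediv_succ (a m : ℤ) (hm : 0 < m) :
    ((a + 1) % m = a % m + 1 ∧ (a + 1) / m = a / m) ∨
      ((a + 1) % m = 0 ∧ (a + 1) / m = a / m + 1 ∧ a % m = m - 1) := by
  have h1 := Int.emod_add_mul_ediv a m
  have h2 := Int.emod_nonneg a hm.ne'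
  have h3 := Int.emod_lt_of_pos a hm
  by_cases h : a % m + 1 < m
  · left
    have e : a + 1 = (a % m + 1) + m * (a / m) := by linarith
    constructor
    · rw [e, Int.add_mul_emod_self_left, Int.emod_eq_of_lt (by omega) h]
    · rw [e, Int.add_mul_ediv_left _ _ hm.ne', Int.ediv_eq_zero_of_lt (by omega) h, zero_add]
  · right
    have e : a + 1 = 0 + m * (a / m + 1) := by linarith
    refine ⟨?_, ?_, by omega⟩
    · rw [e, Int.add_mul_emod_self_left, Int.zero_emod]
    · conv_lhs => rw [e, Int.add_mul_ediv_left _ _ hm.ne', Int.zero_ediv, zero_add]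

lemma iotaFun_monotone (s : ℤ) (M : ℕ) : Monotone (iotaFun s M) := by
  refine monotone_int_of_le_succ fun n => ?_
  have h2 := Int.emod_nonneg (n - s) (show (M + 1 : ℤ) ≠ 0 by omega)
  unfold iotaFun
  rw [show n + 1 - s = n - s + 1 by ring]
  rcases emod_ediv_succ (n - s) (M + 1) (by omega) with ⟨h, h'⟩ | ⟨h, h', h''⟩
  · rw [h, h']; split_ifs <;> omega
  · rw [h, h', h'', add_mul]; split_ifs <;> omega

lemma rhoFun_monotone (s : ℤ) (M : ℕ) (hM : 0 < M) : Monotone (rhoFun s M) := by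
  refine monotone_int_of_le_succ fun n => ?_
  have h2 := Int.emod_nonneg (n - s) (show (M : ℤ) ≠ 0 by omega)
  unfold rhoFun
  rw [show n + 1 - s = n - s + 1 by ring]
  rcases emod_ediv_succ (n - s) M (by omega) with ⟨h, h'⟩ | ⟨h, h', h''⟩
  · rw [h, h']; split_ifs <;> omega
  · rw [h, h', h'', add_mul]; split_ifs <;> omega

/-- The prolongation functor `I_s^{(M)} : K_M(B) ⥤ K_{M+1}(B)`, with `I_s(X)^i = X^{ι_s(i)}`; the
differential at `i` is the one of `X` if `ι_s(i) < ι_s(i+1)` and the identity if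
`ι_s(i) = ι_s(i+1)`. -/
def I (B : Type u) [Category.{v} B] [Preadditive B] (s : ℤ) (M : ℕ) : K B M ⥤ K B (M + 1) :=
  reindex (iotaFun s M) (iotaFun_monotone s M) (iotaFun_add s M)

/-- The contraction functor `J_s^{(M+1)} : K_{M+1}(B) ⥤ K_M(B)`, with `J_s(Y)^i = Y^{ρ_s(i)}`; the
differential at `i` is the composite `d^{ρ_s(i+1)-1} ⋯ d^{ρ_s(i)}`. -/
def J (B : Type u) [Category.{v} B] [Preadditive B] (s : ℤ) (M : ℕ) (hM : 0 < M) :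
    K B (M + 1) ⥤ K B M :=
  reindex (rhoFun s M) (rhoFun_monotone s M hM) (rhoFun_add s M hM)

/-- The iterated prolongation `I_s^{(M+k-1)} ⋯ I_s^{(M)} : K_M(B) ⥤ K_N(B)`, where `N = M + k`. -/
def prolong (B : Type u) [Category.{v} B] [Preadditive B] (s : ℤ) :
    ∀ (k M N : ℕ), M + k = N → (K B M ⥤ K B N)
  | 0, _, _, rfl => 𝟭 _
  | k + 1, M, _, rfl => prolong B s k M (M + k) rfl ⋙ I B s (M + k)

/-- The iterated contraction `J_s^{(M+1)} ⋯ J_s^{(M+k)} : K_N(B) ⥤ K_M(B)`, where `N = M + k`. -/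
def contract (B : Type u) [Category.{v} B] [Preadditive B] (s : ℤ) :
    ∀ (k M N : ℕ), 0 < M → M + k = N → (K B N ⥤ K B M)
  | 0, _, _, _, rfl => 𝟭 _
  | k + 1, M, _, hM, rfl => J B s (M + k) (by omega) ⋙ contract B s k M (M + k) hM rfl

/-! ### Suspension, mapping cones and triangles -/

/-- The coefficient of the composite of differentials `X^a ⟶ X^b` in the transition map of `ΣX`
starting in degree `m`. -/
def susCoeff (N : ℕ) (m a b : ℤ) : ℤ :=
  (if a = b then 1 else 0) - (if b = m + N then 1 else 0)

lemma susCoeff_sum {N : ℕ} (X : Cpx B N) {m m' m'' a b : ℤ} (h : m ≤ m') (h' : m' ≤ m'')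
    (ha : a ∈ Finset.Ioo m (m + N)) (hb : b ∈ Finset.Ioo m'' (m'' + N)) :
    ∑ c ∈ Finset.Ioo m' (m' + N), (susCoeff N m a c • dd X.obj a c) ≫
      (susCoeff N m' c b • dd X.obj c b) = susCoeff N m a b • dd X.obj a b := by
  rw [Finset.mem_Ioo] at ha hb
  have e : ∀ c, (susCoeff N m a c • dd X.obj a c) ≫ (susCoeff N m' c b • dd X.obj c b) =
      (if a = c then dd X.obj a c ≫ (susCoeff N m' c b • dd X.obj c b) else 0) -
      (if m + N = c then dd X.obj a c ≫ (susCoeff N m' c b • dd X.obj c b) else 0) := by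
    intro c
    have e' : susCoeff N m a c = (if a = c then 1 else 0) - (if m + N = c then 1 else 0) := by
      simp only [susCoeff, eq_comm]
    rw [e', sub_smul, Preadditive.sub_comp]
    split_ifs <;> simp
  simp only [e, Finset.sum_sub_distrib, Finset.sum_ite_eq, Finset.mem_Ioo, dd_self,
    Category.id_comp, Preadditive.comp_zsmul]
  by_cases hz : dd X.obj a b = 0
  · have h2 : m + N ≤ b → dd X.obj a (m + N) ≫ dd X.obj (m + N) b = 0 := fun h3 => by
      rw [dd_comp X.obj (by omega) h3, hz]
    by_cases h3 : m + N ≤ b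
    · simp [hz, h2 h3]
    · simp [hz, dd_of_lt X.obj (show b < m + N by omega)]
  · have h1 : a ≤ b := by by_contra h1; exact hz (dd_of_lt _ (by omega))
    have h2 : b < a + N := by by_contra h2; exact hz (dd_eq_zero X (by omega))
    by_cases h3 : m + N ≤ b
    · rw [dd_comp X.obj (by omega) h3]
      unfold susCoeff
      split_ifs <;> first | omega | simp
    · rw [dd_of_lt X.obj (show b < m + N by omega)]
      unfold susCoeff
      split_ifs <;> first | omega | simp

lemma cone_sum {N : ℕ} (Y : Cpx B N) {m m' m'' a : ℤ} (h : m ≤ m') (h' : m' ≤ m'')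
    (ha : a ∈ Finset.Ioo m (m + N)) :
    (if m' < m + N then dd Y.obj a m' else 0) ≫ dd Y.obj m' m'' +
      ∑ c ∈ Finset.Ioo m' (m' + N), (susCoeff N m a c • dd Y.obj a c) ≫
        (if m'' < m' + N then dd Y.obj c m'' else 0) =
      if m'' < m + N then dd Y.obj a m'' else 0 := by
  rw [Finset.mem_Ioo] at ha
  have e : ∀ c, (susCoeff N m a c • dd Y.obj a c) ≫ (if m'' < m' + N then dd Y.obj c m'' else 0) =
      (if a = c then dd Y.obj a c ≫ (if m'' < m' + N then dd Y.obj c m'' else 0) else 0) -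
      (if m + N = c then dd Y.obj a c ≫ (if m'' < m' + N then dd Y.obj c m'' else 0) else 0) := by
    intro c
    have e' : susCoeff N m a c = (if a = c then 1 else 0) - (if m + N = c then 1 else 0) := by
      simp only [susCoeff, eq_comm]
    rw [e', sub_smul, Preadditive.sub_comp]
    split_ifs <;> simp
  simp only [e, Finset.sum_sub_distrib, Finset.sum_ite_eq, Finset.mem_Ioo, dd_self,
    Category.id_comp]
  have key : ∀ c, a ≤ c → c ≤ m'' → dd Y.obj a c ≫ dd Y.obj c m'' = dd Y.obj a m'' :=
    fun c h1 h2 => dd_comp Y.obj h1 h2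
  by_cases hz : dd Y.obj a m'' = 0
  · rw [hz]
    have k1 : dd Y.obj a m' ≫ dd Y.obj m' m'' = 0 := by
      by_cases h1 : a ≤ m'
      · rw [key _ h1 h', hz]
      · rw [dd_of_lt _ (by omega), zero_comp]
    have k2 : dd Y.obj a (m + N) ≫ dd Y.obj (m + N) m'' = 0 := by
      by_cases h1 : m + N ≤ m''
      · rw [key _ (by omega) h1, hz]
      · rw [dd_of_lt Y.obj (show m'' < m + N by omega), comp_zero]
    split_ifs <;> simp [k1, k2]
  · have h1 : a ≤ m'' := by by_contra h1; exact hz (dd_of_lt _ (by omega))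
    have h2 : m'' < a + N := by by_contra h2; exact hz (dd_eq_zero Y (by omega))
    have k1 : dd Y.obj a m' ≫ dd Y.obj m' m'' = if a ≤ m' then dd Y.obj a m'' else 0 := by
      split_ifs with h3
      · exact key _ h3 h'
      · rw [dd_of_lt _ (by omega), zero_comp]
    have k2 : dd Y.obj a (m + N) ≫ dd Y.obj (m + N) m'' =
        if m + N ≤ m'' then dd Y.obj a m'' else 0 := by
      split_ifs with h3
      · exact key _ (by omega) h3
      · rw [dd_of_lt Y.obj (show m'' < m + N by omega), comp_zero]
    rw [apply_ite (fun t => t ≫ dd Y.obj m' m''), zero_comp,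
      apply_ite (fun t => dd Y.obj a (m + N) ≫ t), comp_zero, k1, k2]
    split_ifs <;> first | omega | simp

section Suspension

variable [HasFiniteBiproducts B]

attribute [local instance] hasBinaryBiproducts_of_finite_biproducts

/-- `(ΣX)^m = ⨁_{m < a < m + N} X^a`. -/
abbrev susObj (N : ℕ) (X : ℤ ⥤ B) (m : ℤ) : B :=
  ⨁ fun a : Finset.Ioo m (m + N) => X.obj a.1

/-- The map `(ΣX)^m ⟶ (ΣX)^{m'}` for `m ≤ m'`. For `m' = m + 1` it is the companion matrix: `X^a`
is mapped identically to `X^a` for `m + 1 < a < m + N`, and by `-d^{m+N-a}` to `X^{m+N}`. -/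
def susMap (N : ℕ) (X : ℤ ⥤ B) (m m' : ℤ) : susObj N X m ⟶ susObj N X m' :=
  biproduct.matrix fun a b => susCoeff N m a.1 b.1 • dd X a.1 b.1

lemma sus_hom_ext {N : ℕ} {X Y : ℤ ⥤ B} {m m' : ℤ} {f g : susObj N X m ⟶ susObj N Y m'}
    (h : ∀ a b, biproduct.ι (fun a : Finset.Ioo m (m + N) => X.obj a.1) a ≫ f ≫
      biproduct.π (fun a : Finset.Ioo m' (m' + N) => Y.obj a.1) b = biproduct.ι _ a ≫ g ≫
      biproduct.π _ b) : f = g :=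
  biproduct.hom_ext _ _ fun b => biproduct.hom_ext' _ _ fun a => h a b

lemma ι_susMap_π {N : ℕ} (X : ℤ ⥤ B) (m m' : ℤ) (a : Finset.Ioo m (m + (N : ℤ)))
    (b : Finset.Ioo m' (m' + (N : ℤ))) :
    biproduct.ι (fun a : Finset.Ioo m (m + N) => X.obj a.1) a ≫ susMap N X m m' ≫
      biproduct.π (fun a : Finset.Ioo m' (m' + N) => X.obj a.1) b =
      susCoeff N m a.1 b.1 • dd X a.1 b.1 := by
  unfold susMap
  rw [biproduct.matrix_π, biproduct.ι_desc]

lemma susMap_comp {N : ℕ} (X : Cpx B N) {m m' m'' : ℤ} (h : m ≤ m') (h' : m' ≤ m'') :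
    susMap N X.obj m m' ≫ susMap N X.obj m' m'' = susMap N X.obj m m'' := by
  refine sus_hom_ext fun a b => ?_
  rw [ι_susMap_π]
  unfold susMap
  rw [Category.assoc, biproduct.matrix_π, biproduct.matrix_desc, biproduct.ι_desc]
  exact (Finset.sum_coe_sort (Finset.Ioo m' (m' + (N : ℤ))) fun c =>
    (susCoeff N m a.1 c • dd X.obj a.1 c) ≫ (susCoeff N m' c b.1 • dd X.obj c b.1)).trans
      (susCoeff_sum X h h' a.2 b.2)

lemma susMap_self {N : ℕ} (X : ℤ ⥤ B) (m : ℤ) : susMap N X m m = 𝟙 _ := by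
  refine sus_hom_ext fun a b => ?_
  rw [ι_susMap_π, Category.id_comp]
  have hb := Finset.mem_Ioo.1 b.2
  by_cases hab : a = b
  · subst hab
    simp [susCoeff, show ¬ (a.1 = m + (N : ℤ)) by omega]
  · have h1 : ¬ (a.1 = b.1) := fun h => hab (Subtype.ext h)
    rw [biproduct.ι_π_ne _ hab]
    simp [susCoeff, h1, show ¬ (b.1 = m + (N : ℤ)) by omega]

lemma susMap_eq_zero {N : ℕ} (X : ℤ ⥤ B) {m m' : ℤ} (h : m + N ≤ m') : susMap N X m m' = 0 := by
  refine sus_hom_ext fun a b => ?_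
  have ha := Finset.mem_Ioo.1 a.2
  have hb := Finset.mem_Ioo.1 b.2
  rw [ι_susMap_π]
  simp [susCoeff, show ¬ (a.1 = b.1) by omega, show ¬ (b.1 = m + (N : ℤ)) by omega]

/-- The map `(ΣX)^m ⟶ (ΣY)^m` with components `f^a`. -/
def susHom (N : ℕ) {X Y : ℤ ⥤ B} (f : X ⟶ Y) (m : ℤ) : susObj N X m ⟶ susObj N Y m :=
  biproduct.map fun a => f.app a.1

lemma ι_susHom {N : ℕ} {X Y : ℤ ⥤ B} (f : X ⟶ Y) (m : ℤ) (a : Finset.Ioo m (m + (N : ℤ))) :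
    biproduct.ι (fun a : Finset.Ioo m (m + N) => X.obj a.1) a ≫ susHom N f m =
      f.app a.1 ≫ biproduct.ι (fun a : Finset.Ioo m (m + N) => Y.obj a.1) a := by
  simp [susHom]

lemma susHom_π {N : ℕ} {X Y : ℤ ⥤ B} (f : X ⟶ Y) (m : ℤ) (a : Finset.Ioo m (m + (N : ℤ))) :
    susHom N f m ≫ biproduct.π (fun a : Finset.Ioo m (m + N) => Y.obj a.1) a =
      biproduct.π (fun a : Finset.Ioo m (m + N) => X.obj a.1) a ≫ f.app a.1 := by
  simp [susHom]

lemma susHom_naturality {N : ℕ} {X Y : ℤ ⥤ B} (f : X ⟶ Y) (m m' : ℤ) :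
    susMap N X m m' ≫ susHom N f m' = susHom N f m ≫ susMap N Y m m' := by
  refine sus_hom_ext fun a b => ?_
  have h1 := ι_susMap_π (N := N) X m m' a b
  have h2 := ι_susMap_π (N := N) Y m m' a b
  rw [Category.assoc, susHom_π, ← Category.assoc (susMap N X m m'), ← Category.assoc, h1,
    Category.assoc, ← Category.assoc, ι_susHom, Category.assoc, h2, Preadditive.zsmul_comp,
    Preadditive.comp_zsmul, dd_naturality]

/-- The suspension `Σ : C_N(B) ⥤ C_N(B)`. -/
def susC (B : Type u) [Category.{v} B] [Preadditive B] [HasFiniteBiproducts B] (N : ℕ) :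
    Cpx B N ⥤ Cpx B N where
  obj X :=
    ⟨{ obj := fun m => susObj N X.obj m
       map := fun {m m'} _ => susMap N X.obj m m'
       map_id := fun m => susMap_self X.obj m
       map_comp := fun f g => (susMap_comp X f.le g.le).symm },
      fun m => susMap_eq_zero X.obj le_rfl⟩
  map f := ObjectProperty.homMk
    { app := fun m => susHom N f.hom m
      naturality := fun m m' _ => susHom_naturality f.hom m m' }
  map_id X := by
    apply ObjectProperty.hom_ext
    ext m : 2
    refine sus_hom_ext (N := N) (X := X.obj) (Y := X.obj) fun a b => ?_
    change _ ≫ susHom N (𝟙 X.obj) m ≫ _ = _ ≫ 𝟙 (susObj N X.obj m) ≫ _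
    rw [susHom_π]
    simp
  map_comp {X Y Z} f g := by
    apply ObjectProperty.hom_ext
    ext m : 2
    refine sus_hom_ext (N := N) (X := X.obj) (Y := Z.obj) fun a b => ?_
    change _ ≫ susHom N (f.hom ≫ g.hom) m ≫ _ = _ ≫ (susHom N f.hom m ≫ susHom N g.hom m) ≫ _
    rw [Category.assoc, susHom_π, susHom_π, ← Category.assoc (susHom N f.hom m), susHom_π]
    simp

/-! The suspension of a null-homotopic morphism is null-homotopic. -/

/-- The component in degree `m` of the homotopy on the suspension, before inclusion into `ΣY`. -/
def susTau {N : ℕ} {X Y : ℤ ⥤ B} (s : ∀ n : ℤ, X.obj n ⟶ Y.obj (n - N + 1)) (m : ℤ) :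
    susObj N X m ⟶ Y.obj m :=
  biproduct.desc fun a =>
    - ∑ n ∈ Finset.Ico a.1 (m + N), dd X a.1 n ≫ s n ≫ dd Y (n - N + 1) m

/-- The inclusion of `Y^m` into `(ΣY)^{m-N+1}`. -/
def susKappa (N : ℕ) (Y : ℤ ⥤ B) (m : ℤ) : Y.obj m ⟶ susObj N Y (m - N + 1) :=
  biproduct.lift fun b => if m = b.1 then dd Y m b.1 else 0

lemma susKappa_map {N : ℕ} (hN : 2 ≤ N) (Y : ℤ ⥤ B) (c m : ℤ) (b : Finset.Ioo m (m + (N : ℤ))) :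
    susKappa N Y c ≫ susMap N Y (c - N + 1) m ≫
      biproduct.π (fun a : Finset.Ioo m (m + N) => Y.obj a.1) b =
      (if b.1 = c then dd Y c b.1 else 0) - (if b.1 - 1 = c then dd Y c b.1 else 0) := by
  unfold susMap susKappa
  rw [biproduct.matrix_π, biproduct.lift_desc]
  rw [Finset.sum_coe_sort (Finset.Ioo (c - N + 1) (c - N + 1 + (N : ℤ))) (fun e =>
    (if c = e then dd Y c e else 0) ≫ (susCoeff N (c - N + 1) e b.1 • dd Y e b.1))]
  rw [Finset.sum_eq_single c]
  · rw [if_pos rfl, dd_self, Category.id_comp, susCoeff, sub_smul, ite_smul, ite_smul]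
    congr 1
    · simp [eq_comm]
    · simp only [one_smul, zero_smul]
      congr 1
      simp only [eq_iff_iff]; omega
  · intro e _ he
    rw [if_neg (Ne.symm he), zero_comp]
  · intro h
    exact absurd (Finset.mem_Ioo.2 ⟨by omega, by omega⟩) h

lemma ι_susMap_susTau {N : ℕ} {X Y : Cpx B N} (f : X ⟶ Y)
    (s : ∀ n : ℤ, X.obj.obj n ⟶ Y.obj.obj (n - N + 1))
    (hs : ∀ i : ℤ, f.hom.app i =
      ∑ n ∈ Finset.Ico i (i + N), dd X.obj i n ≫ s n ≫ dd Y.obj (n - N + 1) i)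
    {m c : ℤ} (h : m ≤ c) (h' : c < m + N) (a : Finset.Ioo m (m + (N : ℤ))) :
    biproduct.ι (fun a : Finset.Ioo m (m + N) => X.obj.obj a.1) a ≫ susMap N X.obj m c ≫
      susTau s c = f.hom.app a.1 ≫ dd Y.obj a.1 c -
        ∑ n ∈ Finset.Ico a.1 (m + N), dd X.obj a.1 n ≫ s n ≫ dd Y.obj (n - N + 1) c := by
  obtain ⟨a, ha⟩ := a
  have ha' := Finset.mem_Ioo.1 ha
  set G : ℤ → (X.obj.obj a ⟶ Y.obj.obj c) :=
    fun n => dd X.obj a n ≫ s n ≫ dd Y.obj (n - N + 1) c with hG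
  have key : ∀ e, a ≤ e → dd X.obj a e ≫
      (- ∑ n ∈ Finset.Ico e (c + N), dd X.obj e n ≫ s n ≫ dd Y.obj (n - N + 1) c) =
      - ∑ n ∈ Finset.Ico e (c + N), G n := by
    intro e he
    rw [Preadditive.comp_neg, Preadditive.comp_sum]
    congr 1
    refine Finset.sum_congr rfl fun n hn => ?_
    rw [dd_comp_assoc _ he (Finset.mem_Ico.1 hn).1]
  have lhs : biproduct.ι (fun a : Finset.Ioo m (m + (N : ℤ)) => X.obj.obj a.1) ⟨a, ha⟩ ≫
      susMap N X.obj m c ≫ susTau s c =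
      (if c < a then - ∑ n ∈ Finset.Ico a (c + N), G n else 0) +
        (if m < c then ∑ n ∈ Finset.Ico (m + N) (c + N), G n else 0) := by
    unfold susMap susTau
    rw [biproduct.matrix_desc, biproduct.ι_desc,
      Finset.sum_coe_sort (Finset.Ioo c (c + (N : ℤ))) (fun e => (susCoeff N m a e • dd X.obj a e) ≫
        (- ∑ n ∈ Finset.Ico e (c + N), dd X.obj e n ≫ s n ≫ dd Y.obj (n - N + 1) c))]
    have e : ∀ e, (susCoeff N m a e • dd X.obj a e) ≫
        (- ∑ n ∈ Finset.Ico e (c + N), dd X.obj e n ≫ s n ≫ dd Y.obj (n - N + 1) c) =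
        (if a = e then (- ∑ n ∈ Finset.Ico e (c + N), G n) else 0) +
        (if m + N = e then (∑ n ∈ Finset.Ico e (c + N), G n) else 0) := by
      intro e
      have e' : susCoeff N m a e = (if a = e then 1 else 0) - (if m + N = e then 1 else 0) := by
        simp only [susCoeff, eq_comm]
      rw [e', Preadditive.zsmul_comp]
      by_cases he : a ≤ e
      · rw [key e he]
        split_ifs <;> simp
      · rw [if_neg (by omega), if_neg (by omega), if_neg (by omega), if_neg (by omega)]
        simp
    simp only [e, Finset.sum_add_distrib, Finset.sum_ite_eq, Finset.mem_Ioo]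
    congr 1 <;> congr 1 <;> (simp only [eq_iff_iff]; omega)
  rw [lhs]
  by_cases hac : a ≤ c
  · rw [if_neg (by omega), if_pos (by omega), zero_add, hs, Preadditive.sum_comp]
    have e1 : ∑ n ∈ Finset.Ico a (a + (N : ℤ)),
        (dd X.obj a n ≫ s n ≫ dd Y.obj (n - N + 1) a) ≫ dd Y.obj a c =
        ∑ n ∈ Finset.Ico a (a + (N : ℤ)), G n := by
      refine Finset.sum_congr rfl fun n hn => ?_
      rw [Finset.mem_Ico] at hn
      simp only [Category.assoc, hG]
      rw [dd_comp _ (by omega) hac]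
    have e2 : ∑ n ∈ Finset.Ico (a + (N : ℤ)) (c + N), G n = 0 := by
      refine Finset.sum_eq_zero fun n hn => ?_
      simp only [hG]
      rw [dd_eq_zero X (Finset.mem_Ico.1 hn).1, zero_comp]
    have e3 := sum_Ico_add (show a ≤ a + (N : ℤ) by omega) (show a + (N : ℤ) ≤ c + N by omega) G
    have e4 := sum_Ico_add (show a ≤ m + (N : ℤ) by omega) (show m + (N : ℤ) ≤ c + N by omega) G
    rw [e1, eq_sub_iff_add_eq]
    exact (add_comm _ _).trans (e4.symm.trans <| by rw [e3, e2, add_zero])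
  · have e4 := sum_Ico_add (show a ≤ m + (N : ℤ) by omega) (show m + (N : ℤ) ≤ c + N by omega) G
    have e5 : (if m < c then ∑ n ∈ Finset.Ico (m + (N : ℤ)) (c + N), G n else 0) =
        ∑ n ∈ Finset.Ico (m + (N : ℤ)) (c + N), G n := by
      split_ifs with hmc
      · rfl
      · rw [Finset.Ico_eq_empty (by omega), Finset.sum_empty]
    rw [if_pos (by omega), e5, dd_of_lt Y.obj (show c < a by omega), comp_zero, e4]
    abel

lemma NullHomotopic.sus {N : ℕ} {X Y : Cpx B N} {f : X ⟶ Y} (hf : NullHomotopic f) :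
    NullHomotopic ((susC B N).map f) := by
  by_cases hN : 2 ≤ N
  · obtain ⟨s, hs⟩ := hf
    refine ⟨fun m => susTau s m ≫ susKappa N Y.obj m, fun m => ?_⟩
    have e0 : ∑ c ∈ Finset.Ico m (m + (N : ℤ)), dd ((susC B N).obj X).obj m c ≫
        (susTau s c ≫ susKappa N Y.obj c) ≫ dd ((susC B N).obj Y).obj (c - N + 1) m =
        ∑ c ∈ Finset.Ico m (m + (N : ℤ)), susMap N X.obj m c ≫
          (susTau s c ≫ susKappa N Y.obj c) ≫ susMap N Y.obj (c - N + 1) m := by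
      refine Finset.sum_congr rfl fun c hc => ?_
      rw [Finset.mem_Ico] at hc
      rw [dd_of_le _ hc.1, dd_of_le _ (show c - N + 1 ≤ m by omega)]
      rfl
    refine Eq.trans ?_ e0.symm
    change susHom N f.hom m = _
    refine sus_hom_ext fun a b => ?_
    have ha := Finset.mem_Ioo.1 a.2
    have hb := Finset.mem_Ioo.1 b.2
    rw [Preadditive.sum_comp, Preadditive.comp_sum, susHom_π]
    set T : ∀ c, X.obj.obj a.1 ⟶ Y.obj.obj c := fun c => f.hom.app a.1 ≫ dd Y.obj a.1 c -
        ∑ n ∈ Finset.Ico a.1 (m + N), dd X.obj a.1 n ≫ s n ≫ dd Y.obj (n - N + 1) c with hT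
    have e1 : ∀ c ∈ Finset.Ico m (m + (N : ℤ)),
        biproduct.ι (fun a : Finset.Ioo m (m + (N : ℤ)) => X.obj.obj a.1) a ≫
          (susMap N X.obj m c ≫ (susTau s c ≫ susKappa N Y.obj c) ≫
            susMap N Y.obj (c - N + 1) m) ≫
          biproduct.π (fun a : Finset.Ioo m (m + (N : ℤ)) => Y.obj.obj a.1) b =
        (if b.1 = c then T c ≫ dd Y.obj c b.1 else 0) -
          (if b.1 - 1 = c then T c ≫ dd Y.obj c b.1 else 0) := by
      intro c hc
      rw [Finset.mem_Ico] at hc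
      have h1 := ι_susMap_susTau f s hs hc.1 hc.2 a
      have h2 := susKappa_map hN Y.obj c m b
      simp only [Category.assoc]
      rw [h2, ← Category.assoc (susMap N X.obj m c), ← Category.assoc, h1, Preadditive.comp_sub]
      split_ifs <;> simp [hT]
    rw [Finset.sum_congr rfl e1, Finset.sum_sub_distrib, Finset.sum_ite_eq, Finset.sum_ite_eq,
      if_pos (Finset.mem_Ico.2 ⟨by omega, by omega⟩), if_pos (Finset.mem_Ico.2 ⟨by omega, by omega⟩)]
    have e2 : ∑ n ∈ Finset.Ico a.1 (m + (N : ℤ)),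
        (dd X.obj a.1 n ≫ s n ≫ dd Y.obj (n - N + 1) (b.1 - 1)) ≫ dd Y.obj (b.1 - 1) b.1 =
        ∑ n ∈ Finset.Ico a.1 (m + (N : ℤ)), dd X.obj a.1 n ≫ s n ≫ dd Y.obj (n - N + 1) b.1 := by
      refine Finset.sum_congr rfl fun n hn => ?_
      rw [Finset.mem_Ico] at hn
      simp only [Category.assoc]
      rw [dd_comp _ (by omega) (by omega)]
    simp only [hT, dd_self, Category.comp_id, Preadditive.sub_comp]
    rw [Preadditive.sum_comp, e2, Category.assoc]
    rw [sub_sub_sub_cancel_right]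
    by_cases hab : a = b
    · subst hab
      rw [dd_self, dd_of_lt Y.obj (show a.1 - 1 < a.1 by omega)]
      simp
    · have hab' : a.1 ≠ b.1 := fun h => hab (Subtype.ext h)
      rw [← Category.assoc, biproduct.ι_π_ne _ hab, zero_comp]
      by_cases hlt : a.1 ≤ b.1
      · rw [dd_comp _ (by omega) (by omega), sub_self]
      · rw [dd_of_lt Y.obj (show b.1 < a.1 by omega),
          dd_of_lt Y.obj (show b.1 - 1 < a.1 by omega)]
        simp
  · refine ⟨fun _ => 0, fun m => ?_⟩
    refine sus_hom_ext (N := N) (X := X.obj) (Y := Y.obj) fun a b => ?_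
    have ha := Finset.mem_Ioo.1 a.2
    omega

/-- The suspension functor `Σ : K_N(B) ⥤ K_N(B)`. -/
def sus (B : Type u) [Category.{v} B] [Preadditive B] [HasFiniteBiproducts B] (N : ℕ) :
    K B N ⥤ K B N :=
  liftK (susC B N)
    (fun X Y f g => by
      apply ObjectProperty.hom_ext
      ext m : 2
      refine sus_hom_ext (N := N) (X := X.obj) (Y := Y.obj) fun a b => ?_
      change _ ≫ susHom N (f.hom - g.hom) m ≫ _ =
        _ ≫ (susHom N f.hom m - susHom N g.hom m) ≫ _
      rw [Preadditive.sub_comp, susHom_π, susHom_π, susHom_π, ← Preadditive.comp_sub]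
      rfl)
    (fun _ _ _ hf => hf.sus)

/-- The component `(ΣX)^m ⟶ Y^{m'}` of the transition maps of the mapping cone. -/
def conePart {N : ℕ} {X Y : ℤ ⥤ B} (f : X ⟶ Y) (m m' : ℤ) : susObj N X m ⟶ Y.obj m' :=
  biproduct.desc fun a => f.app a.1 ≫ (if m' < m + N then dd Y a.1 m' else 0)

/-- The transition map `C(f)^m ⟶ C(f)^{m'}` for `m ≤ m'`, where `C(f)^m = Y^m ⊕ (ΣX)^m`. The
component `X^a ⟶ Y^{m'}` is `d^{m'-a} f^a` if `a ≤ m' < m + N` and zero otherwise; for `m' = m + 1`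
(and `N ≥ 2`) this is `f` on `X^{m+1}`, and zero on the other summands. -/
def coneMap {N : ℕ} {X Y : ℤ ⥤ B} (f : X ⟶ Y) (m m' : ℤ) :
    Y.obj m ⊞ susObj N X m ⟶ Y.obj m' ⊞ susObj N X m' :=
  Biprod.ofComponents (dd Y m m') 0 (conePart f m m') (susMap N X m m')

lemma conePart_comp {N : ℕ} {X Y : Cpx B N} (f : X ⟶ Y) {m m' m'' : ℤ} (h : m ≤ m')
    (h' : m' ≤ m'') : conePart (N := N) f.hom m m' ≫ dd Y.obj m' m'' +
      susMap N X.obj m m' ≫ conePart f.hom m' m'' = conePart f.hom m m'' := by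
  refine biproduct.hom_ext' _ _ fun a => ?_
  unfold susMap conePart
  rw [biproduct.matrix_desc, Preadditive.comp_add, biproduct.ι_desc, biproduct.ι_desc,
    ← Category.assoc, biproduct.ι_desc, ← cone_sum Y h h' a.2, Preadditive.comp_add,
    Category.assoc, Preadditive.comp_sum, ← Finset.sum_coe_sort (Finset.Ioo m' (m' + (N : ℤ)))]
  refine congrArg₂ _ rfl (Finset.sum_congr rfl fun c _ => ?_)
  rw [Preadditive.zsmul_comp, Preadditive.zsmul_comp, Preadditive.comp_zsmul,
    ← Category.assoc, dd_naturality, Category.assoc]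

lemma coneMap_comp {N : ℕ} {X Y : Cpx B N} (f : X ⟶ Y) {m m' m'' : ℤ} (h : m ≤ m')
    (h' : m' ≤ m'') : coneMap (N := N) f.hom m m' ≫ coneMap f.hom m' m'' = coneMap f.hom m m'' := by
  unfold coneMap
  rw [Biprod.ofComponents_comp, dd_comp _ h h', susMap_comp X h h', conePart_comp f h h']
  simp

lemma coneMap_self {N : ℕ} {X Y : ℤ ⥤ B} (f : X ⟶ Y) (m : ℤ) :
    coneMap (N := N) f m m = 𝟙 _ := by
  have e : conePart (N := N) f m m = 0 := by
    refine biproduct.hom_ext' _ _ fun a => ?_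
    have ha := Finset.mem_Ioo.1 a.2
    unfold conePart
    rw [biproduct.ι_desc, dd_of_lt Y ha.1]
    simp
  unfold coneMap
  rw [e, susMap_self]
  apply biprod.hom_ext' <;> simp

lemma coneMap_eq_zero {N : ℕ} {X Y : Cpx B N} (f : X ⟶ Y) {m m' : ℤ} (h : m + N ≤ m') :
    coneMap (N := N) f.hom m m' = 0 := by
  have e : conePart (N := N) f.hom m m' = 0 := by
    refine biproduct.hom_ext' _ _ fun a => ?_
    unfold conePart
    rw [biproduct.ι_desc, if_neg (by omega)]
    simp
  unfold coneMap
  rw [e, susMap_eq_zero X.obj h, dd_eq_zero Y h]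
  apply biprod.hom_ext' <;> simp

/-- The mapping cone of a morphism of `N`-complexes. -/
def cone {N : ℕ} {X Y : Cpx B N} (f : X ⟶ Y) : Cpx B N :=
  ⟨{ obj := fun m => Y.obj.obj m ⊞ susObj N X.obj m
     map := fun {m m'} _ => coneMap f.hom m m'
     map_id := fun m => coneMap_self f.hom m
     map_comp := fun g g' => (coneMap_comp f g.le g'.le).symm },
    fun _ => coneMap_eq_zero f le_rfl⟩

/-- The inclusion `Y ⟶ C(f)`. -/
def coneIn {N : ℕ} {X Y : Cpx B N} (f : X ⟶ Y) : Y ⟶ cone f :=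
  ObjectProperty.homMk
    { app := fun m => (biprod.inl : Y.obj.obj m ⟶ Y.obj.obj m ⊞ susObj N X.obj m)
      naturality := fun m m' g => by
        change Y.obj.map g ≫ biprod.inl = biprod.inl ≫ coneMap f.hom m m'
        unfold coneMap
        rw [Biprod.inl_ofComponents, dd_of_le Y.obj g.le]
        simp
        rfl }

/-- The projection `C(f) ⟶ ΣX`. -/
def coneOut {N : ℕ} {X Y : Cpx B N} (f : X ⟶ Y) : cone f ⟶ (susC B N).obj X :=
  ObjectProperty.homMk
    { app := fun m => (biprod.snd : Y.obj.obj m ⊞ susObj N X.obj m ⟶ susObj N X.obj m)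
      naturality := fun m m' g => by
        change coneMap f.hom m m' ≫ biprod.snd = biprod.snd ≫ susMap N X.obj m m'
        unfold coneMap
        rw [Biprod.ofComponents_snd]
        simp }

end Suspension

/-- A suspension functor and a class of triangles `X ⟶ Y ⟶ Z ⟶ ΣX` on a category. -/
class TriangleData (C : Type*) [Category* C] where
  /-- the suspension functor -/
  susp : C ⥤ C
  /-- the distinguished triangles `(u, v, w)` -/
  dist : ∀ {X Y Z : C}, (X ⟶ Y) → (Y ⟶ Z) → (Z ⟶ susp.obj X) → Prop

/-- The suspension and the distinguished triangles make the category a triangulated category. -/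
def IsTriangulatedCategory (C : Type*) [Category* C] [Preadditive C] [TriangleData C] : Prop :=
  ∃ (_ : HasZeroObject C) (_ : HasShift C ℤ) (_ : ∀ n : ℤ, (shiftFunctor C n).Additive)
    (_ : Pretriangulated C) (e : shiftFunctor C (1 : ℤ) ≅ TriangleData.susp),
    IsTriangulated C ∧
      ∀ {X Y Z : C} (u : X ⟶ Y) (v : Y ⟶ Z) (w : Z ⟶ (shiftFunctor C (1 : ℤ)).obj X),
        Pretriangulated.Triangle.mk u v w ∈ Pretriangulated.distinguishedTriangles ↔
          TriangleData.dist u v (w ≫ e.hom.app X)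

/-- `F` is a triangle functor: it is additive, and for a suitable natural isomorphism
`θ : F Σ ≅ Σ F` it sends distinguished triangles to distinguished triangles. -/
def IsTriangleFunctor {C D : Type*} [Category* C] [Category* D] [Preadditive C] [Preadditive D]
    [TriangleData C] [TriangleData D] (F : C ⥤ D) : Prop :=
  F.Additive ∧ ∃ θ : TriangleData.susp ⋙ F ≅ F ⋙ TriangleData.susp,
    ∀ {X Y Z : C} (u : X ⟶ Y) (v : Y ⟶ Z) (w : Z ⟶ TriangleData.susp.obj X),
      TriangleData.dist u v w → TriangleData.dist (F.map u) (F.map v) (F.map w ≫ θ.hom.app X)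

/-- A recollement of triangulated categories: `D'` on the left, `D` in the middle, `D''` on the
right, with functors `i^*, i^! : D ⥤ D'`, `i_* : D' ⥤ D`, `j_!, j_* : D'' ⥤ D`, `j^* : D ⥤ D''`. -/
structure IsRecollement {D' D D'' : Type*} [Category* D'] [Category* D] [Category* D'']
    [Preadditive D'] [Preadditive D] [Preadditive D'']
    [TriangleData D'] [TriangleData D] [TriangleData D'']
    (iUpperStar : D ⥤ D') (iLowerStar : D' ⥤ D) (iUpperShriek : D ⥤ D')
    (jLowerShriek : D'' ⥤ D) (jUpperStar : D ⥤ D'') (jLowerStar : D'' ⥤ D) : Prop where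
  triangulated_left : IsTriangulatedCategory D'
  triangulated_middle : IsTriangulatedCategory D
  triangulated_right : IsTriangulatedCategory D''
  triangle_iUpperStar : IsTriangleFunctor iUpperStar
  triangle_iLowerStar : IsTriangleFunctor iLowerStar
  triangle_iUpperShriek : IsTriangleFunctor iUpperShriek
  triangle_jLowerShriek : IsTriangleFunctor jLowerShriek
  triangle_jUpperStar : IsTriangleFunctor jUpperStar
  triangle_jLowerStar : IsTriangleFunctor jLowerStar
  full_iLowerStar : iLowerStar.Full
  faithful_iLowerStar : iLowerStar.Faithful
  full_jLowerShriek : jLowerShriek.Full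
  faithful_jLowerShriek : jLowerShriek.Faithful
  full_jLowerStar : jLowerStar.Full
  faithful_jLowerStar : jLowerStar.Faithful
  adj_iUpperStar_iLowerStar : Nonempty (iUpperStar ⊣ iLowerStar)
  adj_iLowerStar_iUpperShriek : Nonempty (iLowerStar ⊣ iUpperShriek)
  adj_jLowerShriek_jUpperStar : Nonempty (jLowerShriek ⊣ jUpperStar)
  adj_jUpperStar_jLowerStar : Nonempty (jUpperStar ⊣ jLowerStar)
  /-- `Im j_! = Ker i^*` -/
  image_jLowerShriek : ∀ X : D, jLowerShriek.essImage X ↔ IsZero (iUpperStar.obj X)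
  /-- `Im i_* = Ker j^*` -/
  image_iLowerStar : ∀ X : D, iLowerStar.essImage X ↔ IsZero (jUpperStar.obj X)
  /-- `Im j_* = Ker i^!` -/
  image_jLowerStar : ∀ X : D, jLowerStar.essImage X ↔ IsZero (iUpperShriek.obj X)

/-- The suspension on `K_N(B)`, and as distinguished triangles those isomorphic in `K_N(B)` to
`X ⟶ Y ⟶ C(f) ⟶ ΣX` for a morphism `f : X ⟶ Y` of `N`-complexes. -/
instance (N : ℕ) [HasFiniteBiproducts B] : TriangleData (K B N) where
  susp := sus B N
  dist {X Y Z} u v w := ∃ (X' Y' : Cpx B N) (f : X' ⟶ Y') (α : X ≅ (toK B N).obj X')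
    (β : Y ≅ (toK B N).obj Y') (γ : Z ≅ (toK B N).obj (cone f)),
    u ≫ β.hom = α.hom ≫ (toK B N).map f ∧
    v ≫ γ.hom = β.hom ≫ (toK B N).map (coneIn f) ∧
    w ≫ (sus B N).map α.hom = γ.hom ≫ (toK B N).map (coneOut f)

end NCpx

end

/-! ### Triangulated structures from a suspension functor: the formal part. -/

noncomputable section

namespace NCpx

/-! ### The shift by `ℤ` defined by an autoequivalence -/

section Shift

universe v₁ u₁

variable {C : Type u₁} [Category.{v₁} C]

/-! Every functor in the recollement is restriction of complexes along a monotone `φ : ℤ → ℤ` with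
`φ (i + P) = φ i + N`, and the recollement comes from inequalities between such functions. If `n ≤ r
(l n)` and `l (r n) ≤ n`, the transition maps of the complexes are the unit and counit of an
adjunction between restriction along `r` and along `l` (`reindexAdjunction`). On one period the
iterated prolongation function is `max (n - k) s`. The contraction functions based at `s` and at `s
- 1` are sections of it, one giving its right adjoint, the other its left adjoint. This yields the
four adjunctions and full faithfulness.

For the kernels put `c = r + s` and consider the period `[s, s + N)`. There `j_! j^*` and `i_* i^*`
are restriction along `min n c` and `max n c`. The square on `X^{min n c}`, `X^n`, `X^c`, `X^{max n
c}` has two opposite sides that are identities, so `X ∘ min ⟶ X ⊕ X ∘ ε ⟶ X ∘ max` is termwise split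
exact, where `ε` has constant value `c` on the period (`termwiseSplit_reindexC`). Restriction along
a function that is constant on a whole period is contractible (`nullHomotopic_id_reindexC`). Hence
if one outer term vanishes, the other is isomorphic to `X` (`isIso_of_isZero_reindex`). The same
contractibility gives `i^* j_! = 0`, `j^* i_* = 0` and `i^! j_* = 0`. For `i_* i^!` and `j_* j^*`
take `c = s` and the period `[r + s + 1 - N, r + s + 1)`.

The triangulation rests on termwise split sequences `X ⟶ Y ⟶ Z`. Null-homotopic maps extend and lift
along them, so a contractible end term can be discarded (`TermwiseSplit.isIso_right`,
`TermwiseSplit.isIso_left`). As `C(1_X)` is contractible, `C(X ⟶ Y)` becomes isomorphic to `Z`,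
which defines a natural `δ : Z ⟶ ΣX` and a distinguished triangle. Rotation is the computation of
`δ` for a cone (`δ_cone`), the octahedral axiom is a termwise split sequence of cones
(`termwiseSplit_coneHom`), and `Σ` is invertible because `Σ²` is translation by `N`
(`susSquareIso`). Restriction preserves termwise split sequences and contractible complexes, hence
triangles. -/

/-- A sequence of objects related by isomorphisms `F (X n) ≅ X (n + 1)`. -/
structure Spectrum (F : C ⥤ C) where
  /-- the objects -/
  obj : ℤ → C
  /-- the structure isomorphisms -/
  iso : ∀ n, F.obj (obj n) ≅ obj (n + 1)

namespace Spectrum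

variable {F : C ⥤ C}

/-- Morphisms of spectra. -/
@[ext]
structure Hom (X Y : Spectrum F) where
  /-- the components -/
  app : ∀ n, X.obj n ⟶ Y.obj n
  comm : ∀ n, F.map (app n) ≫ (Y.iso n).hom = (X.iso n).hom ≫ app (n + 1)

@[simps]
instance : Category (Spectrum F) where
  Hom X Y := Hom X Y
  id X := ⟨fun _ => 𝟙 _, by simp⟩
  comp f g := ⟨fun n => f.app n ≫ g.app n, fun n => by
    rw [F.map_comp, Category.assoc, g.comm, ← Category.assoc, f.comm, Category.assoc]⟩

@[ext]
lemma hom_ext {X Y : Spectrum F} {f g : X ⟶ Y} (h : ∀ n, f.app n = g.app n) : f = g :=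
  Hom.ext (funext h)

lemma app_eqToHom {X Y : Spectrum F} (f : X ⟶ Y) {m n : ℤ} (h : m = n) :
    f.app m ≫ eqToHom (congrArg Y.obj h) = eqToHom (congrArg X.obj h) ≫ f.app n := by
  subst h; simp

lemma iso_eqToHom (X : Spectrum F) {m n : ℤ} (h : m = n) :
    (X.iso m).hom ≫ eqToHom (by rw [h]) = F.map (eqToHom (by rw [h])) ≫ (X.iso n).hom := by
  subst h; simp

lemma eqToHom_app {X Y : Spectrum F} (h : X = Y) (n : ℤ) :
    Hom.app (eqToHom h) n = eqToHom (by rw [h]) := by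
  subst h; rfl

/-- The strict shift of spectra. -/
@[simps]
def shift (F : C ⥤ C) (a : ℤ) : Spectrum F ⥤ Spectrum F where
  obj X :=
    { obj := fun n => X.obj (n + a)
      iso := fun n => X.iso (n + a) ≪≫ eqToIso (by rw [add_right_comm]) }
  map {X Y} f :=
    { app := fun n => f.app (n + a)
      comm := fun n => by
        have h : n + a + 1 = n + 1 + a := by ring
        simp only [Iso.trans_hom, eqToIso.hom]
        rw [← Category.assoc, f.comm, Category.assoc, Category.assoc, app_eqToHom f h] }

lemma comp_eqToHom_eqToHom {X Y Z W : C} (f : X ⟶ Y) (h : Y = Z) (h' : Z = W) :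
    (f ≫ eqToHom h) ≫ eqToHom h' = f ≫ eqToHom (h.trans h') := by
  subst h; subst h'; simp

/-- The isomorphism of spectra given by equalities of the components. -/
@[simps]
def isoOfEq (X Y : Spectrum F) (h : ∀ n, X.obj n = Y.obj n)
    (H : ∀ n, F.map (eqToHom (h n)) ≫ (Y.iso n).hom = (X.iso n).hom ≫ eqToHom (h (n + 1))) :
    X ≅ Y where
  hom := ⟨fun n => eqToHom (h n), H⟩
  inv := ⟨fun n => eqToHom (h n).symm, fun n => by
    rw [← cancel_mono (eqToHom (h (n + 1))), Category.assoc, ← H, ← Category.assoc,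
      ← F.map_comp]
    simp⟩

/-- The shift by zero is the identity. -/
def shiftZero (F : C ⥤ C) : shift F 0 ≅ 𝟭 (Spectrum F) :=
  NatIso.ofComponents
    (fun X => isoOfEq _ _ (fun n => congrArg X.obj (add_zero n)) (fun n => by
      exact (iso_eqToHom X (add_zero n)).symm.trans (comp_eqToHom_eqToHom _
        (congrArg X.obj (show n + 0 + 1 = n + 1 + 0 by ring))
        (congrArg X.obj (add_zero (n + 1)))).symm))
    (fun {X Y} f => by
      ext n
      exact app_eqToHom f (add_zero n))

/-- The shift by a sum is the composite of the shifts. -/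
def shiftAdd (F : C ⥤ C) (a b : ℤ) : shift F (a + b) ≅ shift F a ⋙ shift F b :=
  NatIso.ofComponents
    (fun X => isoOfEq _ _
      (fun n => congrArg X.obj (show n + (a + b) = n + b + a by ring)) (fun n => by
        have h : n + (a + b) = n + b + a := by ring
        have h1 : n + (a + b) + 1 = n + b + a + 1 := by ring
        have h2 : n + b + a + 1 = n + b + 1 + a := by ring
        have h3 : n + b + 1 + a = n + 1 + b + a := by ring
        have h4 : n + (a + b) + 1 = n + 1 + (a + b) := by ring
        have h5 : n + 1 + (a + b) = n + 1 + b + a := by ring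
        have key : F.map (eqToHom (congrArg X.obj h)) ≫ ((X.iso (n + b + a)).hom ≫
            eqToHom (congrArg X.obj h2)) ≫ eqToHom (congrArg X.obj h3) =
            ((X.iso (n + (a + b))).hom ≫ eqToHom (congrArg X.obj h4)) ≫
              eqToHom (congrArg X.obj h5) := by
          rw [Category.assoc, ← Category.assoc, ← iso_eqToHom X h]
          simp
        exact key))
    (fun {X Y} f => by
      ext n
      exact app_eqToHom f (show n + (a + b) = n + b + a by ring))

/-- Every coherence isomorphism has components `eqToHom`, so each axiom becomes an identity between
composites of equalities in `C`. -/
instance : HasShift (Spectrum F) ℤ :=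
  hasShiftMk (Spectrum F) ℤ
    { F := shift F
      zero := shiftZero F
      add := shiftAdd F
      assoc_hom_app := fun a b c X => by
        ext n
        rw [comp_app, comp_app, comp_app, eqToHom_app]
        have h1 : n + (a + b + c) = n + c + (a + b) := by ring
        have h2 : n + c + (a + b) = n + c + b + a := by ring
        have h3 : n + (a + b + c) = n + (a + (b + c)) := by ring
        have h4 : n + (a + (b + c)) = n + (b + c) + a := by ring
        have h5 : n + (b + c) + a = n + c + b + a := by ring
        have key : eqToHom (congrArg X.obj h1) ≫ eqToHom (congrArg X.obj h2) =
            eqToHom (congrArg X.obj h3) ≫ eqToHom (congrArg X.obj h4) ≫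
              eqToHom (congrArg X.obj h5) := by
          simp
        exact key
      zero_add_hom_app := fun a X => by
        ext n
        rw [comp_app, eqToHom_app]
        exact (eqToHom_trans (congrArg X.obj (show n + (0 + a) = n + a by ring))
          (congrArg X.obj (show n + a = n + a + 0 by ring))).symm
      add_zero_hom_app := fun a X => by
        ext n
        rw [comp_app, eqToHom_app]
        exact (eqToHom_trans (congrArg X.obj (show n + (a + 0) = n + a by ring))
          (congrArg X.obj (show n + a = n + 0 + a by ring))).symm }

/-- The component in degree zero. -/
@[simps]
def ev (F : C ⥤ C) : Spectrum F ⥤ C where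
  obj X := X.obj 0
  map f := f.app 0

/-- The components in nonnegative degrees of the morphism extending a given one. -/
def extendUp {X Y : Spectrum F} (f : X.obj 0 ⟶ Y.obj 0) :
    ∀ k : ℕ, X.obj (Int.ofNat k) ⟶ Y.obj (Int.ofNat k)
  | 0 => f
  | k + 1 => (X.iso (Int.ofNat k)).inv ≫ F.map (extendUp f k) ≫ (Y.iso (Int.ofNat k)).hom

/-- The components in negative degrees of the morphism extending a given one. -/
def extendDown [F.Full] {X Y : Spectrum F} (f : X.obj 0 ⟶ Y.obj 0) :
    ∀ k : ℕ, X.obj (Int.negSucc k) ⟶ Y.obj (Int.negSucc k)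
  | 0 => F.preimage ((X.iso (Int.negSucc 0)).hom ≫ f ≫ (Y.iso (Int.negSucc 0)).inv)
  | k + 1 => F.preimage ((X.iso (Int.negSucc (k + 1))).hom ≫ extendDown f k ≫
      (Y.iso (Int.negSucc (k + 1))).inv)

lemma map_preimage_conj [F.Full] {X Y X' Y' : C} (a : F.obj X ≅ X') (b : F.obj Y ≅ Y')
    (f : X' ⟶ Y') : F.map (F.preimage (a.hom ≫ f ≫ b.inv)) ≫ b.hom = a.hom ≫ f := by
  simp

/-- A map in degree zero propagates upwards by applying `F` and conjugating with the structure
isomorphisms, and downwards by taking preimages under `F`. -/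
instance [F.Full] : (ev F).Full where
  map_surjective {X Y} f := by
    refine ⟨⟨fun n => match n with
      | Int.ofNat k => extendUp f k
      | Int.negSucc k => extendDown f k, fun n => ?_⟩, rfl⟩
    match n with
    | Int.ofNat k =>
      change _ = _ ≫ (X.iso (Int.ofNat k)).inv ≫ F.map (extendUp f k) ≫ (Y.iso (Int.ofNat k)).hom
      simp
    | Int.negSucc 0 => exact map_preimage_conj _ _ _
    | Int.negSucc (k + 1) => exact map_preimage_conj _ _ _

instance [F.Faithful] : (ev F).Faithful where
  map_injective {X Y f g} h := by
    ext n
    have step : ∀ n, f.app n = g.app n ↔ f.app (n + 1) = g.app (n + 1) := fun n => by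
      constructor
      · intro h
        rw [← cancel_epi (X.iso n).hom, ← f.comm, ← g.comm, h]
      · intro h
        apply F.map_injective
        rw [← cancel_mono (Y.iso n).hom, f.comm, g.comm, h]
    induction n with
    | zero => exact h
    | succ i hi => exact (step _).1 hi
    | pred i hi => exact (step _).2 (by rwa [sub_add_cancel])

/-- The iterates of a functor on an object. -/
def iterObj (G : C ⥤ C) (X : C) : ℕ → C
  | 0 => X
  | k + 1 => G.obj (iterObj G X k)

/-- The spectrum of an object. -/
def ofObj (e : C ≌ C) (X : C) : Spectrum e.functor where
  obj n := match n with
    | Int.ofNat k => iterObj e.functor X k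
    | Int.negSucc k => iterObj e.inverse X (k + 1)
  iso n := match n with
    | Int.ofNat _ => Iso.refl _
    | Int.negSucc 0 => e.counitIso.app X
    | Int.negSucc (k + 1) => e.counitIso.app (iterObj e.inverse X (k + 1))

instance [F.IsEquivalence] : (ev F).EssSurj where
  mem_essImage X := ⟨ofObj F.asEquivalence X, ⟨Iso.refl _⟩⟩

instance [F.IsEquivalence] : (ev F).IsEquivalence where

end Spectrum

open Spectrum

/-- Choosing the powers of `F` directly would require coherent isomorphisms between them. Spectra
are shifted by relabelling instead, and evaluation in degree zero, an equivalence because `F` is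
one, carries the shift to `C`. The structure isomorphism in degree zero identifies the shift by one
with `F`. -/
theorem exists_hasShift_of_isEquivalence (F : C ⥤ C) [F.IsEquivalence] :
    ∃ (_ : HasShift C ℤ), Nonempty (shiftFunctor C (1 : ℤ) ≅ F) := by
  let s : ℤ → C ⥤ C := fun a => (ev F).inv ⋙ shift F a ⋙ ev F
  let i : ∀ a, ev F ⋙ s a ≅ shiftFunctor (Spectrum F) a ⋙ ev F := fun a =>
    Functor.isoWhiskerRight (ev F).asEquivalence.unitIso.symm (shift F a ⋙ ev F)
  let j : shift F 1 ⋙ ev F ≅ ev F ⋙ F :=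
    NatIso.ofComponents (fun X => (X.iso 0).symm) (fun {X Y} f => by
      change f.app (0 + 1) ≫ (Y.iso 0).inv = (X.iso 0).inv ≫ F.map (f.app 0)
      rw [Iso.comp_inv_eq, Category.assoc, Iso.eq_inv_comp]
      exact (f.comm 0).symm)
  exact ⟨HasShift.induced (ev F) ℤ s i,
    ⟨Functor.isoWhiskerLeft (ev F).inv j ≪≫
      Functor.isoWhiskerRight (ev F).asEquivalence.counitIso F ≪≫ F.leftUnitor⟩⟩

lemma shiftFunctor_additive [Preadditive C] [HasShift C ℤ]
    (h : (shiftFunctor C (1 : ℤ)).Additive) (n : ℤ) : (shiftFunctor C n).Additive := by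
  have : (shiftEquiv C (1 : ℤ)).functor.Additive := h
  have h' : (shiftFunctor C (-1 : ℤ)).Additive :=
    Functor.additive_of_iso (F := (shiftEquiv C (1 : ℤ)).inverse) (Iso.refl _)
  induction n with
  | zero => exact Functor.additive_of_iso (shiftFunctorZero C ℤ).symm
  | succ i hi => exact Functor.additive_of_iso (shiftFunctorAdd C (i : ℤ) 1).symm
  | pred i hi =>
    exact Functor.additive_of_iso (shiftFunctorAdd C (-(i : ℤ)) (-1)).symm

end Shift

end NCpx

end

noncomputable section

namespace NCpx

/-! ### Axioms for a triangulation with a given suspension -/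

section Axioms

universe v₁ u₁

variable {C : Type u₁} [Category.{v₁} C] [Preadditive C] [TriangleData C]

open TriangleData
open scoped ZeroObject

variable (C) in
/-- The axioms of a triangulated category, where the rotation axiom is only one implication and the
octahedral axiom is only required up to isomorphism. -/
structure TriangulationAxioms : Prop where
  zero : HasZeroObject C
  equivalence : (susp : C ⥤ C).IsEquivalence
  additive : (susp : C ⥤ C).Additive
  dist_of_iso : ∀ {X Y Z X' Y' Z' : C} {u : X ⟶ Y} {v : Y ⟶ Z} {w : Z ⟶ susp.obj X}
    {u' : X' ⟶ Y'} {v' : Y' ⟶ Z'} {w' : Z' ⟶ susp.obj X'} (α : X ≅ X') (β : Y ≅ Y') (γ : Z ≅ Z'),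
    u ≫ β.hom = α.hom ≫ u' → v ≫ γ.hom = β.hom ≫ v' → w ≫ susp.map α.hom = γ.hom ≫ w' →
    dist u' v' w' → dist u v w
  dist_id : ∀ (X Z : C), IsZero Z → dist (𝟙 X) (0 : X ⟶ Z) 0
  exists_dist : ∀ {X Y : C} (u : X ⟶ Y), ∃ (Z : C) (v : Y ⟶ Z) (w : Z ⟶ susp.obj X), dist u v w
  rotate : ∀ {X Y Z : C} {u : X ⟶ Y} {v : Y ⟶ Z} {w : Z ⟶ susp.obj X},
    dist u v w → dist v w (-susp.map u)
  complete : ∀ {X Y Z X' Y' Z' : C} {u : X ⟶ Y} {v : Y ⟶ Z} {w : Z ⟶ susp.obj X}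
    {u' : X' ⟶ Y'} {v' : Y' ⟶ Z'} {w' : Z' ⟶ susp.obj X'} (_ : dist u v w) (_ : dist u' v' w')
    (a : X ⟶ X') (b : Y ⟶ Y'), u ≫ b = a ≫ u' →
    ∃ c : Z ⟶ Z', v ≫ c = b ≫ v' ∧ w ≫ susp.map a = c ≫ w'
  octahedron : ∀ {X Y Z : C} (u : X ⟶ Y) (v : Y ⟶ Z),
    ∃ (X' Y' Z' A B D : C) (u' : X' ⟶ Y') (v' : Y' ⟶ Z') (e₁ : X ≅ X') (e₂ : Y ≅ Y') (e₃ : Z ≅ Z')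
      (v₁ : Y' ⟶ A) (w₁ : A ⟶ susp.obj X') (v₂ : Z' ⟶ B) (w₂ : B ⟶ susp.obj Y')
      (v₃ : Z' ⟶ D) (w₃ : D ⟶ susp.obj X') (m₁ : A ⟶ D) (m₃ : D ⟶ B),
      u ≫ e₂.hom = e₁.hom ≫ u' ∧ v ≫ e₃.hom = e₂.hom ≫ v' ∧
      dist u' v₁ w₁ ∧ dist v' v₂ w₂ ∧ dist (u' ≫ v') v₃ w₃ ∧
      v₁ ≫ m₁ = v' ≫ v₃ ∧ m₁ ≫ w₃ = w₁ ∧ v₃ ≫ m₃ = v₂ ∧ w₃ ≫ susp.map u' = m₃ ≫ w₂ ∧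
      dist m₁ m₃ (w₂ ≫ susp.map v₁)

namespace TriangulationAxioms

variable (h : TriangulationAxioms C)

-- Rotating `W ⟶ W ⟶ 0` and the given triangle once, the pair `(t, 0)` completes to a map `ΣW ⟶ ΣX`,
-- which desuspends because `Σ` is full and faithful.
include h in
lemma exists_lift {W X Y Z : C} {u : X ⟶ Y} {v : Y ⟶ Z} {w : Z ⟶ susp.obj X} (H : dist u v w)
    (t : W ⟶ Y) (ht : t ≫ v = 0) : ∃ t' : W ⟶ X, t' ≫ u = t := by
  have := h.zero
  have := h.equivalence
  have := h.additive
  obtain ⟨c, -, hc⟩ := h.complete (h.rotate (h.dist_id W 0 (isZero_zero C))) (h.rotate H) t 0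
    (by simp [ht])
  obtain ⟨c', rfl⟩ := (susp : C ⥤ C).map_surjective c
  refine ⟨c', (susp : C ⥤ C).map_injective ?_⟩
  rw [Functor.map_comp]
  simpa [eq_comm] using hc

-- A substitute for the five lemma: `e - 𝟙` composed with `w` vanishes, so `e - 𝟙` factors through
-- `v`, and `v ≫ (e - 𝟙) = 0`. Thus `e - 𝟙` has square zero and `2 - e` inverts `e`.
include h in
lemma isIso_of_endo {X Y Z : C} {u : X ⟶ Y} {v : Y ⟶ Z} {w : Z ⟶ susp.obj X}
    (H : dist v w (-susp.map u)) (e : Z ⟶ Z) (h₁ : v ≫ e = v) (h₂ : e ≫ w = w) : IsIso e := by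
  obtain ⟨g, hg⟩ := h.exists_lift H (e - 𝟙 Z) (by simp [h₂])
  have hz : (e - 𝟙 Z) ≫ (e - 𝟙 Z) = 0 := by
    nth_rw 1 [← hg]
    simp [h₁]
  have hz' : e ≫ e = e + e - 𝟙 Z := by
    simp only [Preadditive.comp_sub, Preadditive.sub_comp, Category.comp_id,
      Category.id_comp] at hz
    rw [← sub_eq_zero, ← hz]; abel
  refine ⟨⟨𝟙 Z + 𝟙 Z - e, ?_, ?_⟩⟩
  · rw [Preadditive.comp_sub, hz', Preadditive.comp_add, Category.comp_id]; abel
  · rw [Preadditive.sub_comp, hz', Preadditive.add_comp, Category.id_comp]; abel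

-- A triangle on `u` exists, and its rotation has the same third map as the given one. Both
-- triangles are compared after rotation, and `isIso_of_endo` makes the comparison invertible.
include h in
lemma rotate_inv {X Y Z : C} {u : X ⟶ Y} {v : Y ⟶ Z} {w : Z ⟶ susp.obj X}
    (H : dist v w (-susp.map u)) : dist u v w := by
  have := h.equivalence
  have := h.additive
  obtain ⟨Z', v', w', H'⟩ := h.exists_dist u
  have key : ∀ {Z₁ Z₂ : C} {v₁ : Y ⟶ Z₁} {w₁ : Z₁ ⟶ susp.obj X} {v₂ : Y ⟶ Z₂}
      {w₂ : Z₂ ⟶ susp.obj X}, dist v₁ w₁ (-susp.map u) → dist v₂ w₂ (-susp.map u) →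
      ∃ c : Z₁ ⟶ Z₂, v₁ ≫ c = v₂ ∧ c ≫ w₂ = w₁ := by
    intro Z₁ Z₂ v₁ w₁ v₂ w₂ H₁ H₂
    -- After two more rotations the first map of both triangles is `-Σu` and the third objects are
    -- suspensions, so identities on `ΣX` and `ΣY` can be completed and the result desuspended.
    obtain ⟨c, hc, hc'⟩ := h.complete (h.rotate (h.rotate H₁)) (h.rotate (h.rotate H₂)) (𝟙 _) (𝟙 _)
      (by simp)
    obtain ⟨c, rfl⟩ := (susp : C ⥤ C).map_surjective c
    refine ⟨c, (susp : C ⥤ C).map_injective ?_, (susp : C ⥤ C).map_injective ?_⟩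
    · rw [Functor.map_comp]
      simpa using hc
    · rw [Functor.map_comp]
      simpa [eq_comm] using hc'
  obtain ⟨c, hc, hc'⟩ := key H (h.rotate H')
  obtain ⟨d, hd, hd'⟩ := key (h.rotate H') H
  have i₁ := h.isIso_of_endo H (c ≫ d) (by rw [reassoc_of% hc, hd]) (by rw [Category.assoc, hd', hc'])
  have i₂ := h.isIso_of_endo (h.rotate H') (d ≫ c) (by rw [reassoc_of% hd, hc])
    (by rw [Category.assoc, hc', hd'])
  have : Mono c := mono_of_mono c d
  have : IsSplitEpi c := ⟨⟨inv (d ≫ c) ≫ d, by rw [Category.assoc, IsIso.inv_hom_id]⟩⟩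
  have : IsIso c := isIso_of_mono_of_isSplitEpi c
  exact h.dist_of_iso (Iso.refl X) (Iso.refl Y) (asIso c) (by simp) (by simp [hc])
    (by simp [hc']) H'

include h in
theorem isTriangulatedCategory : IsTriangulatedCategory C := by
  have := h.zero
  have := h.equivalence
  have := h.additive
  obtain ⟨hs, ⟨e⟩⟩ := exists_hasShift_of_isEquivalence (susp : C ⥤ C)
  have add : ∀ n : ℤ, (shiftFunctor C n).Additive :=
    shiftFunctor_additive (Functor.additive_of_iso e.symm)
  let P : Pretriangulated C :=
    { distinguishedTriangles := fun T => dist T.mor₁ T.mor₂ (T.mor₃ ≫ e.hom.app T.obj₁)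
      isomorphic_distinguished := fun T hT T' i =>
        h.dist_of_iso (Pretriangulated.Triangle.π₁.mapIso i) (Pretriangulated.Triangle.π₂.mapIso i)
          (Pretriangulated.Triangle.π₃.mapIso i) i.hom.comm₁ i.hom.comm₂ (by
            have := i.hom.comm₃
            change (T'.mor₃ ≫ e.hom.app T'.obj₁) ≫ susp.map i.hom.hom₁ =
              i.hom.hom₃ ≫ T.mor₃ ≫ e.hom.app T.obj₁
            rw [Category.assoc, ← e.hom.naturality, reassoc_of% this]) hT
      contractible_distinguished := fun X => by
        have := h.dist_id X 0 (isZero_zero C)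
        change TriangleData.dist (𝟙 X) 0 ((0 : (0 : C) ⟶ _) ≫ e.hom.app X)
        rwa [zero_comp]
      distinguished_cocone_triangle := fun {X Y} f => by
        obtain ⟨Z, v, w, H⟩ := h.exists_dist f
        refine ⟨Z, v, w ≫ e.inv.app X, ?_⟩
        change TriangleData.dist f v ((w ≫ e.inv.app X) ≫ e.hom.app X)
        simpa using H
      rotate_distinguished_triangle := fun ⟨X, Y, Z, u, v, w⟩ => by
        change TriangleData.dist u v (w ≫ e.hom.app X) ↔
          TriangleData.dist v w ((-(shiftFunctor C (1 : ℤ)).map u) ≫ e.hom.app Y)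
        have E : (-(shiftFunctor C (1 : ℤ)).map u) ≫ e.hom.app Y =
            e.hom.app X ≫ (-susp.map u) := by
          rw [Preadditive.neg_comp, e.hom.naturality, Preadditive.comp_neg]
        rw [E]
        constructor <;> intro H
        · exact h.dist_of_iso (Iso.refl _) (Iso.refl _) (e.app X) (by simp) (by simp) (by simp)
            (h.rotate H)
        · exact h.rotate_inv (h.dist_of_iso (Iso.refl _) (Iso.refl _) (e.symm.app X) (by simp)
            (by simp) (by simp) H)
      complete_distinguished_triangle_morphism := fun T T' hT hT' a b hab => by
        obtain ⟨c, hc, hc'⟩ := h.complete hT hT' a b hab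
        refine ⟨c, hc, ?_⟩
        rw [← cancel_mono (e.hom.app _), Category.assoc, e.hom.naturality, ← Category.assoc, hc',
          Category.assoc] }
  have mem : ∀ {X Y Z : C} (u : X ⟶ Y) (v : Y ⟶ Z) (w : Z ⟶ (shiftFunctor C (1 : ℤ)).obj X),
      Pretriangulated.Triangle.mk u v w ∈ P.distinguishedTriangles ↔
        TriangleData.dist u v (w ≫ e.hom.app X) := fun _ _ _ => Iff.rfl
  -- `IsTriangulated.mk'` accepts an octahedron on any composable pair isomorphic to the given one;
  -- this is the freedom left in the `octahedron` axiom.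
  refine ⟨h.zero, hs, add, P, e, IsTriangulated.mk' fun X Y Z u v => ?_, mem⟩
  obtain ⟨X', Y', Z', A, B, D, u', v', e₁, e₂, e₃, v₁, w₁, v₂, w₂, v₃, w₃, m₁, m₃, c₁, c₂, d₁, d₂,
    d₃, k₁, k₂, k₃, k₄, d₄⟩ := h.octahedron u v
  refine ⟨X', Y', Z', A, B, D, u', v', e₁, e₂, e₃, c₁, c₂, v₁, w₁ ≫ e.inv.app _, ?_,
    v₂, w₂ ≫ e.inv.app _, ?_, v₃, w₃ ≫ e.inv.app _, ?_, ⟨⟨m₁, m₃, k₁, ?_, k₃, ?_, ?_⟩⟩⟩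
  · rw [mem]; simpa using d₁
  · rw [mem]; simpa using d₂
  · rw [mem]; simpa using d₃
  · rw [reassoc_of% k₂]
  · rw [Category.assoc, ← e.inv.naturality, reassoc_of% k₄]
  · rw [mem]
    simpa using d₄

end TriangulationAxioms

end Axioms

end NCpx

end

/-! ### Homotopies, termwise split sequences and mapping cones. -/

noncomputable section

namespace NCpx

universe v u

variable {B : Type u} [Category.{v} B] [Preadditive B] {N : ℕ}

/-! ### Morphisms of `N`-complexes -/

lemma comp_app {X Y Z : Cpx B N} (f : X ⟶ Y) (g : Y ⟶ Z) (n : ℤ) :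
    (f ≫ g).hom.app n = f.hom.app n ≫ g.hom.app n := rfl

lemma id_app (X : Cpx B N) (n : ℤ) : (𝟙 X : X ⟶ X).hom.app n = 𝟙 (X.obj.obj n) := rfl

lemma add_app {X Y : Cpx B N} (f g : X ⟶ Y) (n : ℤ) :
    (f + g).hom.app n = f.hom.app n + g.hom.app n := rfl

lemma zero_app (X Y : Cpx B N) (n : ℤ) : (0 : X ⟶ Y).hom.app n = 0 := rfl

lemma hom_ext_app {X Y : Cpx B N} {f g : X ⟶ Y} (h : ∀ n, f.hom.app n = g.hom.app n) : f = g := by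
  apply ObjectProperty.hom_ext
  ext n
  exact h n

lemma app_dd {X Y : Cpx B N} (f : X ⟶ Y) (a b : ℤ) :
    f.hom.app a ≫ dd Y.obj a b = dd X.obj a b ≫ f.hom.app b := (dd_naturality f.hom a b).symm

lemma app_dd_assoc {X Y : Cpx B N} (f : X ⟶ Y) (a b : ℤ) {A : B} (h : Y.obj.obj b ⟶ A) :
    f.hom.app a ≫ dd Y.obj a b ≫ h = dd X.obj a b ≫ f.hom.app b ≫ h := by
  rw [← Category.assoc, app_dd, Category.assoc]

/-- The morphism of `N`-complexes with given components. -/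
def mkHom {X Y : Cpx B N} (f : ∀ n, X.obj.obj n ⟶ Y.obj.obj n)
    (h : ∀ a b, a ≤ b → dd X.obj a b ≫ f b = f a ≫ dd Y.obj a b) : X ⟶ Y :=
  ObjectProperty.homMk
    { app := f
      naturality := fun a b g => by
        have := h a b g.le
        rw [dd_of_le _ g.le, dd_of_le _ g.le] at this
        exact this }

lemma mkHom_app {X Y : Cpx B N} (f : ∀ n, X.obj.obj n ⟶ Y.obj.obj n)
    (h : ∀ a b, a ≤ b → dd X.obj a b ≫ f b = f a ≫ dd Y.obj a b) (n : ℤ) :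
    (mkHom f h).hom.app n = f n := rfl

/-- The null-homotopic morphism defined by a family of morphisms. -/
def nullMap {X Y : Cpx B N} (s : ∀ n : ℤ, X.obj.obj n ⟶ Y.obj.obj (n - N + 1)) : X ⟶ Y :=
  mkHom (fun i => ∑ n ∈ Finset.Ico i (i + N), dd X.obj i n ≫ s n ≫ dd Y.obj (n - N + 1) i)
    (fun i j hij => by
      set G : ℤ → (X.obj.obj i ⟶ Y.obj.obj j) :=
        fun n => dd X.obj i n ≫ s n ≫ dd Y.obj (n - N + 1) j with hG
      have e₁ : dd X.obj i j ≫
          ∑ n ∈ Finset.Ico j (j + N), dd X.obj j n ≫ s n ≫ dd Y.obj (n - N + 1) j =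
          ∑ n ∈ Finset.Ico j (j + (N : ℤ)), G n := by
        rw [Preadditive.comp_sum]
        exact Finset.sum_congr rfl fun n hn => dd_comp_assoc _ hij (Finset.mem_Ico.1 hn).1 _
      have e₂ : (∑ n ∈ Finset.Ico i (i + N), dd X.obj i n ≫ s n ≫ dd Y.obj (n - N + 1) i) ≫
          dd Y.obj i j = ∑ n ∈ Finset.Ico i (i + (N : ℤ)), G n := by
        rw [Preadditive.sum_comp]
        refine Finset.sum_congr rfl fun n hn => ?_
        have := (Finset.mem_Ico.1 hn).2
        rw [Category.assoc, Category.assoc, dd_comp _ (by omega) hij]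
      -- The two sums run over windows that differ by a shift. Outside their overlap a term contains
      -- at least `N` consecutive differentials, of `Y` at the lower end and of `X` at the upper
      -- end.
      have z₁ : ∑ n ∈ Finset.Ico i j, G n = 0 := Finset.sum_eq_zero fun n hn => by
        have := (Finset.mem_Ico.1 hn).2
        simp only [hG]
        rw [dd_eq_zero Y (a := n - N + 1) (b := j) (by omega), comp_zero, comp_zero]
      have z₂ : ∑ n ∈ Finset.Ico (i + (N : ℤ)) (j + N), G n = 0 := Finset.sum_eq_zero fun n hn => by
        simp only [hG]
        rw [dd_eq_zero X (Finset.mem_Ico.1 hn).1, zero_comp]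
      have s₁ := sum_Ico_add hij (show j ≤ j + (N : ℤ) by omega) G
      have s₂ := sum_Ico_add (show i ≤ i + (N : ℤ) by omega)
        (show i + (N : ℤ) ≤ j + (N : ℤ) by omega) G
      rw [z₁, zero_add] at s₁
      rw [z₂, add_zero] at s₂
      exact e₁.trans (s₁.symm.trans (s₂.trans e₂.symm)))

lemma nullHomotopic_nullMap {X Y : Cpx B N} (s : ∀ n : ℤ, X.obj.obj n ⟶ Y.obj.obj (n - N + 1)) :
    NullHomotopic (nullMap s) := ⟨s, fun _ => rfl⟩

lemma NullHomotopic.exists_eq {X Y : Cpx B N} {f : X ⟶ Y} (hf : NullHomotopic f) :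
    ∃ s, f = nullMap s := by
  obtain ⟨s, hs⟩ := hf
  exact ⟨s, hom_ext_app hs⟩

lemma comp_nullMap {X Y Z : Cpx B N} (f : X ⟶ Y)
    (s : ∀ n : ℤ, Y.obj.obj n ⟶ Z.obj.obj (n - N + 1)) :
    f ≫ nullMap s = nullMap fun n => f.hom.app n ≫ s n := by
  refine hom_ext_app fun i => ?_
  rw [comp_app]
  simp only [nullMap, mkHom_app]
  rw [Preadditive.comp_sum]
  refine Finset.sum_congr rfl fun n _ => ?_
  rw [app_dd_assoc, Category.assoc]

lemma nullMap_comp {X Y Z : Cpx B N} (s : ∀ n : ℤ, X.obj.obj n ⟶ Y.obj.obj (n - N + 1))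
    (f : Y ⟶ Z) : nullMap s ≫ f = nullMap fun n => s n ≫ f.hom.app (n - N + 1) := by
  refine hom_ext_app fun i => ?_
  rw [comp_app]
  simp only [nullMap, mkHom_app]
  rw [Preadditive.sum_comp]
  refine Finset.sum_congr rfl fun n _ => ?_
  simp only [Category.assoc]
  rw [app_dd]

lemma nullHomotopic_of_eq_one (hN : N = 1) {X Y : Cpx B N} (f : X ⟶ Y) : NullHomotopic f := by
  subst hN
  -- The homotopy is `f` itself; `dd` only transports from degree `n` to the equal degree `n - 1 +
  -- 1`.
  refine ⟨fun n => f.hom.app n ≫ dd Y.obj n (n - (1 : ℕ) + 1), fun i => ?_⟩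
  have : Finset.Ico i (i + (1 : ℕ)) = {i} := by
    ext x; simp only [Finset.mem_Ico, Finset.mem_singleton]; omega
  rw [this, Finset.sum_singleton, dd_self, Category.id_comp, Category.assoc,
    dd_comp _ (by omega) (by omega), dd_self, Category.comp_id]

/-! ### Translation -/

/-- The translation of `N`-complexes by `k`. -/
def translC (B : Type u) [Category.{v} B] [Preadditive B] (N : ℕ) (k : ℤ) :
    Cpx B N ⥤ Cpx B N :=
  reindexC (fun i => i + k) (fun _ _ h => by simpa using h) (fun i => by ring)

lemma dd_translC (X : Cpx B N) (k : ℤ) {a b : ℤ} (h : a ≤ b) :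
    dd ((translC B N k).obj X).obj a b = dd X.obj (a + k) (b + k) := dd_reindexC _ _ X h

/-! ### The homotopy category -/

instance : (toK B N).Additive := CategoryTheory.Quotient.functor_additive _ _

lemma toK_map_eq_zero_iff {X Y : Cpx B N} (f : X ⟶ Y) :
    (toK B N).map f = 0 ↔ NullHomotopic f := by
  rw [← (toK B N).map_zero, CategoryTheory.Quotient.functor_map_eq_iff]
  change NullHomotopic (f - 0) ↔ _
  rw [sub_zero]

lemma isZero_toK_iff (X : Cpx B N) : IsZero ((toK B N).obj X) ↔ NullHomotopic (𝟙 X) := by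
  rw [IsZero.iff_id_eq_zero, ← toK_map_eq_zero_iff, CategoryTheory.Functor.map_id]

/-! ### Termwise split short exact sequences -/

/-- The sequence `X ⟶ Y ⟶ Z` is termwise a split short exact sequence. -/
def TermwiseSplit {X Y Z : Cpx B N} (i : X ⟶ Y) (p : Y ⟶ Z) : Prop :=
  ∀ n, ∃ (r : Y.obj.obj n ⟶ X.obj.obj n) (σ : Z.obj.obj n ⟶ Y.obj.obj n),
    i.hom.app n ≫ r = 𝟙 _ ∧ σ ≫ p.hom.app n = 𝟙 _ ∧ i.hom.app n ≫ p.hom.app n = 0 ∧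
      r ≫ i.hom.app n + p.hom.app n ≫ σ = 𝟙 _

namespace TermwiseSplit

variable {X Y Z W : Cpx B N} {i : X ⟶ Y} {p : Y ⟶ Z} (h : TermwiseSplit i p)

include h

lemma zero : i ≫ p = 0 := hom_ext_app fun n => by
  obtain ⟨r, σ, -, -, h₃, -⟩ := h n
  exact h₃

lemma epi : Epi p where
  left_cancellation {W} g g' hg := hom_ext_app fun n => by
    obtain ⟨r, σ, -, h₂, -, -⟩ := h n
    rw [← Category.id_comp (g.hom.app n), ← Category.id_comp (g'.hom.app n), ← h₂, Category.assoc,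
      Category.assoc, ← comp_app, ← comp_app, hg]

lemma mono : Mono i where
  right_cancellation {W} g g' hg := hom_ext_app fun n => by
    obtain ⟨r, σ, h₁, -, -, -⟩ := h n
    rw [← Category.comp_id (g.hom.app n), ← Category.comp_id (g'.hom.app n), ← h₁,
      ← Category.assoc, ← Category.assoc, ← comp_app, ← comp_app, hg]

lemma exists_desc (g : Y ⟶ W) (hg : i ≫ g = 0) : ∃ g' : Z ⟶ W, p ≫ g' = g := by
  choose r σ h₁ h₂ h₃ h₄ using h
  have key : ∀ n, p.hom.app n ≫ σ n ≫ g.hom.app n = g.hom.app n := fun n => by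
    have e : i.hom.app n ≫ g.hom.app n = 0 := by rw [← comp_app, hg, zero_app]
    have := congrArg (· ≫ g.hom.app n) (h₄ n)
    simpa [e] using this
  refine ⟨mkHom (fun n => σ n ≫ g.hom.app n) fun a b _ => ?_, hom_ext_app key⟩
  rw [← Category.id_comp (dd Z.obj a b ≫ _), ← h₂ a, Category.assoc, app_dd_assoc, key, ← app_dd,
    Category.assoc]

lemma exists_lift (g : W ⟶ Y) (hg : g ≫ p = 0) : ∃ g' : W ⟶ X, g' ≫ i = g := by
  choose r σ h₁ h₂ h₃ h₄ using h
  have key : ∀ n, (g.hom.app n ≫ r n) ≫ i.hom.app n = g.hom.app n := fun n => by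
    have e : g.hom.app n ≫ p.hom.app n = 0 := by rw [← comp_app, hg, zero_app]
    have := congrArg (g.hom.app n ≫ ·) (h₄ n)
    simpa [reassoc_of% e] using this
  refine ⟨mkHom (fun n => g.hom.app n ≫ r n) fun a b _ => ?_, hom_ext_app key⟩
  have e : dd X.obj a b = i.hom.app a ≫ dd Y.obj a b ≫ r b := by
    rw [app_dd_assoc, h₁, Category.comp_id]
  rw [e, ← Category.assoc _ (i.hom.app a), key, app_dd_assoc]

/-- A homotopy is an arbitrary family of maps, so it extends by the degreewise retractions even if
these do not commute with the differentials. `exists_null_lift` is the dual. -/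
lemma exists_extension {f : X ⟶ W} (hf : NullHomotopic f) :
    ∃ g : Y ⟶ W, NullHomotopic g ∧ i ≫ g = f := by
  choose r σ h₁ h₂ h₃ h₄ using h
  obtain ⟨s, rfl⟩ := hf.exists_eq
  refine ⟨nullMap fun n => r n ≫ s n, nullHomotopic_nullMap _, ?_⟩
  rw [comp_nullMap]
  simp only [reassoc_of% h₁]

lemma exists_null_lift {f : W ⟶ Z} (hf : NullHomotopic f) :
    ∃ g : W ⟶ Y, NullHomotopic g ∧ g ≫ p = f := by
  choose r σ h₁ h₂ h₃ h₄ using h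
  obtain ⟨s, rfl⟩ := hf.exists_eq
  refine ⟨nullMap fun n => s n ≫ σ _, nullHomotopic_nullMap _, ?_⟩
  rw [nullMap_comp]
  simp only [Category.assoc, h₂, Category.comp_id]

/-- Extend `𝟙 X` to a null-homotopic retraction `r` of `i`. Then `𝟙 - r ≫ i` factors as `p ≫ s`,
where `s` is a strict section of `p` and `p ≫ s` is homotopic to the identity. `isIso_left` is dual.
-/
lemma isIso_right (hX : NullHomotopic (𝟙 X)) : IsIso ((toK B N).map p) := by
  have := h.epi
  obtain ⟨r, hr, hr'⟩ := h.exists_extension hX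
  obtain ⟨s, hs⟩ := h.exists_desc (𝟙 Y - r ≫ i) (by
    rw [Preadditive.comp_sub, reassoc_of% hr', Category.comp_id, sub_self])
  refine ⟨(toK B N).map s, ?_, ?_⟩
  · rw [← Functor.map_comp, hs, Functor.map_sub, Functor.map_comp, (toK_map_eq_zero_iff r).2 hr,
      zero_comp, sub_zero, CategoryTheory.Functor.map_id]
  · have : s ≫ p = 𝟙 Z := by
      rw [← cancel_epi p, reassoc_of% hs, Preadditive.sub_comp, Category.assoc, h.zero]
      simp
    rw [← Functor.map_comp, this, CategoryTheory.Functor.map_id]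

lemma isIso_left (hZ : NullHomotopic (𝟙 Z)) : IsIso ((toK B N).map i) := by
  have := h.mono
  obtain ⟨s, hs, hs'⟩ := h.exists_null_lift hZ
  obtain ⟨r, hr⟩ := h.exists_lift (𝟙 Y - p ≫ s) (by
    rw [Preadditive.sub_comp, Category.assoc, hs', Category.comp_id, Category.id_comp, sub_self])
  refine ⟨(toK B N).map r, ?_, ?_⟩
  · have : i ≫ r = 𝟙 X := by
      rw [← cancel_mono i, Category.assoc, hr, Preadditive.comp_sub, reassoc_of% h.zero]
      simp
    rw [← Functor.map_comp, this, CategoryTheory.Functor.map_id]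
  · rw [← Functor.map_comp, hr, Functor.map_sub, Functor.map_comp, (toK_map_eq_zero_iff s).2 hs,
      comp_zero, sub_zero, CategoryTheory.Functor.map_id]

end TermwiseSplit

/-! ### Binary biproducts of `N`-complexes -/

section Biproducts

variable [HasFiniteBiproducts B]

attribute [local instance] hasBinaryBiproducts_of_finite_biproducts

/-- The direct sum of two `N`-complexes. -/
def sumC (X Y : Cpx B N) : Cpx B N :=
  ⟨{ obj := fun n => X.obj.obj n ⊞ Y.obj.obj n
     map := fun g => biprod.map (X.obj.map g) (Y.obj.map g)
     map_id := fun _ => by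
       rw [X.obj.map_id, Y.obj.map_id]; apply biprod.hom_ext <;> simp
     map_comp := fun _ _ => by apply biprod.hom_ext <;> simp },
    fun n => by
      change biprod.map (X.obj.map _) (Y.obj.map _) = 0
      rw [X.property, Y.property]
      apply biprod.hom_ext <;> simp⟩

/-- The first inclusion. -/
def sumInl (X Y : Cpx B N) : X ⟶ sumC X Y :=
  ObjectProperty.homMk
    { app := fun n => (biprod.inl : X.obj.obj n ⟶ X.obj.obj n ⊞ Y.obj.obj n)
      naturality := fun _ _ g => (biprod.inl_map (X.obj.map g) (Y.obj.map g)).symm }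

/-- The second inclusion. -/
def sumInr (X Y : Cpx B N) : Y ⟶ sumC X Y :=
  ObjectProperty.homMk
    { app := fun n => (biprod.inr : Y.obj.obj n ⟶ X.obj.obj n ⊞ Y.obj.obj n)
      naturality := fun _ _ g => (biprod.inr_map (X.obj.map g) (Y.obj.map g)).symm }

/-- The first projection. -/
def sumFst (X Y : Cpx B N) : sumC X Y ⟶ X :=
  ObjectProperty.homMk
    { app := fun n => (biprod.fst : X.obj.obj n ⊞ Y.obj.obj n ⟶ X.obj.obj n)
      naturality := fun _ _ g => biprod.map_fst (X.obj.map g) (Y.obj.map g) }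

/-- The second projection. -/
def sumSnd (X Y : Cpx B N) : sumC X Y ⟶ Y :=
  ObjectProperty.homMk
    { app := fun n => (biprod.snd : X.obj.obj n ⊞ Y.obj.obj n ⟶ Y.obj.obj n)
      naturality := fun _ _ g => biprod.map_snd (X.obj.map g) (Y.obj.map g) }

@[simp]
lemma sumInl_sumFst (X Y : Cpx B N) : sumInl X Y ≫ sumFst X Y = 𝟙 X :=
  hom_ext_app fun _ => biprod.inl_fst

@[simp]
lemma sumInl_sumSnd (X Y : Cpx B N) : sumInl X Y ≫ sumSnd X Y = 0 :=
  hom_ext_app fun _ => biprod.inl_snd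

@[simp]
lemma sumInr_sumFst (X Y : Cpx B N) : sumInr X Y ≫ sumFst X Y = 0 :=
  hom_ext_app fun _ => biprod.inr_fst

@[simp]
lemma sumInr_sumSnd (X Y : Cpx B N) : sumInr X Y ≫ sumSnd X Y = 𝟙 Y :=
  hom_ext_app fun _ => biprod.inr_snd

lemma termwiseSplit_sum (X Y : Cpx B N) : TermwiseSplit (sumInr X Y) (sumFst X Y) := fun n =>
  ⟨(sumSnd X Y).hom.app n, (sumInl X Y).hom.app n, biprod.inr_snd, biprod.inl_fst,
    biprod.inr_fst, (add_comm _ _).trans biprod.total⟩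

end Biproducts

end NCpx

end

noncomputable section

namespace NCpx

universe v u

variable {B : Type u} [Category.{v} B] [Preadditive B] {N : ℕ}

section Cone

variable [HasFiniteBiproducts B]

attribute [local instance] hasBinaryBiproducts_of_finite_biproducts

/-! ### The components of the mapping cone -/

section Components

variable {X Y : Cpx B N} (f : X ⟶ Y)

/-- The projection `C(f)^m ⟶ Y^m`. -/
def coneFst (m : ℤ) : (cone f).obj.obj m ⟶ Y.obj.obj m :=
  (biprod.fst : Y.obj.obj m ⊞ susObj N X.obj m ⟶ Y.obj.obj m)

/-- The inclusion `(ΣX)^m ⟶ C(f)^m`. -/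
def coneInr (m : ℤ) : ((susC B N).obj X).obj.obj m ⟶ (cone f).obj.obj m :=
  (biprod.inr : susObj N X.obj m ⟶ Y.obj.obj m ⊞ susObj N X.obj m)

/-- The component `(ΣX)^m ⟶ Y^{m'}` of the transition maps of the mapping cone. -/
def conePartC (m m' : ℤ) : ((susC B N).obj X).obj.obj m ⟶ Y.obj.obj m' :=
  conePart f.hom m m'

@[simp] lemma coneIn_fst (m : ℤ) : (coneIn f).hom.app m ≫ coneFst f m = 𝟙 _ := biprod.inl_fst

@[simp] lemma coneIn_out (m : ℤ) : (coneIn f).hom.app m ≫ (coneOut f).hom.app m = 0 :=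
  biprod.inl_snd

@[simp] lemma coneInr_fst (m : ℤ) : coneInr f m ≫ coneFst f m = 0 := biprod.inr_fst

@[simp] lemma coneInr_out (m : ℤ) : coneInr f m ≫ (coneOut f).hom.app m = 𝟙 _ := biprod.inr_snd

@[simp] lemma coneIn_fst_assoc (m : ℤ) {A : B} (h : Y.obj.obj m ⟶ A) :
    (coneIn f).hom.app m ≫ coneFst f m ≫ h = h := biprod.inl_fst_assoc _

@[simp] lemma coneIn_out_assoc (m : ℤ) {A : B} (h : ((susC B N).obj X).obj.obj m ⟶ A) :
    (coneIn f).hom.app m ≫ (coneOut f).hom.app m ≫ h = 0 := by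
  rw [← Category.assoc, coneIn_out, zero_comp]

@[simp] lemma coneInr_fst_assoc (m : ℤ) {A : B} (h : Y.obj.obj m ⟶ A) :
    coneInr f m ≫ coneFst f m ≫ h = 0 := by
  rw [← Category.assoc, coneInr_fst, zero_comp]

@[simp] lemma coneInr_out_assoc (m : ℤ) {A : B} (h : ((susC B N).obj X).obj.obj m ⟶ A) :
    coneInr f m ≫ (coneOut f).hom.app m ≫ h = h := biprod.inr_snd_assoc _

lemma cone_total (m : ℤ) : coneFst f m ≫ (coneIn f).hom.app m +
    (coneOut f).hom.app m ≫ coneInr f m = 𝟙 _ := biprod.total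

variable {f} in
lemma cone_hom_ext {m : ℤ} {A : B} {g g' : (cone f).obj.obj m ⟶ A}
    (h₁ : (coneIn f).hom.app m ≫ g = (coneIn f).hom.app m ≫ g')
    (h₂ : coneInr f m ≫ g = coneInr f m ≫ g') : g = g' := biprod.hom_ext' _ _ h₁ h₂

lemma dd_cone {m m' : ℤ} (h : m ≤ m') : dd (cone f).obj m m' = coneMap f.hom m m' := dd_of_le _ h

lemma dd_sus (X : Cpx B N) {m m' : ℤ} (h : m ≤ m') :
    dd ((susC B N).obj X).obj m m' = susMap N X.obj m m' := dd_of_le _ h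

lemma coneIn_dd (m m' : ℤ) : (coneIn f).hom.app m ≫ dd (cone f).obj m m' =
    dd Y.obj m m' ≫ (coneIn f).hom.app m' := app_dd _ _ _

lemma coneInr_dd {m m' : ℤ} (h : m ≤ m') : coneInr f m ≫ dd (cone f).obj m m' =
    conePartC f m m' ≫ (coneIn f).hom.app m' +
      dd ((susC B N).obj X).obj m m' ≫ coneInr f m' := by
  rw [dd_cone f h, dd_sus X h]
  exact Biprod.inr_ofComponents _ _ _ _

/-- The inclusion `X^a ⟶ (ΣX)^m`. -/
def susι (X : Cpx B N) (m : ℤ) (a : Finset.Ioo m (m + (N : ℤ))) :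
    X.obj.obj a.1 ⟶ ((susC B N).obj X).obj.obj m :=
  biproduct.ι (fun a : Finset.Ioo m (m + (N : ℤ)) => X.obj.obj a.1) a

/-- The projection `(ΣX)^m ⟶ X^a`. -/
def susπ (X : Cpx B N) (m : ℤ) (a : Finset.Ioo m (m + (N : ℤ))) :
    ((susC B N).obj X).obj.obj m ⟶ X.obj.obj a.1 :=
  biproduct.π (fun a : Finset.Ioo m (m + (N : ℤ)) => X.obj.obj a.1) a

lemma susι_hom_ext {X : Cpx B N} {m : ℤ} {A : B} {g g' : ((susC B N).obj X).obj.obj m ⟶ A}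
    (h : ∀ a, susι X m a ≫ g = susι X m a ≫ g') : g = g' := biproduct.hom_ext' _ _ h

lemma susπ_hom_ext {X : Cpx B N} {m : ℤ} {A : B} {g g' : A ⟶ ((susC B N).obj X).obj.obj m}
    (h : ∀ a, g ≫ susπ X m a = g' ≫ susπ X m a) : g = g' := biproduct.hom_ext _ _ h

lemma susι_π_self (X : Cpx B N) (m : ℤ) (a : Finset.Ioo m (m + (N : ℤ))) :
    susι X m a ≫ susπ X m a = 𝟙 _ := biproduct.ι_π_self _ _

lemma susι_π_ne (X : Cpx B N) (m : ℤ) {a b : Finset.Ioo m (m + (N : ℤ))} (h : a ≠ b) :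
    susι X m a ≫ susπ X m b = 0 := biproduct.ι_π_ne _ h

lemma susι_dd_π (X : Cpx B N) {m m' : ℤ} (h : m ≤ m') (a : Finset.Ioo m (m + (N : ℤ)))
    (b : Finset.Ioo m' (m' + (N : ℤ))) :
    susι X m a ≫ dd ((susC B N).obj X).obj m m' ≫ susπ X m' b =
      susCoeff N m a.1 b.1 • dd X.obj a.1 b.1 := by
  rw [dd_sus X h]
  exact ι_susMap_π _ _ _ _ _

lemma susι_map {X Y : Cpx B N} (f : X ⟶ Y) (m : ℤ) (a : Finset.Ioo m (m + (N : ℤ))) :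
    susι X m a ≫ ((susC B N).map f).hom.app m = f.hom.app a.1 ≫ susι Y m a := ι_susHom _ _ _

lemma susι_conePartC {X Y : Cpx B N} (f : X ⟶ Y) (m m' : ℤ) (a : Finset.Ioo m (m + (N : ℤ))) :
    susι X m a ≫ conePartC f m m' =
      f.hom.app a.1 ≫ if m' < m + N then dd Y.obj a.1 m' else 0 := biproduct.ι_desc _ _

lemma conePartC_comp {Z : Cpx B N} (g : Y ⟶ Z) (m m' : ℤ) :
    conePartC (f ≫ g) m m' = conePartC f m m' ≫ g.hom.app m' := by
  refine susι_hom_ext fun a => ?_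
  rw [← Category.assoc, susι_conePartC, susι_conePartC, comp_app]
  split_ifs
  · rw [Category.assoc, Category.assoc, app_dd]
  · simp

lemma conePartC_zero (X Y : Cpx B N) (m m' : ℤ) : conePartC (0 : X ⟶ Y) m m' = 0 := by
  refine susι_hom_ext fun a => ?_
  rw [susι_conePartC, zero_app, zero_comp, comp_zero]

lemma sus_conePartC {W : Cpx B N} (g : W ⟶ X) (m m' : ℤ) :
    ((susC B N).map g).hom.app m ≫ conePartC f m m' = conePartC (g ≫ f) m m' := by
  refine susι_hom_ext fun a => ?_
  rw [← Category.assoc, susι_map, Category.assoc, susι_conePartC, susι_conePartC, comp_app,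
    Category.assoc]

end Components

lemma termwiseSplit_cone {X Y : Cpx B N} (f : X ⟶ Y) : TermwiseSplit (coneIn f) (coneOut f) :=
  fun n => ⟨coneFst f n, coneInr f n, by simp, by simp, by simp, cone_total f n⟩

/-! ### Functoriality of the mapping cone -/

/-- The morphism of mapping cones defined by a commutative square. -/
def coneHom {X Y X' Y' : Cpx B N} {f : X ⟶ Y} {f' : X' ⟶ Y'} (a : X ⟶ X') (b : Y ⟶ Y')
    (h : f ≫ b = a ≫ f') : cone f ⟶ cone f' :=
  mkHom (fun m => coneFst f m ≫ b.hom.app m ≫ (coneIn f').hom.app m +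
      (coneOut f).hom.app m ≫ ((susC B N).map a).hom.app m ≫ coneInr f' m) (fun m m' hm => by
    refine cone_hom_ext ?_ ?_
    · simp only [Preadditive.comp_add, Preadditive.add_comp, reassoc_of% coneIn_dd f, Category.assoc,
        coneIn_fst_assoc, coneIn_out_assoc, coneIn_dd, comp_zero, add_zero,
        app_dd_assoc]
    · simp only [Preadditive.comp_add, Preadditive.add_comp, Category.assoc, coneInr_fst_assoc,
        coneInr_out_assoc, coneInr_dd f' hm, zero_add]
      rw [← Category.assoc, ← Category.assoc (coneInr f m), coneInr_dd f hm]
      simp only [Preadditive.add_comp, Category.assoc, coneInr_fst_assoc, coneInr_out_assoc,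
        coneIn_fst_assoc, coneIn_out_assoc, comp_zero, add_zero, zero_add]
      rw [← Category.assoc (conePartC f m m'), ← conePartC_comp, h, ← sus_conePartC,
        Category.assoc, app_dd_assoc])

section

variable {X Y X' Y' : Cpx B N} {f : X ⟶ Y} {f' : X' ⟶ Y'} (a : X ⟶ X') (b : Y ⟶ Y')
    (h : f ≫ b = a ≫ f')

lemma coneIn_coneHom_app (m : ℤ) : (coneIn f).hom.app m ≫ (coneHom a b h).hom.app m =
    b.hom.app m ≫ (coneIn f').hom.app m := by
  simp [coneHom, mkHom_app]

lemma coneInr_coneHom_app (m : ℤ) : coneInr f m ≫ (coneHom a b h).hom.app m =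
    ((susC B N).map a).hom.app m ≫ coneInr f' m := by
  simp [coneHom, mkHom_app]

lemma coneIn_coneHom : coneIn f ≫ coneHom a b h = b ≫ coneIn f' :=
  hom_ext_app fun m => coneIn_coneHom_app a b h m

lemma coneHom_coneOut : coneHom a b h ≫ coneOut f' = coneOut f ≫ (susC B N).map a :=
  hom_ext_app fun m => by
    simp [coneHom, mkHom_app]

end

/-- The morphism from the mapping cone of `f` defined by a morphism that vanishes on `f`. -/
def coneDesc {X Y Z : Cpx B N} (f : X ⟶ Y) (p : Y ⟶ Z) (h : f ≫ p = 0) : cone f ⟶ Z :=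
  mkHom (fun m => coneFst f m ≫ p.hom.app m) (fun m m' hm => by
    refine cone_hom_ext ?_ ?_
    · simp only [reassoc_of% coneIn_dd f, Category.assoc, coneIn_fst_assoc, app_dd]
    · rw [← Category.assoc, coneInr_dd f hm]
      simp only [Preadditive.add_comp, Category.assoc, coneInr_fst_assoc, coneIn_fst_assoc,
        comp_zero, add_zero]
      rw [← conePartC_comp, h, conePartC_zero])

section

variable {X Y Z : Cpx B N} (f : X ⟶ Y) (p : Y ⟶ Z) (h : f ≫ p = 0)

lemma coneDesc_app (m : ℤ) : (coneDesc f p h).hom.app m = coneFst f m ≫ p.hom.app m := rfl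

lemma coneIn_coneDesc : coneIn f ≫ coneDesc f p h = p :=
  hom_ext_app fun m => by simp [coneDesc_app]

lemma coneHom_coneDesc {X' Y' Z' : Cpx B N} (f' : X' ⟶ Y') (p' : Y' ⟶ Z') (h' : f' ≫ p' = 0)
    (a : X ⟶ X') (b : Y ⟶ Y') (c : Z ⟶ Z') (hab : f ≫ b = a ≫ f') (hbc : p ≫ c = b ≫ p') :
    coneHom a b hab ≫ coneDesc f' p' h' = coneDesc f p h ≫ c :=
  hom_ext_app fun m => by
    rw [comp_app, comp_app, coneDesc_app, coneDesc_app]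
    refine cone_hom_ext ?_ ?_
    · rw [← Category.assoc, coneIn_coneHom_app]
      simp only [Category.assoc, coneIn_fst_assoc]
      rw [← comp_app, ← comp_app, hbc]
    · rw [← Category.assoc, coneInr_coneHom_app]
      simp

end

/-- This sequence `C(f) ⟶ C(f ≫ g) ⟶ Q` is the octahedral axiom before passing to homotopy. With `f
= 𝟙 X` it also identifies the cone of a termwise split monomorphism with its quotient. -/
lemma termwiseSplit_coneHom {X Y Z Q : Cpx B N} (f : X ⟶ Y) {g : Y ⟶ Z} {p : Z ⟶ Q} (k : X ⟶ Z)
    (hk : f ≫ g = k) (h : TermwiseSplit g p) :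
    TermwiseSplit (coneHom (f := f) (f' := k) (𝟙 X) g (by rw [hk, Category.id_comp]))
      (coneDesc k p (by rw [← hk, Category.assoc, h.zero, comp_zero])) := fun n => by
  obtain ⟨r, σ, h₁, h₂, h₃, h₄⟩ := h n
  have e := coneIn_coneHom_app (f := f) (f' := k) (𝟙 X) g (by rw [hk, Category.id_comp]) n
  have e' := coneInr_coneHom_app (f := f) (f' := k) (𝟙 X) g (by rw [hk, Category.id_comp]) n
  rw [CategoryTheory.Functor.map_id, id_app] at e'
  replace e' := e'.trans (Category.id_comp _)
  refine ⟨coneFst k n ≫ r ≫ (coneIn f).hom.app n + (coneOut k).hom.app n ≫ coneInr f n,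
    σ ≫ (coneIn k).hom.app n, ?_, ?_, ?_, ?_⟩
  · refine cone_hom_ext ?_ ?_
    · rw [← Category.assoc, e]
      simp [reassoc_of% h₁]
    · rw [← Category.assoc, e']
      simp
  · simp [coneDesc_app, h₂]
  · rw [coneDesc_app]
    refine cone_hom_ext ?_ ?_
    · rw [← Category.assoc, e]
      simp [h₃]
    · rw [← Category.assoc, e']
      simp
  · rw [Preadditive.add_comp, Category.assoc, Category.assoc, Category.assoc, e, e', coneDesc_app]
    refine cone_hom_ext ?_ ?_
    · simp only [Preadditive.comp_add, Category.assoc, coneIn_fst_assoc, coneIn_out_assoc, add_zero,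
        Category.comp_id]
      rw [← Category.assoc, ← Category.assoc (p.hom.app n), ← Preadditive.add_comp, h₄,
        Category.id_comp]
    · simp

/-! ### Contractibility of the cone of an identity -/

/-- On a summand `X^a` with `a < b` the two terms cancel. For `a = b` only the first survives, since
`dd` from `b` to `b - 1` is zero by convention. -/
lemma conePartC_id_sub (X : Cpx B N) (i : ℤ) (b : Finset.Ioo i (i + (N : ℤ))) :
    conePartC (𝟙 X) i b.1 - conePartC (𝟙 X) i (b.1 - 1) ≫ dd X.obj (b.1 - 1) b.1 =
      susπ X i b := by
  have hb := Finset.mem_Ioo.1 b.2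
  refine susι_hom_ext fun a => ?_
  have ha := Finset.mem_Ioo.1 a.2
  rw [Preadditive.comp_sub, susι_conePartC, ← Category.assoc, susι_conePartC, id_app,
    Category.id_comp, Category.id_comp, if_pos hb.2, if_pos (by omega)]
  by_cases hab : a = b
  · subst hab
    rw [susι_π_self, dd_of_lt X.obj (show a.1 - 1 < a.1 by omega)]
    simp
  · have hab' : a.1 ≠ b.1 := fun h => hab (Subtype.ext h)
    rw [susι_π_ne _ _ hab]
    by_cases hlt : a.1 ≤ b.1
    · rw [dd_comp _ (by omega) (by omega), sub_self]
    · rw [dd_of_lt X.obj (show b.1 < a.1 by omega), dd_of_lt X.obj (show b.1 - 1 < a.1 by omega)]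
      simp

/-- The inclusion of `X^m` into `(ΣX)^{m-N+1}`. -/
def susKappaC (X : Cpx B N) (m : ℤ) : X.obj.obj m ⟶ ((susC B N).obj X).obj.obj (m - N + 1) :=
  susKappa N X.obj m

lemma susKappaC_eq (hN : 2 ≤ N) (X : Cpx B N) (m : ℤ) :
    susKappaC X m = susι X (m - N + 1) ⟨m, Finset.mem_Ioo.2 ⟨by omega, by omega⟩⟩ := by
  refine susπ_hom_ext fun b => ?_
  have e : susKappaC X m ≫ susπ X (m - N + 1) b = if m = b.1 then dd X.obj m b.1 else 0 :=
    biproduct.lift_π _ _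
  rw [e]
  split_ifs with h
  · obtain ⟨b, hb⟩ := b
    subst h
    rw [susι_π_self, dd_self]
  · rw [susι_π_ne _ _ (fun h' => h (by rw [← h']))]

lemma nullHomotopic_id_cone_id (X : Cpx B N) : NullHomotopic (𝟙 (cone (𝟙 X))) := by
  rcases Nat.lt_or_ge N 2 with hN | hN
  · rcases Nat.lt_or_ge N 1 with h0 | h1
    -- In a `0`-complex the identities themselves vanish.
    · refine ⟨fun _ => 0, fun i => ?_⟩
      have e := dd_eq_zero (cone (𝟙 X)) (a := i) (b := i) (by omega)
      rw [dd_self] at e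
      rw [id_app, e]
      simp
    · exact nullHomotopic_of_eq_one (by omega) _
  -- The homotopy takes `X^n` in degree `n` to the last summand `X^n` of `ΣX` in degree `n - N + 1`.
  -- In the sum, only `n = i` contributes to `X^i`, while the part in `ΣX` telescopes.
  · refine ⟨fun n => coneFst (𝟙 X) n ≫ susKappaC X n ≫ coneInr (𝟙 X) (n - N + 1), fun i => ?_⟩
    set A : ∀ n, (cone (𝟙 X)).obj.obj i ⟶ X.obj.obj n := fun n =>
      coneFst (𝟙 X) i ≫ dd X.obj i n + (coneOut (𝟙 X)).hom.app i ≫ conePartC (𝟙 X) i n with hA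
    have hAn : ∀ n, i ≤ n → dd (cone (𝟙 X)).obj i n ≫ coneFst (𝟙 X) n = A n := fun n hn => by
      refine cone_hom_ext ?_ ?_
      · rw [← Category.assoc, coneIn_dd]
        simp [hA]
      · rw [← Category.assoc, coneInr_dd _ hn]
        simp [hA]
    have hA0 : A i = coneFst (𝟙 X) i := by
      have : conePartC (𝟙 X) i i = 0 := susι_hom_ext fun a => by
        have := (Finset.mem_Ioo.1 a.2).1
        rw [susι_conePartC, dd_of_lt _ this]
        simp
      simp [hA, this]
    have hAb : ∀ b : Finset.Ioo i (i + (N : ℤ)), A b.1 - A (b.1 - 1) ≫ dd X.obj (b.1 - 1) b.1 =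
        (coneOut (𝟙 X)).hom.app i ≫ susπ X i b := fun b => by
      have hb := Finset.mem_Ioo.1 b.2
      rw [← conePartC_id_sub]
      simp only [hA, Preadditive.add_comp, Category.assoc, Preadditive.comp_sub]
      rw [dd_comp _ (by omega) (by omega)]
      abel
    have term : ∀ n ∈ Finset.Ico i (i + (N : ℤ)), dd (cone (𝟙 X)).obj i n ≫
        (coneFst (𝟙 X) n ≫ susKappaC X n ≫ coneInr (𝟙 X) (n - N + 1)) ≫
          dd (cone (𝟙 X)).obj (n - N + 1) i =
        (if i = n then A n ≫ dd X.obj n i else 0) ≫ (coneIn (𝟙 X)).hom.app i +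
        (A n ≫ susKappaC X n ≫ dd ((susC B N).obj X).obj (n - N + 1) i) ≫ coneInr (𝟙 X) i := by
      intro n hn
      have hn := Finset.mem_Ico.1 hn
      have e : susKappaC X n ≫ conePartC (𝟙 X) (n - N + 1) i =
          if i = n then dd X.obj n i else 0 := by
        rw [susKappaC_eq hN, susι_conePartC, id_app, Category.id_comp]
        split_ifs with h₁ h₂ h₂
        · rfl
        · exact dd_of_lt X.obj (show i < n by omega)
        · omega
        · rfl
      simp only [Category.assoc]
      rw [coneInr_dd _ (by omega), reassoc_of% hAn n hn.1]
      simp only [Preadditive.comp_add]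
      rw [← Category.assoc (susKappaC X n), e]
      split_ifs <;> simp
    rw [Finset.sum_congr rfl term, Finset.sum_add_distrib, ← Preadditive.sum_comp,
      ← Preadditive.sum_comp, Finset.sum_ite_eq, if_pos (Finset.mem_Ico.2 ⟨le_rfl, by omega⟩),
      dd_self, hA0, Category.comp_id, id_app, ← cone_total]
    congr 2
    refine susπ_hom_ext fun b => ?_
    have hb := Finset.mem_Ioo.1 b.2
    rw [Preadditive.sum_comp, ← hAb]
    -- Projected to `X^b`, only the indices `n = b` and `n = b - 1` remain, and their difference is
    -- evaluated by `hAb`.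
    have term' : ∀ n ∈ Finset.Ico i (i + (N : ℤ)),
        (A n ≫ susKappaC X n ≫ dd ((susC B N).obj X).obj (n - N + 1) i) ≫ susπ X i b =
        (if b.1 = n then A n ≫ dd X.obj n b.1 else 0) -
          (if b.1 - 1 = n then A n ≫ dd X.obj n b.1 else 0) := by
      intro n hn
      have hn := Finset.mem_Ico.1 hn
      have e : susKappaC X n ≫ dd ((susC B N).obj X).obj (n - N + 1) i ≫ susπ X i b =
          (if b.1 = n then dd X.obj n b.1 else 0) - (if b.1 - 1 = n then dd X.obj n b.1 else 0) := by
        rw [dd_sus X (by omega)]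
        exact susKappa_map hN X.obj n i b
      rw [Category.assoc, Category.assoc, e, Preadditive.comp_sub]
      split_ifs <;> simp
    rw [Finset.sum_congr rfl term', Finset.sum_sub_distrib, Finset.sum_ite_eq, Finset.sum_ite_eq,
      if_pos (Finset.mem_Ico.2 ⟨by omega, by omega⟩),
      if_pos (Finset.mem_Ico.2 ⟨by omega, by omega⟩), dd_self, Category.comp_id]

end Cone

end NCpx

end

/-! ### Connecting morphisms, the square of the suspension and replacement of morphisms. -/

noncomputable section

namespace NCpx

universe v u

variable {B : Type u} [Category.{v} B] [Preadditive B] {N : ℕ} [HasFiniteBiproducts B]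

attribute [local instance] hasBinaryBiproducts_of_finite_biproducts

/-! ### The connecting morphism of a termwise split short exact sequence -/

section Connecting

variable {X Y Z : Cpx B N} {i : X ⟶ Y} {p : Y ⟶ Z} (h : TermwiseSplit i p)

-- The kernel of `C(i) ⟶ Z` is termwise the contractible complex `C(1_X)`.
include h in
lemma TermwiseSplit.isIso_coneDesc : IsIso ((toK B N).map (coneDesc i p h.zero)) :=
  (termwiseSplit_coneHom (𝟙 X) i (Category.id_comp _) h).isIso_right
    (nullHomotopic_id_cone_id X)

/-- The projection `C(f) ⟶ ΣX` in the homotopy category. -/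
def coneOutK {X Y : Cpx B N} (f : X ⟶ Y) :
    (toK B N).obj (cone f) ⟶ (sus B N).obj ((toK B N).obj X) :=
  (toK B N).map (coneOut f)

lemma coneHom_coneOutK {X Y X' Y' : Cpx B N} {f : X ⟶ Y} {f' : X' ⟶ Y'} (a : X ⟶ X')
    (b : Y ⟶ Y') (h : f ≫ b = a ≫ f') : (toK B N).map (coneHom a b h) ≫ coneOutK f' =
      coneOutK f ≫ (sus B N).map ((toK B N).map a) :=
  congrArg (toK B N).map (coneHom_coneOut a b h)

/-- The connecting morphism `Z ⟶ ΣX` of a termwise split short exact sequence. -/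
def TermwiseSplit.δ : (toK B N).obj Z ⟶ (sus B N).obj ((toK B N).obj X) :=
  have := h.isIso_coneDesc
  inv ((toK B N).map (coneDesc i p h.zero)) ≫ coneOutK i

lemma TermwiseSplit.coneDesc_δ :
    (toK B N).map (coneDesc i p h.zero) ≫ h.δ = coneOutK i := by
  have := h.isIso_coneDesc
  simp [TermwiseSplit.δ]

lemma TermwiseSplit.dist : TriangleData.dist ((toK B N).map i) ((toK B N).map p) h.δ := by
  have := h.isIso_coneDesc
  refine ⟨X, Y, i, Iso.refl _, Iso.refl _, (asIso ((toK B N).map (coneDesc i p h.zero))).symm,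
    by simp, ?_, ?_⟩
  · simp only [Iso.symm_hom, asIso_inv, Iso.refl_hom, Category.id_comp]
    rw [IsIso.comp_inv_eq, ← Functor.map_comp, coneIn_coneDesc]
  · simp only [Iso.symm_hom, asIso_inv, Iso.refl_hom, CategoryTheory.Functor.map_id]
    rw [Category.comp_id]
    rfl

lemma TermwiseSplit.δ_naturality {X' Y' Z' : Cpx B N} {i' : X' ⟶ Y'} {p' : Y' ⟶ Z'}
    (h' : TermwiseSplit i' p') (a : X ⟶ X') (b : Y ⟶ Y') (c : Z ⟶ Z') (hab : i ≫ b = a ≫ i')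
    (hbc : p ≫ c = b ≫ p') :
    (toK B N).map c ≫ h'.δ = h.δ ≫ (sus B N).map ((toK B N).map a) := by
  have := h.isIso_coneDesc
  rw [← cancel_epi ((toK B N).map (coneDesc i p h.zero)), ← Category.assoc, ← Functor.map_comp,
    ← coneHom_coneDesc i p h.zero i' p' h'.zero a b c hab hbc, Functor.map_comp, Category.assoc,
    h'.coneDesc_δ, coneHom_coneOutK, ← Category.assoc, h.coneDesc_δ]

lemma TermwiseSplit.isIso_δ (hY : NullHomotopic (𝟙 Y)) : IsIso h.δ := by
  have := h.isIso_coneDesc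
  have : IsIso (coneOutK i) := (termwiseSplit_cone i).isIso_right hY
  unfold TermwiseSplit.δ
  exact IsIso.comp_isIso

end Connecting

/-! ### The square of the suspension -/

section Pad

/-- The inclusion of `X^a` into `⨁_{m < b ≤ m + N} X^b`, or zero. -/
def padι₀ (N : ℕ) (X : ℤ ⥤ B) (m a : ℤ) :
    X.obj a ⟶ ⨁ fun b : Finset.Ioc m (m + (N : ℤ)) => X.obj b.1 :=
  if h : a ∈ Finset.Ioc m (m + (N : ℤ)) then
    biproduct.ι (fun b : Finset.Ioc m (m + (N : ℤ)) => X.obj b.1) ⟨a, h⟩ else 0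

/-- The projection of `⨁_{m < b ≤ m + N} X^b` to `X^a`, or zero. -/
def padπ₀ (N : ℕ) (X : ℤ ⥤ B) (m a : ℤ) :
    (⨁ fun b : Finset.Ioc m (m + (N : ℤ)) => X.obj b.1) ⟶ X.obj a :=
  if h : a ∈ Finset.Ioc m (m + (N : ℤ)) then
    biproduct.π (fun b : Finset.Ioc m (m + (N : ℤ)) => X.obj b.1) ⟨a, h⟩ else 0

lemma padι₀_π_self (X : ℤ ⥤ B) {m a : ℤ} (h : a ∈ Finset.Ioc m (m + (N : ℤ))) :
    padι₀ N X m a ≫ padπ₀ N X m a = 𝟙 _ := by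
  unfold padι₀ padπ₀
  rw [dif_pos h, dif_pos h, biproduct.ι_π_self]

lemma padι₀_π_ne (X : ℤ ⥤ B) {m a b : ℤ} (h : a ≠ b) : padι₀ N X m a ≫ padπ₀ N X m b = 0 := by
  unfold padι₀ padπ₀
  split_ifs with h₁ h₂
  · exact biproduct.ι_π_ne _ fun h' => h (by simpa using h')
  all_goals simp

lemma padι₀_hom_ext {X : ℤ ⥤ B} {m : ℤ} {A : B}
    {g g' : (⨁ fun b : Finset.Ioc m (m + (N : ℤ)) => X.obj b.1) ⟶ A}
    (h : ∀ a ∈ Finset.Ioc m (m + (N : ℤ)), padι₀ N X m a ≫ g = padι₀ N X m a ≫ g') : g = g' :=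
  biproduct.hom_ext' _ _ fun a => by
    have := h a.1 a.2
    simpa only [padι₀, dif_pos a.2] using this

lemma padι₀_eq_zero (X : ℤ ⥤ B) {m a : ℤ} (h : a ≤ m) : padι₀ N X m a = 0 :=
  dif_neg fun h' => by have := Finset.mem_Ioc.1 h'; omega

lemma padι₀_desc (X : ℤ ⥤ B) {m a : ℤ} {A : B} (g : ∀ a : ℤ, X.obj a ⟶ A)
    (h : a ∈ Finset.Ioc m (m + (N : ℤ))) : padι₀ N X m a ≫
      biproduct.desc (fun b : Finset.Ioc m (m + (N : ℤ)) => g b.1) = g a := by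
  rw [padι₀, dif_pos h, biproduct.ι_desc]

lemma padι₀_trans (X : ℤ ⥤ B) {m m' a : ℤ} (hm : m ≤ m') (h : a ≤ m + N) : padι₀ N X m a ≫
      biproduct.desc (fun b : Finset.Ioc m (m + (N : ℤ)) => padι₀ N X m' b.1) = padι₀ N X m' a := by
  by_cases h' : m < a
  · exact padι₀_desc X _ (Finset.mem_Ioc.2 ⟨h', h⟩)
  · rw [padι₀_eq_zero X (by omega), padι₀_eq_zero X (by omega), zero_comp]

/-- The contractible `N`-complex with terms `⨁_{m < a ≤ m + N} X^a`, with transition maps the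
projections followed by the inclusions. -/
def padC (X : Cpx B N) : Cpx B N :=
  ⟨{ obj := fun m => ⨁ fun a : Finset.Ioc m (m + (N : ℤ)) => X.obj.obj a.1
     map := fun {m m'} _ => biproduct.desc fun a => padι₀ N X.obj m' a.1
     map_id := fun m => padι₀_hom_ext fun a ha => by
       rw [padι₀_trans _ le_rfl (Finset.mem_Ioc.1 ha).2, Category.comp_id]
     map_comp := fun {m m' m''} f g => padι₀_hom_ext fun a ha => by
       have := (Finset.mem_Ioc.1 ha).2
       have h₁ := f.le
       have h₂ := g.le
       rw [← Category.assoc, padι₀_trans _ (h₁.trans h₂) this, padι₀_trans _ h₁ this,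
         padι₀_trans _ h₂ (by omega)] },
    fun m => padι₀_hom_ext fun a ha => by
      have := (Finset.mem_Ioc.1 ha).2
      rw [padι₀_trans _ (by omega) this, padι₀_eq_zero _ this, comp_zero]⟩

variable (X : Cpx B N)

/-- The inclusion of `X^a` into the term of degree `m` of `padC X`, or zero. -/
def padι (m a : ℤ) : X.obj.obj a ⟶ (padC X).obj.obj m := padι₀ N X.obj m a

/-- The projection of the term of degree `m` of `padC X` to `X^a`, or zero. -/
def padπ (m a : ℤ) : (padC X).obj.obj m ⟶ X.obj.obj a :=
  padπ₀ N X.obj m a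

/-- The morphism from the term of degree `m` of `padC X` with given components. -/
def padDesc (m : ℤ) {A : B} (g : ∀ a : ℤ, X.obj.obj a ⟶ A) : (padC X).obj.obj m ⟶ A :=
  biproduct.desc fun b : Finset.Ioc m (m + (N : ℤ)) => g b.1

variable {X} in
lemma padι_hom_ext {m : ℤ} {A : B} {g g' : (padC X).obj.obj m ⟶ A}
    (h : ∀ a, m < a → a ≤ m + N → padι X m a ≫ g = padι X m a ≫ g') : g = g' :=
  padι₀_hom_ext fun a ha => h a (Finset.mem_Ioc.1 ha).1 (Finset.mem_Ioc.1 ha).2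

lemma padι_eq_zero {m a : ℤ} (h : a ≤ m) : padι X m a = 0 := padι₀_eq_zero X.obj h

lemma padι_desc {m a : ℤ} {A : B} (g : ∀ a : ℤ, X.obj.obj a ⟶ A) (h : m < a) (h' : a ≤ m + N) :
    padι X m a ≫ padDesc X m g = g a := padι₀_desc X.obj g (Finset.mem_Ioc.2 ⟨h, h'⟩)

lemma padι_desc_assoc {m a : ℤ} {A A' : B} (g : ∀ a : ℤ, X.obj.obj a ⟶ A) (h : m < a)
    (h' : a ≤ m + N) (k : A ⟶ A') : padι X m a ≫ padDesc X m g ≫ k = g a ≫ k := by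
  rw [← Category.assoc, padι_desc X g h h']

lemma padι_dd {m m' a : ℤ} (hm : m ≤ m') (h : a ≤ m + N) :
    padι X m a ≫ dd (padC X).obj m m' = padι X m' a := by
  rw [dd_of_le _ hm]
  exact padι₀_trans X.obj hm h

lemma padι_dd_assoc {m m' a : ℤ} (hm : m ≤ m') (h : a ≤ m + N) {A : B}
    (k : (padC X).obj.obj m' ⟶ A) :
    padι X m a ≫ dd (padC X).obj m m' ≫ k = padι X m' a ≫ k := by
  rw [← Category.assoc, padι_dd X hm h]

lemma padι_π_self {m a : ℤ} (h : m < a) (h' : a ≤ m + N) : padι X m a ≫ padπ X m a = 𝟙 _ :=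
  padι₀_π_self X.obj (Finset.mem_Ioc.2 ⟨h, h'⟩)

lemma padι_π_ne {m a b : ℤ} (h : a ≠ b) : padι X m a ≫ padπ X m b = 0 := padι₀_π_ne X.obj h

/-- The summand `X^a` occurs exactly in degrees `a - N` to `a - 1`, with identity transition maps,
so the complex is a sum of elementary contractible ones. The homotopy leads from the last of these
degrees back to the first. -/
lemma nullHomotopic_id_padC : NullHomotopic (𝟙 (padC X)) := by
  refine ⟨fun n => padπ X n (n + 1) ≫ padι X (n - N + 1) (n + 1), fun i => ?_⟩
  refine padι_hom_ext fun a h h' => ?_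
  rw [Preadditive.comp_sum, Finset.sum_eq_single (a - 1)]
  -- The index `a - 1 + 1` is not definitionally `a`, so it is replaced by a variable `c` that can
  -- be substituted.
  · have key : ∀ c, c = a → padι X (a - 1) a ≫ (padπ X (a - 1) c ≫ padι X (a - 1 - N + 1) c) ≫
        dd (padC X).obj (a - 1 - N + 1) i = padι X i a := fun c hc => by
      subst hc
      rw [Category.assoc, ← Category.assoc, padι_π_self X (by omega) (by omega), Category.id_comp,
        padι_dd X (by omega) (by omega)]
    rw [padι_dd_assoc X (by omega) h', key _ (by omega), id_app, Category.comp_id]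
  · intro n hn hn'
    have := Finset.mem_Ico.1 hn
    rw [padι_dd_assoc X this.1 h', Category.assoc, ← Category.assoc, padι_π_ne X (by omega),
      zero_comp]
  · intro hn
    exact absurd (Finset.mem_Ico.2 ⟨by omega, by omega⟩) hn

/-- The inclusion of `X^a` into `(ΣX)^m`, or zero. -/
def susι' (m a : ℤ) : X.obj.obj a ⟶ ((susC B N).obj X).obj.obj m :=
  if h : a ∈ Finset.Ioo m (m + (N : ℤ)) then susι X m ⟨a, h⟩ else 0

variable {X} in
lemma susι'_hom_ext {m : ℤ} {A : B} {g g' : ((susC B N).obj X).obj.obj m ⟶ A}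
    (h : ∀ a, m < a → a < m + N → susι' X m a ≫ g = susι' X m a ≫ g') : g = g' :=
  susι_hom_ext fun a => by
    have := h a.1 (Finset.mem_Ioo.1 a.2).1 (Finset.mem_Ioo.1 a.2).2
    simpa only [susι', dif_pos a.2] using this

lemma susι'_eq_zero {m a : ℤ} (h : a ≤ m ∨ m + N ≤ a) : susι' X m a = 0 :=
  dif_neg fun h' => by have := Finset.mem_Ioo.1 h'; omega

lemma susι'_π {m a : ℤ} (b : Finset.Ioo m (m + (N : ℤ))) :
    susι' X m a ≫ susπ X m b = if a = b.1 then dd X.obj a b.1 else 0 := by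
  by_cases h : a = b.1
  · subst h
    rw [susι', dif_pos b.2, if_pos rfl, dd_self]
    exact susι_π_self X m b
  · rw [if_neg h]
    unfold susι'
    split_ifs with h'
    · exact susι_π_ne X m fun e => h (congrArg Subtype.val e)
    · exact zero_comp

/-- Both entries of the companion matrix appear in one formula because `susι'` is zero outside the
window: a summand already passed, or not yet reached, contributes nothing. -/
lemma susι'_dd {m m' a : ℤ} (hm : m ≤ m') (h : m < a) (h' : a < m + N) :
    susι' X m a ≫ dd ((susC B N).obj X).obj m m' =
      susι' X m' a - dd X.obj a (m + N) ≫ susι' X m' (m + N) := by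
  refine susπ_hom_ext fun b => ?_
  have e := susι_dd_π X hm ⟨a, Finset.mem_Ioo.2 ⟨h, h'⟩⟩ b
  rw [susι', dif_pos (Finset.mem_Ioo.2 ⟨h, h'⟩), Category.assoc, e, Preadditive.sub_comp,
    Category.assoc, susι'_π, susι'_π, susCoeff, sub_smul]
  have hb := Finset.mem_Ioo.1 b.2
  congr 1
  · split_ifs <;> simp
  · by_cases hb' : b.1 = m + N
    · rw [if_pos hb', if_pos hb'.symm, one_smul, dd_comp _ (by omega) (by omega)]
    · rw [if_neg hb', if_neg (fun h => hb' h.symm)]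
      simp

/-- The morphism from `(ΣX)^m` with given components. -/
def susDesc (m : ℤ) {A : B} (g : ∀ a : ℤ, X.obj.obj a ⟶ A) : ((susC B N).obj X).obj.obj m ⟶ A :=
  biproduct.desc fun b : Finset.Ioo m (m + (N : ℤ)) => g b.1

lemma susι'_desc {m a : ℤ} {A : B} (g : ∀ a : ℤ, X.obj.obj a ⟶ A) (h : m < a) (h' : a < m + N) :
    susι' X m a ≫ susDesc X m g = g a := by
  rw [susι', dif_pos (Finset.mem_Ioo.2 ⟨h, h'⟩)]
  exact biproduct.ι_desc _ _

lemma susι'_desc_assoc {m a : ℤ} {A A' : B} (g : ∀ a : ℤ, X.obj.obj a ⟶ A) (h : m < a)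
    (h' : a < m + N) (k : A ⟶ A') : susι' X m a ≫ susDesc X m g ≫ k = g a ≫ k := by
  rw [← Category.assoc, susι'_desc X g h h']

/-- The inclusion of the suspension into `padC X`. -/
def susToPad : (susC B N).obj X ⟶ padC X :=
  mkHom (fun m => susDesc X m fun a => padι X m a - dd X.obj a (m + N) ≫ padι X m (m + N))
    (fun m m' hm => by
      refine susι'_hom_ext fun a h h' => ?_
      rw [← Category.assoc, susι'_dd X hm h h', susι'_desc_assoc X _ h h', Preadditive.sub_comp,
        Preadditive.sub_comp, padι_dd X hm (by omega), Category.assoc, Category.assoc,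
        padι_dd X hm le_rfl]
      by_cases h₁ : m' < a
      · rw [susι'_desc X _ h₁ (by omega)]
        rcases hm.eq_or_lt with rfl | h₂
        · rw [susι'_eq_zero X (Or.inr le_rfl)]
          simp
        · rw [susι'_desc X _ (by omega) (by omega), Preadditive.comp_sub,
            dd_comp_assoc _ (by omega) (by omega)]
          abel
      · rw [susι'_eq_zero X (Or.inl (by omega)), padι_eq_zero X (show a ≤ m' by omega)]
        by_cases h₂ : m' < m + N
        · rw [susι'_desc X _ h₂ (by omega), Preadditive.comp_sub,
            dd_comp_assoc _ (by omega) (by omega),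
            -- The summand `X^a` has left the window, and its image in the new last summand
            -- `X^{m'+N}` consists of at least `N` differentials.
            dd_eq_zero X (show a + N ≤ m' + N by omega)]
          simp
        · rw [susι'_eq_zero X (Or.inl (by omega)), padι_eq_zero X (show m + N ≤ m' by omega)]
          simp)

lemma susι'_susToPad {m a : ℤ} (h : m < a) (h' : a < m + N) :
    susι' X m a ≫ (susToPad X).hom.app m =
      padι X m a - dd X.obj a (m + N) ≫ padι X m (m + N) :=
  susι'_desc X (fun a => padι X m a - dd X.obj a (m + N) ≫ padι X m (m + N)) h h'

/-- The projection from `padC X` to the translate of `X`. -/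
def padToTransl : padC X ⟶ (translC B N N).obj X :=
  mkHom (fun m => padDesc X m fun a => dd X.obj a (m + N)) (fun m m' hm => by
    refine padι_hom_ext fun a h h' => ?_
    have e : padι X m a ≫ padDesc X m (fun a => dd X.obj a (m + N)) ≫
        dd X.obj (m + N) (m' + N) = dd X.obj a (m' + N) := by
      rw [padι_desc_assoc X _ h h', dd_comp X.obj h' (by omega)]
    rw [dd_translC X _ hm, padι_dd_assoc X hm h']
    refine Eq.trans ?_ e.symm
    by_cases h₁ : m' < a
    · exact padι_desc X _ h₁ (by omega)
    · rw [padι_eq_zero X (by omega), zero_comp,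
        dd_eq_zero X (show a + N ≤ m' + N by omega)]
      rfl)

lemma padι_padToTransl {m a : ℤ} (h : m < a) (h' : a ≤ m + N) :
    padι X m a ≫ (padToTransl X).hom.app m = dd X.obj a (m + N) :=
  padι_desc X (fun a => dd X.obj a (m + N)) h h'

/-- The last summand `X^{m+N}` splits the projection, and its kernel consists of the elements `x - d
x` with `x` in the remaining summands. As the middle term is contractible, `δ` identifies `X[N]`
with `Σ(ΣX)`. -/
lemma termwiseSplit_susToPad (hN : 1 ≤ N) : TermwiseSplit (susToPad X) (padToTransl X) := by
  intro m
  let σ : ((translC B N N).obj X).obj.obj m ⟶ (padC X).obj.obj m := padι X m (m + N)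
  have hσ : dd X.obj (m + N) (m + N) ≫ padι X m (m + N) = σ := by
    rw [dd_self]; exact Category.id_comp _
  have e : ∀ a, m < a → a ≤ m + N → padι X m a ≫ (padToTransl X).hom.app m ≫ σ =
      dd X.obj a (m + N) ≫ padι X m (m + N) := fun a h h' => by
    rw [← Category.assoc, padι_padToTransl X h h']
    rfl
  refine ⟨padDesc X m fun a => susι' X m a, σ, ?_, ?_, ?_, ?_⟩
  · refine susι'_hom_ext fun a h h' => ?_
    rw [← Category.assoc, susι'_susToPad X h h', Preadditive.sub_comp, Category.assoc,
      padι_desc X _ h (by omega), padι_desc X _ (by omega) (by omega),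
      susι'_eq_zero X (Or.inr le_rfl)]
    simp
  · refine (padι_padToTransl X (show m < m + (N : ℤ) by omega) le_rfl).trans ?_
    rw [dd_self]; rfl
  · refine susι'_hom_ext fun a h h' => ?_
    rw [← Category.assoc, susι'_susToPad X h h', Preadditive.sub_comp, Category.assoc,
      padι_padToTransl X h (by omega), padι_padToTransl X (by omega) (by omega), dd_self, comp_zero]
    exact sub_eq_zero.2 (Category.comp_id _).symm
  · refine padι_hom_ext fun a h h' => ?_
    rw [Preadditive.comp_add, padι_desc_assoc X _ h h', e a h h', Category.comp_id]
    rcases h'.lt_or_eq with h₁ | rfl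
    · rw [susι'_susToPad X h h₁]
      abel
    · rw [susι'_eq_zero X (Or.inr le_rfl), dd_self]
      simp

variable {X} {Y : Cpx B N} (f : X ⟶ Y)

/-- The functoriality of `padC`. -/
def padHom : padC X ⟶ padC Y :=
  mkHom (fun m => padDesc X m fun a => f.hom.app a ≫ padι Y m a) (fun m m' hm => by
    refine padι_hom_ext fun a h h' => ?_
    rw [padι_dd_assoc X hm h', padι_desc_assoc X _ h h', Category.assoc, padι_dd Y hm h']
    by_cases h₁ : m' < a
    · exact padι_desc X _ h₁ (by omega)
    · rw [padι_eq_zero X (by omega), padι_eq_zero Y (by omega), zero_comp, comp_zero])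

lemma padι_padHom {m a : ℤ} (h : m < a) (h' : a ≤ m + N) :
    padι X m a ≫ (padHom f).hom.app m = f.hom.app a ≫ padι Y m a :=
  padι_desc X (fun a => f.hom.app a ≫ padι Y m a) h h'

lemma susι'_map (m a : ℤ) :
    susι' X m a ≫ ((susC B N).map f).hom.app m = f.hom.app a ≫ susι' Y m a := by
  unfold susι'
  split_ifs with h
  · exact susι_map f m ⟨a, h⟩
  · simp

lemma susToPad_naturality : susToPad X ≫ padHom f = (susC B N).map f ≫ susToPad Y :=
  hom_ext_app fun m => by
    refine susι'_hom_ext fun a h h' => ?_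
    rw [comp_app, comp_app, ← Category.assoc, susι'_susToPad X h h', ← Category.assoc, susι'_map,
      Category.assoc, susι'_susToPad Y h h', Preadditive.sub_comp, Category.assoc,
      padι_padHom f h h'.le, padι_padHom f (by omega) le_rfl, Preadditive.comp_sub, app_dd_assoc]

lemma padToTransl_naturality :
    padToTransl X ≫ (translC B N N).map f = padHom f ≫ padToTransl Y :=
  hom_ext_app fun m => by
    refine padι_hom_ext fun a h h' => ?_
    rw [comp_app, comp_app, ← Category.assoc, padι_padToTransl X h h', ← Category.assoc,
      padι_padHom f h h', Category.assoc, padι_padToTransl Y h h']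
    exact dd_naturality f.hom a (m + N)

end Pad

end NCpx

end

noncomputable section

namespace NCpx

universe v u

variable {B : Type u} [Category.{v} B] [Preadditive B] {N : ℕ}

/-! ### Functors induced on homotopy categories -/

lemma liftK_additive {M : ℕ} (F : Cpx B N ⥤ Cpx B M)
    (hsub : ∀ ⦃X Y : Cpx B N⦄ (f g : X ⟶ Y), F.map (f - g) = F.map f - F.map g)
    (hF : ∀ ⦃X Y : Cpx B N⦄ (f : X ⟶ Y), NullHomotopic f → NullHomotopic (F.map f)) :
    (liftK F hsub hF).Additive where
  map_add {X Y f g} := by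
    obtain ⟨f, rfl⟩ := (toK B N).map_surjective f
    obtain ⟨g, rfl⟩ := (toK B N).map_surjective g
    have h0 : F.map (0 : X.as ⟶ Y.as) = 0 := by
      rw [← sub_self (0 : X.as ⟶ Y.as), hsub, sub_self]
    have h : F.map (f + g) = F.map f + F.map g := by
      rw [show f + g = f - (0 - g) by abel, hsub, hsub, h0]
      abel
    rw [← Functor.map_add]
    exact (congrArg (toK B M).map h).trans (toK B M).map_add

lemma reindex_comp {P Q : ℕ} (φ ψ : ℤ → ℤ) (hφ : Monotone φ) (hψ : Monotone ψ)
    (h : ∀ i, φ (i + P) = φ i + N) (h' : ∀ i, ψ (i + Q) = ψ i + P) :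
    (reindex φ hφ h ⋙ reindex ψ hψ h' : K B N ⥤ K B Q) =
      reindex (φ ∘ ψ) (hφ.comp hψ) (fun i => by simp [h, h']) :=
  CategoryTheory.Quotient.lift_unique' _ _ _ rfl

lemma reindex_eq_id (φ : ℤ → ℤ) (hφ : Monotone φ) (h : ∀ i, φ (i + N) = φ i + N)
    (hφ' : ∀ i, φ i = i) : (reindex φ hφ h : K B N ⥤ K B N) = 𝟭 _ := by
  obtain rfl : φ = id := funext hφ'
  exact CategoryTheory.Quotient.lift_unique' _ _ _ rfl

/-- The translation of the homotopy category. -/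
def transl (B : Type u) [Category.{v} B] [Preadditive B] (N : ℕ) (k : ℤ) : K B N ⥤ K B N :=
  reindex (fun i => i + k) (fun _ _ h => by simpa using h) (fun i => by ring)

instance (k : ℤ) : (transl B N k).IsEquivalence :=
  (CategoryTheory.Equivalence.mk (transl B N k) (transl B N (-k))
    (eqToIso ((reindex_comp _ _ _ _ _ _).trans (reindex_eq_id _ _ _ fun i => by simp)).symm)
    (eqToIso ((reindex_comp _ _ _ _ _ _).trans
      (reindex_eq_id _ _ _ fun i => by simp)))).isEquivalence_functor

variable [HasFiniteBiproducts B]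

attribute [local instance] hasBinaryBiproducts_of_finite_biproducts

/-! ### The suspension is an autoequivalence -/

instance : (sus B N).Additive := liftK_additive _ _ _

/-- The square of the suspension is the translation by `N`. -/
def susSquareIso (hN : 1 ≤ N) : transl B N N ≅ sus B N ⋙ sus B N :=
  NatIso.ofComponents
    (fun X =>
      @asIso _ _ _ _ (termwiseSplit_susToPad X.as hN).δ
        ((termwiseSplit_susToPad X.as hN).isIso_δ (nullHomotopic_id_padC X.as)))
    (fun {X Y} f => by
      obtain ⟨f, rfl⟩ := (toK B N).map_surjective f
      exact (termwiseSplit_susToPad X.as hN).δ_naturality (termwiseSplit_susToPad Y.as hN)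
        ((susC B N).map f) (padHom f) ((translC B N N).map f) (susToPad_naturality f)
        (padToTransl_naturality f))

lemma isEquivalence_of_comp_self {C : Type*} [Category* C] (F : C ⥤ C)
    [(F ⋙ F).IsEquivalence] : F.IsEquivalence := by
  have : F.Faithful := Functor.Faithful.of_comp F F
  have : F.EssSurj := ⟨fun Y => ⟨F.obj ((F ⋙ F).objPreimage Y), ⟨(F ⋙ F).objObjPreimageIso Y⟩⟩⟩
  have : F.Full := ⟨fun {X Y} g => by
    obtain ⟨f, hf⟩ := (F ⋙ F).map_surjective (F.map g)
    exact ⟨f, F.map_injective hf⟩⟩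
  exact { }

lemma sus_isEquivalence (hN : 1 ≤ N) : (sus B N).IsEquivalence := by
  have : (sus B N ⋙ sus B N).IsEquivalence := Functor.isEquivalence_of_iso (susSquareIso hN)
  exact isEquivalence_of_comp_self _

/-! ### Replacing a morphism by a termwise split monomorphism -/

section Replacement

variable {X Y : Cpx B N} (f : X ⟶ Y)

lemma sum_hom_ext {X Y : Cpx B N} {n : ℤ} {A : B} {g g' : (sumC X Y).obj.obj n ⟶ A}
    (h₁ : (sumInl X Y).hom.app n ≫ g = (sumInl X Y).hom.app n ≫ g')
    (h₂ : (sumInr X Y).hom.app n ≫ g = (sumInr X Y).hom.app n ≫ g') : g = g' :=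
  biprod.hom_ext' _ _ h₁ h₂

@[simp] lemma sumInl_fst_app (X Y : Cpx B N) (n : ℤ) :
    (sumInl X Y).hom.app n ≫ (sumFst X Y).hom.app n = 𝟙 _ := biprod.inl_fst

@[simp] lemma sumInr_fst_app (X Y : Cpx B N) (n : ℤ) :
    (sumInr X Y).hom.app n ≫ (sumFst X Y).hom.app n = 0 := biprod.inr_fst

@[simp] lemma sumInl_snd_app (X Y : Cpx B N) (n : ℤ) :
    (sumInl X Y).hom.app n ≫ (sumSnd X Y).hom.app n = 0 := biprod.inl_snd

@[simp] lemma sumInr_snd_app (X Y : Cpx B N) (n : ℤ) :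
    (sumInr X Y).hom.app n ≫ (sumSnd X Y).hom.app n = 𝟙 _ := biprod.inr_snd

@[simp] lemma sumInl_fst_app_assoc (X Y : Cpx B N) (n : ℤ) {A : B} (g : X.obj.obj n ⟶ A) :
    (sumInl X Y).hom.app n ≫ (sumFst X Y).hom.app n ≫ g = g := biprod.inl_fst_assoc _

@[simp] lemma sumInr_fst_app_assoc (X Y : Cpx B N) (n : ℤ) {A : B} (g : X.obj.obj n ⟶ A) :
    (sumInr X Y).hom.app n ≫ (sumFst X Y).hom.app n ≫ g = 0 := by
  rw [← Category.assoc, sumInr_fst_app, zero_comp]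

@[simp] lemma sumInl_snd_app_assoc (X Y : Cpx B N) (n : ℤ) {A : B} (g : Y.obj.obj n ⟶ A) :
    (sumInl X Y).hom.app n ≫ (sumSnd X Y).hom.app n ≫ g = 0 := by
  rw [← Category.assoc, sumInl_snd_app, zero_comp]

@[simp] lemma sumInr_snd_app_assoc (X Y : Cpx B N) (n : ℤ) {A : B} (g : Y.obj.obj n ⟶ A) :
    (sumInr X Y).hom.app n ≫ (sumSnd X Y).hom.app n ≫ g = g := biprod.inr_snd_assoc _

/-- The morphism `(f, -1) : X ⟶ Y ⊕ C(1_X)`. -/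
def replIn : X ⟶ sumC Y (cone (𝟙 X)) := f ≫ sumInl _ _ - coneIn (𝟙 X) ≫ sumInr _ _

/-- The canonical morphism `Y ⊕ C(1_X) ⟶ C(f)`. -/
def replOut : sumC Y (cone (𝟙 X)) ⟶ cone f :=
  sumFst _ _ ≫ coneIn f + sumSnd _ _ ≫ coneHom (𝟙 X) f rfl

lemma replIn_fst : replIn f ≫ sumFst _ _ = f := by simp [replIn]

lemma replIn_snd : replIn f ≫ sumSnd _ _ = -coneIn (𝟙 X) := by simp [replIn]

lemma sumInl_replOut : sumInl _ _ ≫ replOut f = coneIn f := by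
  rw [replOut, Preadditive.comp_add, ← Category.assoc, ← Category.assoc]
  simp

lemma sumInr_replOut : sumInr _ _ ≫ replOut f = coneHom (𝟙 X) f rfl := by
  rw [replOut, Preadditive.comp_add, ← Category.assoc, ← Category.assoc]
  simp

/-- Termwise `C(1_X)` is `X ⊕ ΣX`, and the component `-1` of `replIn` in `X` makes minus the
projection a retraction; what is left is `Y ⊕ ΣX`, the cone of `f`. -/
lemma termwiseSplit_repl : TermwiseSplit (replIn f) (replOut f) := fun n => by
  have e₁ : (sumInl _ _).hom.app n ≫ (replOut f).hom.app n = (coneIn f).hom.app n := by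
    rw [← comp_app, sumInl_replOut]
  have e₂ : (coneIn (𝟙 X)).hom.app n ≫ (coneHom (𝟙 X) f rfl).hom.app n =
      f.hom.app n ≫ (coneIn f).hom.app n := coneIn_coneHom_app (𝟙 X) f rfl n
  have e₃ : coneInr (𝟙 X) n ≫ (coneHom (𝟙 X) f rfl).hom.app n = coneInr f n := by
    rw [coneInr_coneHom_app, CategoryTheory.Functor.map_id, id_app]
    exact Category.id_comp _
  have e₄ : (sumInr _ _).hom.app n ≫ (replOut f).hom.app n =
      (coneHom (𝟙 X) f rfl).hom.app n := by
    rw [← comp_app, sumInr_replOut]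
  have e₅ : (replIn f).hom.app n = f.hom.app n ≫ (sumInl _ _).hom.app n -
      (coneIn (𝟙 X)).hom.app n ≫ (sumInr _ _).hom.app n := rfl
  refine ⟨-((sumSnd _ _).hom.app n ≫ coneFst (𝟙 X) n), coneFst f n ≫ (sumInl _ _).hom.app n +
    (coneOut f).hom.app n ≫ coneInr (𝟙 X) n ≫ (sumInr _ _).hom.app n, ?_, ?_, ?_, ?_⟩
  · simp [e₅]
  · simp only [Preadditive.add_comp, Category.assoc, e₁, e₄, e₃]
    exact cone_total f n
  · simp [e₅, Preadditive.sub_comp, e₁, e₄, e₂]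
  · refine sum_hom_ext ?_ (cone_hom_ext ?_ ?_)
    · simp only [Preadditive.comp_add, Preadditive.comp_neg, Preadditive.neg_comp,
        sumInl_snd_app_assoc, neg_zero, zero_add, reassoc_of% e₁, coneIn_fst_assoc,
        coneIn_out_assoc, add_zero, Category.comp_id, Category.assoc]
    · simp only [Preadditive.comp_add, Preadditive.comp_neg, Preadditive.neg_comp,
        sumInr_snd_app_assoc, Category.assoc, reassoc_of% e₄, coneIn_fst_assoc, e₅,
        Preadditive.comp_sub, reassoc_of% e₂, coneIn_out_assoc, comp_zero, add_zero,
        Category.comp_id]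
      abel
    · simp only [Preadditive.comp_add, Preadditive.comp_neg, Preadditive.neg_comp,
        sumInr_snd_app_assoc, Category.assoc, reassoc_of% e₄, coneInr_fst_assoc,
        neg_zero, zero_add, reassoc_of% e₃, coneInr_out_assoc, Category.comp_id]

lemma replIn_fst' : replIn f ≫ sumFst _ _ = 𝟙 X ≫ f := by rw [replIn_fst, Category.id_comp]

/-- The kernel is the contractible `C(1_X)`, so replacing `f` by `replIn f` does not change the cone
up to homotopy equivalence. -/
lemma termwiseSplit_coneHom_fst : TermwiseSplit (sumInr Y (cone (𝟙 X)) ≫ coneIn (replIn f))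
    (coneHom (𝟙 X) (sumFst _ _) (replIn_fst' f)) := fun n => by
  have e₁ := coneIn_coneHom_app (𝟙 X) (sumFst _ _) (replIn_fst' f) n
  have e₂ : coneInr (replIn f) n ≫ (coneHom (𝟙 X) (sumFst _ _) (replIn_fst' f)).hom.app n =
      coneInr f n := by
    rw [coneInr_coneHom_app, CategoryTheory.Functor.map_id, id_app]
    exact Category.id_comp _
  refine ⟨coneFst _ n ≫ (sumSnd _ _).hom.app n, coneFst f n ≫ (sumInl _ _).hom.app n ≫
    (coneIn _).hom.app n + (coneOut f).hom.app n ≫ coneInr _ n, ?_, ?_, ?_, ?_⟩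
  · simp
  · simp only [Preadditive.add_comp, Category.assoc, e₁, e₂, sumInl_fst_app_assoc]
    exact cone_total f n
  · simp [e₁]
  · refine cone_hom_ext (sum_hom_ext ?_ ?_) ?_
    · simp [reassoc_of% e₁]
    · simp [reassoc_of% e₁]
    · simp [reassoc_of% e₂]

end Replacement

end NCpx

end

/-! ### The axioms of a triangulated category for the homotopy category. -/

noncomputable section

namespace NCpx

universe v u

variable {B : Type u} [Category.{v} B] [Preadditive B] {N : ℕ} [HasFiniteBiproducts B]

attribute [local instance] hasBinaryBiproducts_of_finite_biproducts

/-! ### The homotopy category is triangulated -/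

/-- The morphism from the mapping cone of `Y ⟶ C(1_Y)` to `C(1_Y)` that is the identity on `C(1_Y)` and
the inclusion on `ΣY`. -/
def coneConeId (Y : Cpx B N) : cone (coneIn (𝟙 Y)) ⟶ cone (𝟙 Y) :=
  mkHom (fun m => coneFst (coneIn (𝟙 Y)) m + (coneOut (coneIn (𝟙 Y))).hom.app m ≫ coneInr (𝟙 Y) m)
    (fun m m' hm => by
      refine cone_hom_ext ?_ ?_
      · simp only [Preadditive.comp_add, Preadditive.add_comp, reassoc_of% coneIn_dd (coneIn (𝟙 Y)),
          Category.assoc, coneIn_fst, coneIn_fst_assoc, coneIn_out_assoc, comp_zero, add_zero,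
          Category.comp_id]
      · rw [← Category.assoc, coneInr_dd _ hm]
        simp only [Preadditive.comp_add, Preadditive.add_comp, Category.assoc, coneIn_fst,
          coneIn_out_assoc, coneInr_fst, coneInr_fst_assoc, coneInr_out_assoc, coneInr_dd (𝟙 Y) hm,
          comp_zero, add_zero, zero_add, Category.comp_id]
        rw [← conePartC_comp, Category.id_comp])

lemma coneConeId_out (Y : Cpx B N) : coneConeId Y ≫ coneOut (𝟙 Y) =
    coneDesc _ _ (termwiseSplit_cone (𝟙 Y)).zero + coneOut (coneIn (𝟙 Y)) :=
  hom_ext_app fun m => by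
    rw [comp_app, add_app, coneDesc_app]
    simp only [coneConeId, mkHom_app, Preadditive.add_comp, Category.assoc, coneInr_out,
      Category.comp_id]

lemma eq_neg_id_of_epi {C : Type*} [Category* C] [Preadditive C] {A Z : C} (p q : A ⟶ Z) [Epi p]
    (d : Z ⟶ Z) (h : p ≫ d = q) (e : p + q = 0) : d = -𝟙 Z := by
  rw [← cancel_epi p, h, Preadditive.comp_neg, Category.comp_id]
  exact eq_neg_of_add_eq_zero_right e

lemma eq_neg_of_comp_neg_id {C : Type*} [Category* C] [Preadditive C] {A Z : C} (m d : A ⟶ Z)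
    (h : m ≫ (-𝟙 Z) = d ≫ 𝟙 Z) : d = -m := by
  rw [Category.comp_id, Preadditive.comp_neg, Category.comp_id] at h
  exact h.symm

/-- From the cone of `Y ⟶ C(1_Y)` there are two maps to `ΣY`, through the quotient of `C(1_Y)` and
through the cone projection. Their sum factors through the contractible `C(1_Y)` by
`coneConeId_out`; this is the source of the sign in the rotation axiom. -/
lemma δ_cone_id (Y : Cpx B N) :
    (termwiseSplit_cone (𝟙 Y)).δ = -𝟙 ((sus B N).obj ((toK B N).obj Y)) := by
  have := (termwiseSplit_cone (𝟙 Y)).isIso_coneDesc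
  have e := (toK_map_eq_zero_iff _).2
    (((nullHomotopic_id_cone_id Y).postcomp (coneOut (𝟙 Y))).precomp (coneConeId Y))
  rw [Category.id_comp, coneConeId_out, Functor.map_add] at e
  exact eq_neg_id_of_epi ((toK B N).map (coneDesc _ _ (termwiseSplit_cone (𝟙 Y)).zero))
    (coneOutK _) _ (termwiseSplit_cone (𝟙 Y)).coneDesc_δ e

/-- Naturality of `δ` along `C(f) ⟶ C(1_Y)` reduces this to the identity of `Y`. -/
lemma δ_cone {X Y : Cpx B N} (f : X ⟶ Y) :
    (termwiseSplit_cone f).δ = -(sus B N).map ((toK B N).map f) := by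
  have h := (termwiseSplit_cone f).δ_naturality (termwiseSplit_cone (𝟙 Y)) (𝟙 Y)
    (coneHom f (𝟙 Y) rfl) ((susC B N).map f)
    (by rw [coneIn_coneHom]) (coneHom_coneOut _ _ _).symm
  rw [δ_cone_id, CategoryTheory.Functor.map_id, CategoryTheory.Functor.map_id] at h
  exact eq_neg_of_comp_neg_id _ _ h

/-- Cones are functorial only for strictly commutative squares. After replacing `f` by `replIn f`, a
square that commutes up to homotopy can be made strict. -/
lemma exists_cone_map {X Y X' Y' : Cpx B N} (f : X ⟶ Y) (f' : X' ⟶ Y')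
    (a : (toK B N).obj X ⟶ (toK B N).obj X') (b : (toK B N).obj Y ⟶ (toK B N).obj Y')
    (h : (toK B N).map f ≫ b = a ≫ (toK B N).map f') :
    ∃ c : (toK B N).obj (cone f) ⟶ (toK B N).obj (cone f'),
      (toK B N).map (coneIn f) ≫ c = b ≫ (toK B N).map (coneIn f') ∧
        coneOutK f ≫ (sus B N).map a = c ≫ coneOutK f' := by
  obtain ⟨a, rfl⟩ := (toK B N).map_surjective a
  obtain ⟨b, rfl⟩ := (toK B N).map_surjective b
  rw [← Functor.map_comp, ← Functor.map_comp, ← sub_eq_zero, ← Functor.map_sub,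
    toK_map_eq_zero_iff] at h
  -- The defect `f ≫ b - a ≫ f'` is null-homotopic, hence extends to `t` on `C(1_X)`. The component
  -- of `replIn f` there is minus the inclusion, so `t` subtracts the defect.
  obtain ⟨t, -, ht⟩ := (termwiseSplit_cone (𝟙 X)).exists_extension h
  have hb : replIn f ≫ (sumFst _ _ ≫ b + sumSnd _ _ ≫ t) = a ≫ f' := by
    rw [Preadditive.comp_add, ← Category.assoc, ← Category.assoc, replIn_fst, replIn_snd,
      Preadditive.neg_comp, ht]
    abel
  have := (termwiseSplit_coneHom_fst f).isIso_right (nullHomotopic_id_cone_id X)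
  refine ⟨inv ((toK B N).map (coneHom (𝟙 X) (sumFst _ _) (replIn_fst' f))) ≫
    (toK B N).map (coneHom a _ hb), ?_, ?_⟩
  · have e : coneIn f = (sumInl _ _ ≫ coneIn (replIn f)) ≫
        coneHom (𝟙 X) (sumFst _ _) (replIn_fst' f) := by
      rw [Category.assoc, coneIn_coneHom, ← Category.assoc, sumInl_sumFst, Category.id_comp]
    rw [e, Functor.map_comp, Category.assoc, IsIso.hom_inv_id_assoc, ← Functor.map_comp,
      ← Functor.map_comp, Category.assoc, coneIn_coneHom, Preadditive.add_comp,
      Preadditive.comp_add, Category.assoc, Category.assoc, ← Category.assoc (sumInl _ _),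
      sumInl_sumFst, Category.id_comp, ← Category.assoc (sumInl _ _), sumInl_sumSnd, zero_comp,
      add_zero]
  · rw [← cancel_epi ((toK B N).map (coneHom (𝟙 X) (sumFst _ _) (replIn_fst' f))),
      Category.assoc, IsIso.hom_inv_id_assoc, coneHom_coneOutK, ← Category.assoc, coneHom_coneOutK,
      CategoryTheory.Functor.map_id, CategoryTheory.Functor.map_id, Category.comp_id]

lemma dist_cone {X Y : Cpx B N} (f : X ⟶ Y) :
    TriangleData.dist ((toK B N).map f) ((toK B N).map (coneIn f)) (coneOutK f) :=
  ⟨X, Y, f, Iso.refl _, Iso.refl _, Iso.refl _, by simp, by simp, by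
    rw [Iso.refl_hom, CategoryTheory.Functor.map_id]
    exact (Category.comp_id _).trans (Category.id_comp _).symm⟩

lemma dist_of_iso {X Y Z X' Y' Z' : K B N} {u : X ⟶ Y} {v : Y ⟶ Z} {w : Z ⟶ (sus B N).obj X}
    {u' : X' ⟶ Y'} {v' : Y' ⟶ Z'} {w' : Z' ⟶ (sus B N).obj X'} (α : X ≅ X') (β : Y ≅ Y')
    (γ : Z ≅ Z') (hu : u ≫ β.hom = α.hom ≫ u') (hv : v ≫ γ.hom = β.hom ≫ v')
    (hw : w ≫ (sus B N).map α.hom = γ.hom ≫ w') (h : TriangleData.dist u' v' w') :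
    TriangleData.dist u v w := by
  obtain ⟨X₀, Y₀, f, α', β', γ', h₁, h₂, h₃⟩ := h
  refine ⟨X₀, Y₀, f, α ≪≫ α', β ≪≫ β', γ ≪≫ γ', ?_, ?_, ?_⟩
  · rw [Iso.trans_hom, Iso.trans_hom, reassoc_of% hu, h₁, Category.assoc]
  · rw [Iso.trans_hom, Iso.trans_hom, reassoc_of% hv, h₂, Category.assoc]
  · rw [Iso.trans_hom, Iso.trans_hom, Functor.map_comp, reassoc_of% hw, h₃, Category.assoc]
    rfl

variable (B N) in
lemma hasZeroObject_K : HasZeroObject (K B N) := by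
  obtain ⟨A, hA⟩ := (inferInstance : HasZeroObject B).zero
  let Z : Cpx B N := ⟨(Functor.const ℤ).obj A, fun _ => hA.eq_of_src _ _⟩
  exact ⟨(toK B N).obj Z, (isZero_toK_iff Z).2
    ⟨fun _ => 0, fun _ => hA.eq_of_src _ _⟩⟩

lemma dist_exists_cone {X Y Z : K B N} {u : X ⟶ Y} {v : Y ⟶ Z} {w : Z ⟶ (sus B N).obj X}
    (h : TriangleData.dist u v w) : ∃ (X' Y' : Cpx B N) (f : X' ⟶ Y') (α : X ≅ (toK B N).obj X')
    (β : Y ≅ (toK B N).obj Y') (γ : Z ≅ (toK B N).obj (cone f)),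
    u ≫ β.hom = α.hom ≫ (toK B N).map f ∧
    v ≫ γ.hom = β.hom ≫ (toK B N).map (coneIn f) ∧
    w ≫ (sus B N).map α.hom = γ.hom ≫ coneOutK f := h

lemma dist_rotate {X Y Z : K B N} {u : X ⟶ Y} {v : Y ⟶ Z} {w : Z ⟶ (sus B N).obj X}
    (h : TriangleData.dist u v w) : TriangleData.dist v w (-(sus B N).map u) := by
  obtain ⟨X', Y', f, α, β, γ, h₁, h₂, h₃⟩ := dist_exists_cone h
  refine dist_of_iso β γ ((sus B N).mapIso α) h₂ h₃ ?_ (termwiseSplit_cone f).dist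
  rw [δ_cone]
  have e := congrArg (sus B N).map h₁
  rw [Functor.map_comp, Functor.map_comp] at e
  rw [Preadditive.neg_comp, e]
  exact (Preadditive.comp_neg _ _).symm

lemma dist_complete {X Y Z X' Y' Z' : K B N} {u : X ⟶ Y} {v : Y ⟶ Z} {w : Z ⟶ (sus B N).obj X}
    {u' : X' ⟶ Y'} {v' : Y' ⟶ Z'} {w' : Z' ⟶ (sus B N).obj X'} (h : TriangleData.dist u v w)
    (h' : TriangleData.dist u' v' w') (a : X ⟶ X') (b : Y ⟶ Y') (hab : u ≫ b = a ≫ u') :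
    ∃ c : Z ⟶ Z', v ≫ c = b ≫ v' ∧ w ≫ (sus B N).map a = c ≫ w' := by
  obtain ⟨X₀, Y₀, f, α, β, γ, h₁, h₂, h₃⟩ := dist_exists_cone h
  obtain ⟨X₁, Y₁, f', α', β', γ', k₁, k₂, k₃⟩ := dist_exists_cone h'
  obtain ⟨c, hc, hc'⟩ := exists_cone_map f f' (α.inv ≫ a ≫ α'.hom) (β.inv ≫ b ≫ β'.hom) (by
    rw [← cancel_epi α.hom, ← reassoc_of% h₁]
    simp [k₁, reassoc_of% hab])
  refine ⟨γ.hom ≫ c ≫ γ'.inv, ?_, ?_⟩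
  · rw [reassoc_of% h₂, reassoc_of% hc, ← reassoc_of% k₂]
    simp
  · rw [← cancel_mono ((sus B N).map α'.hom)]
    simp only [Category.assoc, k₃, Iso.inv_hom_id_assoc, ← hc', ← reassoc_of% h₃]
    simp only [← Functor.map_comp, Iso.hom_inv_id_assoc]

/-- With `g` replaced by the termwise split monomorphism `replIn g`, the sequence `C(f) ⟶ C(f ≫
replIn g) ⟶ C(g)` is termwise split. Its connecting morphism is computed by naturality from that of
`replIn g`. -/
lemma octahedron {X Y Z : Cpx B N} (f : X ⟶ Y) (g : Y ⟶ Z) :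
    ∃ (Z' A D E : K B N) (v' : (toK B N).obj Y ⟶ Z') (e₃ : (toK B N).obj Z ≅ Z')
      (v₁ : (toK B N).obj Y ⟶ A) (w₁ : A ⟶ (sus B N).obj ((toK B N).obj X)) (v₂ : Z' ⟶ D)
      (w₂ : D ⟶ (sus B N).obj ((toK B N).obj Y)) (v₃ : Z' ⟶ E)
      (w₃ : E ⟶ (sus B N).obj ((toK B N).obj X)) (m₁ : A ⟶ E) (m₃ : E ⟶ D),
      (toK B N).map g ≫ e₃.hom = v' ∧ TriangleData.dist ((toK B N).map f) v₁ w₁ ∧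
      TriangleData.dist v' v₂ w₂ ∧ TriangleData.dist ((toK B N).map f ≫ v') v₃ w₃ ∧
      v₁ ≫ m₁ = v' ≫ v₃ ∧ m₁ ≫ w₃ = w₁ ∧ v₃ ≫ m₃ = v₂ ∧
      w₃ ≫ (sus B N).map ((toK B N).map f) = m₃ ≫ w₂ ∧
      TriangleData.dist m₁ m₃ (w₂ ≫ (sus B N).map v₁) := by
  have h := termwiseSplit_repl g
  have hk := termwiseSplit_coneHom f _ rfl h
  have := (termwiseSplit_sum Z (cone (𝟙 Y))).isIso_right (nullHomotopic_id_cone_id Y)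
  refine ⟨_, _, _, _, (toK B N).map (replIn g), (asIso ((toK B N).map (sumFst Z (cone (𝟙 Y))))).symm,
    (toK B N).map (coneIn f), coneOutK f, (toK B N).map (replOut g), h.δ,
    (toK B N).map (coneIn (f ≫ replIn g)), coneOutK (f ≫ replIn g),
    (toK B N).map (coneHom (𝟙 X) (replIn g) (Category.id_comp _).symm),
    (toK B N).map (coneDesc (f ≫ replIn g) (replOut g)
      (by rw [Category.assoc, h.zero, comp_zero])), ?_, dist_cone f, h.dist, ?_, ?_, ?_, ?_, ?_, ?_⟩
  · rw [Iso.symm_hom, asIso_inv, IsIso.comp_inv_eq, ← Functor.map_comp, replIn_fst]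
  · rw [← Functor.map_comp]
    exact dist_cone _
  · rw [← Functor.map_comp, ← Functor.map_comp, coneIn_coneHom]
  · rw [coneHom_coneOutK, CategoryTheory.Functor.map_id, CategoryTheory.Functor.map_id,
      Category.comp_id]
  · rw [← Functor.map_comp, coneIn_coneDesc]
  · rw [← coneHom_coneOutK f (𝟙 _) (Category.comp_id _), ← h.coneDesc_δ, ← Category.assoc,
      ← Functor.map_comp, coneHom_coneDesc _ _ (by rw [Category.assoc, h.zero, comp_zero]) _ _
        h.zero f (𝟙 _) (𝟙 _) (Category.comp_id _) (by simp), Category.comp_id]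
  · have e := h.δ_naturality hk (coneIn f) (coneIn (f ≫ replIn g)) (𝟙 _) (coneIn_coneHom _ _ _).symm
      (by rw [Category.comp_id, coneIn_coneDesc])
    rw [CategoryTheory.Functor.map_id, Category.id_comp] at e
    rw [← e]
    exact hk.dist

lemma triangulationAxioms (hN : 1 ≤ N) : TriangulationAxioms (K B N) where
  zero := hasZeroObject_K B N
  equivalence := sus_isEquivalence hN
  additive := (inferInstance : (sus B N).Additive)
  dist_of_iso := dist_of_iso
  dist_id X Z hZ := by
    have hz := (isZero_toK_iff _).2 (nullHomotopic_id_cone_id X.as)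
    exact dist_of_iso (Iso.refl _) (Iso.refl _) (hZ.iso hz) rfl (hz.eq_of_tgt _ _)
      (hZ.eq_of_src _ _) (dist_cone (𝟙 X.as))
  exists_dist u := by
    obtain ⟨f, rfl⟩ := (toK B N).map_surjective u
    exact ⟨_, _, _, dist_cone f⟩
  rotate := dist_rotate
  complete := dist_complete
  octahedron {X Y Z} u v := by
    obtain ⟨f, rfl⟩ := (toK B N).map_surjective u
    obtain ⟨g, rfl⟩ := (toK B N).map_surjective v
    obtain ⟨Z', A, D, E, v', e₃, v₁, w₁, v₂, w₂, v₃, w₃, m₁, m₃, h₁, h₂, h₃, h₄, h₅, h₆, h₇, h₈,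
      h₉⟩ := octahedron (X := X.as) (Y := Y.as) (Z := Z.as) f g
    exact ⟨X, Y, Z', A, D, E, _, v', Iso.refl _, Iso.refl _, e₃, v₁, w₁, v₂, w₂, v₃, w₃, m₁, m₃,
      (Category.comp_id _).trans (Category.id_comp _).symm, h₁.trans (Category.id_comp _).symm,
      h₂, h₃, h₄, h₅, h₆, h₇, h₈, h₉⟩

end NCpx

end

/-! ### Restriction functors preserve triangles. -/

noncomputable section

namespace NCpx

universe v u

variable {B : Type u} [Category.{v} B] [Preadditive B] {N P : ℕ}

/-! ### Restriction along a monotone map is a triangle functor -/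

section Reindex

variable (φ : ℤ → ℤ) (hφ : Monotone φ) (h : ∀ i, φ (i + P) = φ i + N)

instance : (reindex φ hφ h : K B N ⥤ K B P).Additive := liftK_additive _ _ _

lemma TermwiseSplit.reindex {X Y Z : Cpx B N} {i : X ⟶ Y} {p : Y ⟶ Z} (H : TermwiseSplit i p) :
    TermwiseSplit ((reindexC φ hφ h).map i) ((reindexC φ hφ h).map p) := fun n => H (φ n)

lemma NullHomotopic.reindex_id {X : Cpx B N} (H : NullHomotopic (𝟙 X)) :
    NullHomotopic (𝟙 ((reindexC φ hφ h).obj X)) := H.reindex hφ h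

variable [HasFiniteBiproducts B]

attribute [local instance] hasBinaryBiproducts_of_finite_biproducts

/-- The comparison of the suspensions, in terms of the connecting morphism of `X ⟶ C(1_X) ⟶ ΣX`. -/
def reindexSus (X : Cpx B N) : (toK B P).obj ((reindexC φ hφ h).obj ((susC B N).obj X)) ⟶
    (sus B P).obj ((toK B P).obj ((reindexC φ hφ h).obj X)) :=
  -- By `δ_cone_id` the connecting morphism before restriction is `-1`; the sign compensates for
  -- this.
  -((termwiseSplit_cone (𝟙 X)).reindex φ hφ h).δ

lemma isIso_neg {C : Type*} [Category* C] [Preadditive C] {X Y : C} (f : X ⟶ Y) (hf : IsIso f) :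
    IsIso (-f) := ⟨-inv f, by simp, by simp⟩

instance isIso_reindexSus (X : Cpx B N) : IsIso (reindexSus φ hφ h X) :=
  isIso_neg _ (((termwiseSplit_cone (𝟙 X)).reindex φ hφ h).isIso_δ
    ((nullHomotopic_id_cone_id X).reindex_id φ hφ h))

lemma reindexSus_naturality {X Y : Cpx B N} (f : X ⟶ Y) :
    (toK B P).map ((reindexC φ hφ h).map ((susC B N).map f)) ≫ reindexSus φ hφ h Y =
      reindexSus φ hφ h X ≫ (sus B P).map ((toK B P).map ((reindexC φ hφ h).map f)) := by
  unfold reindexSus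
  rw [Preadditive.comp_neg, Preadditive.neg_comp,
    ((termwiseSplit_cone (𝟙 X)).reindex φ hφ h).δ_naturality
      ((termwiseSplit_cone (𝟙 Y)).reindex φ hφ h) ((reindexC φ hφ h).map f)
      ((reindexC φ hφ h).map (coneHom f f (by simp)))]
  · rw [← Functor.map_comp, ← Functor.map_comp, coneIn_coneHom]
  · rw [← Functor.map_comp, ← Functor.map_comp, coneHom_coneOut]

lemma δ_reindex_cone {X Y : Cpx B N} (f : X ⟶ Y) :
    ((termwiseSplit_cone f).reindex φ hφ h).δ =
      -(reindexSus φ hφ h X ≫ (sus B P).map ((toK B P).map ((reindexC φ hφ h).map f))) := by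
  have e := ((termwiseSplit_cone (𝟙 X)).reindex φ hφ h).δ_naturality
    ((termwiseSplit_cone f).reindex φ hφ h) ((reindexC φ hφ h).map f)
    ((reindexC φ hφ h).map (coneHom (𝟙 X) f rfl)) (𝟙 _)
    (by rw [← Functor.map_comp, ← Functor.map_comp, coneIn_coneHom])
    (by
      rw [← Functor.map_comp, coneHom_coneOut, CategoryTheory.Functor.map_id, Category.comp_id,
        Category.comp_id])
  rw [CategoryTheory.Functor.map_id, Category.id_comp] at e
  rw [e, reindexSus, Preadditive.neg_comp, neg_neg]

/-- Restriction turns `Y ⟶ C(f) ⟶ ΣX` into a termwise split sequence, whose triangle is the rotation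
of the desired one by `δ_reindex_cone`. The rotation is then undone, which needs the triangulation
of the target. -/
lemma dist_reindex_cone (hP : 1 ≤ P) {X Y : Cpx B N} (f : X ⟶ Y) :
    TriangleData.dist ((toK B P).map ((reindexC φ hφ h).map f))
      ((toK B P).map ((reindexC φ hφ h).map (coneIn f)))
      ((toK B P).map ((reindexC φ hφ h).map (coneOut f)) ≫ reindexSus φ hφ h X) := by
  refine (triangulationAxioms hP).rotate_inv (dist_of_iso (Iso.refl _) (Iso.refl _)
    (asIso (reindexSus φ hφ h X)).symm ?_ ?_ ?_ ((termwiseSplit_cone f).reindex φ hφ h).dist)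
  · simp
  · simp
  · rw [δ_reindex_cone, Iso.refl_hom, CategoryTheory.Functor.map_id, Iso.symm_hom, asIso_inv,
      Preadditive.comp_neg, IsIso.inv_hom_id_assoc]
    exact Category.comp_id _

/-- The commutation with the suspension of the restriction functor. -/
def reindexSusIso : sus B N ⋙ reindex φ hφ h ≅ reindex φ hφ h ⋙ sus B P :=
  NatIso.ofComponents (fun X => @asIso _ _ _ _ (reindexSus φ hφ h X.as)
    (isIso_reindexSus φ hφ h X.as)) fun {X Y} f => by
    obtain ⟨f, rfl⟩ := (toK B N).map_surjective f
    exact reindexSus_naturality φ hφ h f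

theorem isTriangleFunctor_reindex (hP : 1 ≤ P) :
    IsTriangleFunctor (reindex φ hφ h : K B N ⥤ K B P) := by
  refine ⟨inferInstance, reindexSusIso φ hφ h, fun {X Y Z} u v w H => ?_⟩
  obtain ⟨X', Y', f, α, β, γ, h₁, h₂, h₃⟩ := dist_exists_cone H
  refine dist_of_iso ((reindex φ hφ h).mapIso α) ((reindex φ hφ h).mapIso β)
    ((reindex φ hφ h).mapIso γ) ?_ ?_ ?_ (dist_reindex_cone φ hφ h hP f)
  · have := congrArg (reindex φ hφ h).map h₁
    rwa [Functor.map_comp, Functor.map_comp] at this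
  · have := congrArg (reindex φ hφ h).map h₂
    rwa [Functor.map_comp, Functor.map_comp] at this
  · have e := congrArg (reindex φ hφ h).map h₃
    rw [Functor.map_comp, Functor.map_comp] at e
    have e' := (reindexSusIso φ hφ h).hom.naturality α.hom
    calc ((reindex φ hφ h).map w ≫ (reindexSusIso φ hφ h).hom.app X) ≫
        (sus B P).map ((reindex φ hφ h).map α.hom)
      _ = (reindex φ hφ h).map w ≫ (reindexSusIso φ hφ h).hom.app X ≫
        (reindex φ hφ h ⋙ sus B P).map α.hom := Category.assoc _ _ _
      _ = (reindex φ hφ h).map w ≫ (sus B N ⋙ reindex φ hφ h).map α.hom ≫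
        (reindexSusIso φ hφ h).hom.app _ := by rw [e']
      _ = ((reindex φ hφ h).map w ≫ (reindex φ hφ h).map ((sus B N).map α.hom)) ≫
        (reindexSusIso φ hφ h).hom.app _ := (Category.assoc _ _ _).symm
      _ = _ := by
        rw [e]
        exact Category.assoc _ _ _

end Reindex

end NCpx

end

/-! ### Combinatorics of the index functions. -/

noncomputable section

namespace NCpx

universe v u

/-! ### The index functions of iterated prolongations and contractions -/

/-- The index function of the iterated prolongation. -/
def prolongFun (s : ℤ) (M : ℕ) : ℕ → ℤ → ℤ
  | 0 => id
  | k + 1 => prolongFun s M k ∘ iotaFun s (M + k)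

/-- The index function of the iterated contraction. -/
def contractFun (s : ℤ) (M : ℕ) : ℕ → ℤ → ℤ
  | 0 => id
  | k + 1 => rhoFun s (M + k) ∘ contractFun s M k

lemma prolongFun_monotone (s : ℤ) (M k : ℕ) : Monotone (prolongFun s M k) := by
  induction k with
  | zero => exact monotone_id
  | succ k ih => exact ih.comp (iotaFun_monotone _ _)

lemma contractFun_monotone (s : ℤ) {M : ℕ} (hM : 0 < M) (k : ℕ) :
    Monotone (contractFun s M k) := by
  induction k with
  | zero => exact monotone_id
  | succ k ih => exact (rhoFun_monotone s (M + k) (by omega)).comp ih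

lemma prolongFun_add (s : ℤ) (M k : ℕ) (n : ℤ) :
    prolongFun s M k (n + (M + k : ℕ)) = prolongFun s M k n + M := by
  induction k generalizing n with
  | zero => rfl
  | succ k ih =>
    have := iotaFun_add s (M + k) n
    simp only [prolongFun, Function.comp_apply]
    rw [← add_assoc M k 1, this, ih]

lemma contractFun_add (s : ℤ) {M : ℕ} (hM : 0 < M) (k : ℕ) (n : ℤ) :
    contractFun s M k (n + M) = contractFun s M k n + (M + k : ℕ) := by
  induction k with
  | zero => rfl
  | succ k ih =>
    simp only [contractFun, Function.comp_apply]
    rw [ih, rhoFun_add s (M + k) (by omega), add_assoc M k 1]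

lemma iotaFun_of_mem {s n : ℤ} {M : ℕ} (h : s ≤ n) (h' : n < s + M + 1) :
    iotaFun s M n = max (n - 1) s := by
  unfold iotaFun
  rw [Int.emod_eq_of_lt (by omega) (by omega), Int.ediv_eq_zero_of_lt (by omega) (by omega)]
  split_ifs <;> omega

lemma rhoFun_of_mem {s n : ℤ} {M : ℕ} (h : s ≤ n) (h' : n < s + M) :
    rhoFun s M n = if n = s then s else n + 1 := by
  unfold rhoFun
  rw [Int.emod_eq_of_lt (by omega) (by omega), Int.ediv_eq_zero_of_lt (by omega) (by omega)]
  split_ifs <;> omega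

/-- On this period each step collapses one more index onto `s`: in the end `s, …, s + k` all go to
`s`. -/
lemma prolongFun_of_mem {s n : ℤ} {M k : ℕ} (hM : 0 < M) (h : s ≤ n) (h' : n < s + M + k) :
    prolongFun s M k n = max (n - k) s := by
  induction k generalizing n with
  | zero => simp [prolongFun, h]
  | succ k ih =>
    simp only [prolongFun, Function.comp_apply]
    rw [iotaFun_of_mem h (by push_cast at h' ⊢; omega), ih (by omega) (by push_cast at h'; omega)]
    push_cast
    omega

/-- The values skipped on this period are `s + 1, …, s + k`. -/
lemma contractFun_of_mem {s n : ℤ} {M k : ℕ} (h : s ≤ n) (h' : n < s + M) :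
    contractFun s M k n = if n = s then s else n + k := by
  induction k with
  | zero => simp only [contractFun, id]; split_ifs <;> simp [*]
  | succ k ih =>
    simp only [contractFun, Function.comp_apply]
    rw [ih, rhoFun_of_mem (by split_ifs <;> omega) (by split_ifs <;> push_cast <;> omega)]
    push_cast
    split_ifs <;> omega

lemma forall_of_window {p : ℤ → Prop} {P : ℕ} (hP : 0 < P) (hp : ∀ n, p (n + P) ↔ p n) (c : ℤ)
    (h : ∀ n, c ≤ n → n < c + P → p n) (n : ℤ) : p n := by
  have key : ∀ q n : ℤ, p (n + q * P) ↔ p n := fun q => by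
    induction q using Int.induction_on with
    | zero => simp
    | succ q ih => intro n; rw [add_mul, one_mul, ← add_assoc, hp, ih]
    | pred q ih => intro n; rw [← hp, ← ih n]; ring_nf
  have h₁ := Int.emod_nonneg (n - c) (show (P : ℤ) ≠ 0 by omega)
  have h₂ := Int.emod_lt_of_pos (n - c) (show (0 : ℤ) < P by omega)
  have h₃ := Int.emod_add_mul_ediv (n - c) P
  rw [show n = c + (n - c) % P + (n - c) / P * P by linarith, key]
  exact h _ (by omega) (by omega)

section Relations

variable {M : ℕ} (hM : 0 < M) (s : ℤ) (k : ℕ)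

include hM

lemma prolongFun_contractFun : ∀ n : ℤ, prolongFun s M k (contractFun s M k n) = n := by
  refine forall_of_window hM (fun n => ?_) s (fun n h h' => ?_)
  · rw [contractFun_add s hM, prolongFun_add]; omega
  · rw [contractFun_of_mem h h', prolongFun_of_mem hM (by split_ifs <;> omega)
      (by split_ifs <;> omega)]
    split_ifs <;> omega

lemma contractFun_prolongFun_of_mem {n : ℤ} (h : s ≤ n) (h' : n < s + M + k) :
    contractFun s M k (prolongFun s M k n) = if n ≤ s + k then s else n := by
  rw [prolongFun_of_mem hM h h', contractFun_of_mem (by omega) (by omega)]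
  split_ifs <;> omega

lemma contractFun_prolongFun_le : ∀ n : ℤ, contractFun s M k (prolongFun s M k n) ≤ n := by
  refine forall_of_window (P := M + k) (by omega) (fun n => ?_) s (fun n h h' => ?_)
  · rw [prolongFun_add, contractFun_add s hM]; omega
  · rw [contractFun_prolongFun_of_mem hM _ _ h (by omega)]
    split_ifs <;> omega

variable {s} {t : ℤ} (ht : t + 1 = s)

include ht

/-- With base point one lower the skipped values are `s, …, s + k - 1`, so on the period from `s`
the function is a plain translation. The last index is congruent to the base point `t` and is
treated separately. -/
lemma contractFun_pred_of_mem {n : ℤ} (h : s ≤ n) (h' : n < s + M) :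
    contractFun t M k n = n + k := by
  by_cases hn : n = t + M
  · subst hn
    rw [contractFun_add _ hM, contractFun_of_mem le_rfl (by omega), if_pos rfl]
    push_cast; ring
  · rw [contractFun_of_mem (by omega) (by omega), if_neg (by omega)]

lemma prolongFun_contractFun_pred : ∀ n : ℤ, prolongFun s M k (contractFun t M k n) = n := by
  refine forall_of_window hM (fun n => ?_) s (fun n h h' => ?_)
  · rw [contractFun_add _ hM, prolongFun_add]; omega
  · rw [contractFun_pred_of_mem hM _ ht h h', prolongFun_of_mem hM (by omega) (by omega)]
    omega

lemma contractFun_pred_prolongFun_of_mem {n : ℤ} (h : s ≤ n) (h' : n < s + M + k) :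
    contractFun t M k (prolongFun s M k n) = max n (s + k) := by
  rw [prolongFun_of_mem hM h (by omega), contractFun_pred_of_mem hM _ ht (by omega) (by omega)]
  omega

lemma le_contractFun_pred_prolongFun : ∀ n : ℤ, n ≤ contractFun t M k (prolongFun s M k n) := by
  refine forall_of_window (P := M + k) (by omega) (fun n => ?_) s (fun n h h' => ?_)
  · rw [prolongFun_add, contractFun_add _ hM]; omega
  · rw [contractFun_pred_prolongFun_of_mem hM _ ht h (by omega)]
    omega

end Relations

/-! ### Iterated prolongations and contractions as restrictions -/

variable {B : Type u} [Category.{v} B] [Preadditive B] {N P : ℕ}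

lemma prolongFun_add' (s : ℤ) {M k : ℕ} (h : M + k = N) (n : ℤ) :
    prolongFun s M k (n + N) = prolongFun s M k n + M := by
  subst h; exact prolongFun_add s M k n

lemma contractFun_add' (s : ℤ) {M k : ℕ} (hM : 0 < M) (h : M + k = N) (n : ℤ) :
    contractFun s M k (n + M) = contractFun s M k n + N := by
  subst h; exact contractFun_add s hM k n

lemma prolong_eq (s : ℤ) {M k : ℕ} (h : M + k = N) :
    prolong B s k M N h = reindex (prolongFun s M k) (prolongFun_monotone s M k)
      (prolongFun_add' s h) := by
  subst h
  induction k with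
  | zero => exact (reindex_eq_id _ _ _ fun _ => rfl).symm
  | succ k ih =>
    change prolong B s k M (M + k) rfl ⋙ I B s (M + k) = _
    rw [ih]
    exact reindex_comp _ _ _ _ _ _

lemma contract_eq (s : ℤ) {M k : ℕ} (hM : 0 < M) (h : M + k = N) :
    contract B s k M N hM h = reindex (contractFun s M k) (contractFun_monotone s hM k)
      (contractFun_add' s hM h) := by
  subst h
  induction k with
  | zero => exact (reindex_eq_id _ _ _ fun _ => rfl).symm
  | succ k ih =>
    change J B s (M + k) _ ⋙ contract B s k M (M + k) hM rfl = _
    rw [ih]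
    exact reindex_comp _ _ _ _ _ _

end NCpx

end

/-! ### Adjunctions, contractibility and exact sequences from relations between index functions. -/

noncomputable section

namespace NCpx

universe v u

variable {B : Type u} [Category.{v} B] [Preadditive B] {N P : ℕ}

/-! ### Adjunctions between restriction functors -/

/-- The morphism `X ∘ φ ⟶ X ∘ φ'` for `φ ≤ φ'`. -/
def reindexLe (φ φ' : ℤ → ℤ) (hφ : Monotone φ) (hφ' : Monotone φ') (h : ∀ i, φ (i + P) = φ i + N)
    (h' : ∀ i, φ' (i + P) = φ' i + N) (hle : ∀ n, φ n ≤ φ' n) (X : Cpx B N) :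
    (reindexC φ hφ h).obj X ⟶ (reindexC φ' hφ' h').obj X :=
  mkHom (fun n => dd X.obj (φ n) (φ' n)) fun a b hab => by
    have e : dd X.obj (φ a) (φ b) ≫ dd X.obj (φ b) (φ' b) =
        dd X.obj (φ a) (φ' a) ≫ dd X.obj (φ' a) (φ' b) := by
      rw [dd_comp X.obj (hφ hab) (hle b), dd_comp X.obj (hle a) (hφ' hab)]
    rw [dd_reindexC hφ h X hab, dd_reindexC hφ' h' X hab]
    exact e

/-- The morphism `X ⟶ X ∘ φ` for `id ≤ φ`. -/
def toReindexC (φ : ℤ → ℤ) (hφ : Monotone φ) (h : ∀ i, φ (i + N) = φ i + N) (hle : ∀ n, n ≤ φ n)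
    (X : Cpx B N) : X ⟶ (reindexC φ hφ h).obj X :=
  reindexLe id φ monotone_id hφ (fun _ => rfl) h hle X

/-- The morphism `X ∘ φ ⟶ X` for `φ ≤ id`. -/
def fromReindexC (φ : ℤ → ℤ) (hφ : Monotone φ) (h : ∀ i, φ (i + N) = φ i + N) (hle : ∀ n, φ n ≤ n)
    (X : Cpx B N) : (reindexC φ hφ h).obj X ⟶ X :=
  reindexLe φ id hφ monotone_id h (fun _ => rfl) hle X

lemma toReindexC_naturality (φ : ℤ → ℤ) (hφ : Monotone φ) (h : ∀ i, φ (i + N) = φ i + N)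
    (hle : ∀ n, n ≤ φ n) {X Y : Cpx B N} (f : X ⟶ Y) :
    f ≫ toReindexC φ hφ h hle Y = toReindexC φ hφ h hle X ≫ (reindexC φ hφ h).map f :=
  hom_ext_app fun n => app_dd f n (φ n)

lemma fromReindexC_naturality (φ : ℤ → ℤ) (hφ : Monotone φ) (h : ∀ i, φ (i + N) = φ i + N)
    (hle : ∀ n, φ n ≤ n) {X Y : Cpx B N} (f : X ⟶ Y) :
    (reindexC φ hφ h).map f ≫ fromReindexC φ hφ h hle Y = fromReindexC φ hφ h hle X ≫ f :=
  hom_ext_app fun n => app_dd f (φ n) n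

section Adjunction

variable (l r : ℤ → ℤ) (hl : Monotone l) (hr : Monotone r) (hl' : ∀ i, l (i + P) = l i + N)
  (hr' : ∀ i, r (i + N) = r i + P)

/-- Unit and counit are transition maps of one and the same complex, so their composite is the
transition map from `r n` to itself. The other triangle identity is similar. -/
lemma toReindexC_fromReindexC (h : ∀ i, (r ∘ l) (i + P) = (r ∘ l) i + P)
    (h' : ∀ i, (l ∘ r) (i + N) = (l ∘ r) i + N) (hlr : ∀ n, n ≤ (r ∘ l) n)
    (hrl : ∀ n, (l ∘ r) n ≤ n) (X : Cpx B P) :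
    (reindexC r hr hr').map (toReindexC (r ∘ l) (hr.comp hl) h hlr X) ≫
      fromReindexC (l ∘ r) (hl.comp hr) h' hrl ((reindexC r hr hr').obj X) = 𝟙 _ :=
  hom_ext_app fun n => by
    have e : dd X.obj (r n) (r (l (r n))) ≫ dd X.obj (r (l (r n))) (r n) = 𝟙 _ := by
      rw [dd_comp X.obj (show r n ≤ r (l (r n)) from hlr _) (hr (hrl n)), dd_self]
    have e' : dd ((reindexC r hr hr').obj X).obj (l (r n)) n = dd X.obj (r (l (r n))) (r n) :=
      dd_reindexC hr hr' X (hrl n)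
    exact (congrArg (fun t => dd X.obj (r n) (r (l (r n))) ≫ t) e').trans e

lemma toReindexC_fromReindexC' (h : ∀ i, (r ∘ l) (i + P) = (r ∘ l) i + P)
    (h' : ∀ i, (l ∘ r) (i + N) = (l ∘ r) i + N) (hlr : ∀ n, n ≤ (r ∘ l) n)
    (hrl : ∀ n, (l ∘ r) n ≤ n) (X : Cpx B N) :
    toReindexC (r ∘ l) (hr.comp hl) h hlr ((reindexC l hl hl').obj X) ≫
      (reindexC l hl hl').map (fromReindexC (l ∘ r) (hl.comp hr) h' hrl X) = 𝟙 _ :=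
  hom_ext_app fun n => by
    have e : dd X.obj (l n) (l (r (l n))) ≫ dd X.obj (l (r (l n))) (l n) = 𝟙 _ := by
      rw [dd_comp X.obj (show l n ≤ l (r (l n)) from hl (hlr n)) (show l (r (l n)) ≤ l n from hrl _), dd_self]
    have e' : dd ((reindexC l hl hl').obj X).obj n (r (l n)) = dd X.obj (l n) (l (r (l n))) :=
      dd_reindexC hl hl' X (hlr n)
    exact (congrArg (fun t => t ≫ dd X.obj (l (r (l n))) (l n)) e').trans e

/-- A Galois connection between index functions induces an adjunction. -/
def reindexAdjunction (hlr : ∀ n, n ≤ r (l n)) (hrl : ∀ n, l (r n) ≤ n) :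
    (reindex r hr hr' : K B P ⥤ K B N) ⊣ reindex l hl hl' :=
  have h : ∀ i, (r ∘ l) (i + P) = (r ∘ l) i + P := fun i => by simp [hl', hr']
  have h' : ∀ i, (l ∘ r) (i + N) = (l ∘ r) i + N := fun i => by simp [hl', hr']
  Adjunction.mkOfUnitCounit
    { unit :=
        { app := fun X => (toK B P).map (toReindexC (r ∘ l) (hr.comp hl) h hlr X.as)
          naturality := fun X Y f => by
            obtain ⟨f, rfl⟩ := (toK B P).map_surjective f
            exact congrArg (toK B P).map
              (toReindexC_naturality (X := X.as) (Y := Y.as) _ (hr.comp hl) h hlr f) }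
      counit :=
        { app := fun X => (toK B N).map (fromReindexC (l ∘ r) (hl.comp hr) h' hrl X.as)
          naturality := fun X Y f => by
            obtain ⟨f, rfl⟩ := (toK B N).map_surjective f
            exact congrArg (toK B N).map
              (fromReindexC_naturality (X := X.as) (Y := Y.as) _ (hl.comp hr) h' hrl f) }
      left_triangle := by
        ext X
        refine (congrArg (fun t => _ ≫ t) (Category.id_comp _)).trans ?_
        exact congrArg (toK B N).map (toReindexC_fromReindexC l r hl hr hr' h h' hlr hrl X.as)
      right_triangle := by
        ext X
        refine (congrArg (fun t => _ ≫ t) (Category.id_comp _)).trans ?_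
        exact congrArg (toK B P).map (toReindexC_fromReindexC' l r hl hr hl' h h' hlr hrl X.as) }

lemma isIso_reindexLe (φ φ' : ℤ → ℤ) (hφ : Monotone φ) (hφ' : Monotone φ')
    (h : ∀ i, φ (i + P) = φ i + N) (h' : ∀ i, φ' (i + P) = φ' i + N) (hle : ∀ n, φ n ≤ φ' n)
    (hge : ∀ n, φ' n ≤ φ n) (X : Cpx B N) : IsIso (reindexLe φ φ' hφ hφ' h h' hle X) :=
  ⟨reindexLe φ' φ hφ' hφ h' h hge X,
    hom_ext_app fun n => (dd_comp X.obj (hle n) (hge n)).trans (dd_self _ _),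
    hom_ext_app fun n => (dd_comp X.obj (hge n) (hle n)).trans (dd_self _ _)⟩

-- The unit consists of transition maps from `n` to `r (l n) = n`, hence is invertible.
include hl hl' in
lemma reindex_full_faithful (hlr : ∀ n, r (l n) = n) (hrl : ∀ n, l (r n) ≤ n) :
    (reindex r hr hr' : K B P ⥤ K B N).Full ∧ (reindex r hr hr' : K B P ⥤ K B N).Faithful := by
  let adj := reindexAdjunction (B := B) l r hl hr hl' hr' (fun n => (hlr n).ge) hrl
  have (X : K B P) : IsIso (adj.unit.app X) := by
    have := isIso_reindexLe id (r ∘ l) monotone_id (hr.comp hl) (fun _ => rfl)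
      (fun i => by simp [hl', hr']) (fun n => (hlr n).ge) (fun n => (hlr n).le) X.as
    exact Functor.map_isIso (toK B P) (reindexLe id (r ∘ l) monotone_id (hr.comp hl) (fun _ => rfl)
      (fun i => by simp [hl', hr']) (fun n => (hlr n).ge) X.as)
  exact ⟨adj.full_L_of_isSplitEpi_unit_app, adj.faithful_L_of_mono_unit_app⟩

end Adjunction

end NCpx

end

noncomputable section

namespace NCpx

universe v u

variable {B : Type u} [Category.{v} B] [Preadditive B] {N P : ℕ}

/-! ### Contractible restrictions -/

lemma map_add_mul {φ : ℤ → ℤ} (h : ∀ i, φ (i + P) = φ i + N) (n q : ℤ) :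
    φ (n + q * P) = φ n + q * N := by
  induction q using Int.induction_on with
  | zero => simp
  | succ q ih => rw [add_mul, one_mul, ← add_assoc, h, ih]; ring
  | pred q ih =>
    have := h (n + (-(q : ℤ) - 1) * P)
    rw [show n + (-(q : ℤ) - 1) * P + P = n + -(q : ℤ) * P by ring, ih] at this
    linarith

/-- The restriction along a function that is constant on a whole period is contractible. -/
lemma nullHomotopic_id_reindexC (hP : 0 < P) (hN : 0 < N) {φ : ℤ → ℤ} (hφ : Monotone φ)
    (h : ∀ i, φ (i + P) = φ i + N) (c : ℤ) (hc : φ (c + P - 1) = φ c) (X : Cpx B N) :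
    NullHomotopic (𝟙 ((reindexC φ hφ h).obj X)) := by
  -- Here `φ (n - P + 1) ≤ φ n`, so by the convention for `dd` this family is zero unless equality
  -- holds, and then it is an identity. Equality occurs for exactly one `n` in the window, namely
  -- the `n₀` congruent to the end of the constant stretch.
  refine ⟨fun n => dd X.obj (φ n) (φ (n - P + 1)), fun i => ?_⟩
  set n₀ := i + (c + P - 1 - i) % P with hn₀
  have h₁ := Int.emod_nonneg (c + P - 1 - i) (show (P : ℤ) ≠ 0 by omega)
  have h₂ := Int.emod_lt_of_pos (c + P - 1 - i) (show (0 : ℤ) < P by omega)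
  have h₃ := Int.emod_add_mul_ediv (c + P - 1 - i) P
  have key : φ (n₀ - P + 1) = φ n₀ := by
    have e₁ := map_add_mul h (c + P - 1) (-((c + P - 1 - i) / P))
    have e₂ := map_add_mul h c (-((c + P - 1 - i) / P))
    rw [show c + P - 1 + -((c + P - 1 - i) / P) * P = n₀ by rw [hn₀]; linarith] at e₁
    rw [show c + -((c + P - 1 - i) / P) * P = n₀ - P + 1 by rw [hn₀]; linarith] at e₂
    rw [e₁, e₂, hc]
  -- For other `n` the constant stretch forces `φ (n + 1) ≤ φ n`, and `φ (n - P + 1)` is smaller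
  -- than `φ (n + 1)` by `N > 0`.
  have ne : ∀ n, i ≤ n → n < i + P → n ≠ n₀ → φ (n - P + 1) < φ n := fun n hn hn' hne => by
    have e := h (n - P + 1)
    have e' := h (n₀ - P + 1)
    rw [show n - P + 1 + P = n + 1 by ring] at e
    rw [show n₀ - P + 1 + P = n₀ + 1 by ring] at e'
    rcases lt_or_gt_of_ne hne with hlt | hlt
    · have a₁ : φ (n + 1) ≤ φ n₀ := hφ (by omega)
      have a₂ : φ (n₀ - P + 1) ≤ φ n := hφ (by omega)
      omega
    · have a₁ : φ (n₀ + 1) ≤ φ n := hφ (by omega)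
      have a₂ : φ (n - P + 1) ≤ φ n₀ := hφ (by omega)
      omega
  have mem : n₀ ∈ Finset.Ico i (i + (P : ℤ)) := Finset.mem_Ico.2 ⟨by omega, by omega⟩
  rw [Finset.sum_eq_single_of_mem n₀ mem]
  · have a₁ : φ i ≤ φ n₀ := hφ (by omega)
    have a₂ : φ (n₀ - P + 1) ≤ φ i := hφ (by omega)
    rw [dd_reindexC hφ h X (show i ≤ n₀ by omega), dd_reindexC hφ h X (show n₀ - P + 1 ≤ i by omega)]
    have e : dd X.obj (φ i) (φ n₀) ≫ dd X.obj (φ n₀) (φ (n₀ - P + 1)) ≫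
        dd X.obj (φ (n₀ - P + 1)) (φ i) = 𝟙 _ := by
      rw [dd_comp X.obj key.ge a₂, dd_comp X.obj a₁ (key ▸ a₂), dd_self]
    exact e.symm
  · intro n hn hne
    rw [Finset.mem_Ico] at hn
    rw [dd_reindexC hφ h X hn.1, dd_reindexC hφ h X (show n - P + 1 ≤ i by omega)]
    have e : dd X.obj (φ i) (φ n) ≫ dd X.obj (φ n) (φ (n - P + 1)) ≫
        dd X.obj (φ (n - P + 1)) (φ i) = 0 := by
      rw [dd_of_lt X.obj (ne n hn.1 hn.2 hne), zero_comp, comp_zero]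
    exact e

lemma isZero_reindex_reindex_obj {Q : ℕ} (hQ : 0 < Q) (hN : 0 < N) {φ ψ : ℤ → ℤ} (hφ : Monotone φ)
    (hψ : Monotone ψ) (h : ∀ i, φ (i + P) = φ i + N) (h' : ∀ i, ψ (i + Q) = ψ i + P) (c : ℤ)
    (hc : φ (ψ (c + Q - 1)) = φ (ψ c)) (X : K B N) :
    IsZero ((reindex ψ hψ h' : K B P ⥤ K B Q).obj ((reindex φ hφ h).obj X)) :=
  (isZero_toK_iff ((reindexC ψ hψ h').obj ((reindexC φ hφ h).obj X.as))).2
    (nullHomotopic_id_reindexC hQ hN (hφ.comp hψ) (fun i => by simp [h, h']) c hc X.as)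

/-! ### The exact sequence of a pair of restrictions -/

variable [HasFiniteBiproducts B]

attribute [local instance] hasBinaryBiproducts_of_finite_biproducts

/-- The hypotheses are the matrix entries of the splitting identities for `A ⟶ X ⊞ E ⟶ D`. -/
lemma exists_split_biprod {A X E D : B} {a : A ⟶ X} {b : A ⟶ E} {c : X ⟶ D} {d : E ⟶ D}
    {r₁ : X ⟶ A} {r₂ : E ⟶ A} {s₁ : D ⟶ X} {s₂ : D ⟶ E} (h₀ : a ≫ c = b ≫ d)
    (h₁ : a ≫ r₁ + b ≫ r₂ = 𝟙 _) (h₂ : s₁ ≫ c - s₂ ≫ d = 𝟙 _) (h₃ : r₁ ≫ a + c ≫ s₁ = 𝟙 _)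
    (h₄ : r₁ ≫ b + c ≫ s₂ = 0) (h₅ : r₂ ≫ a - d ≫ s₁ = 0) (h₆ : r₂ ≫ b - d ≫ s₂ = 𝟙 _) :
    ∃ (r : X ⊞ E ⟶ A) (σ : D ⟶ X ⊞ E), (a ≫ biprod.inl + b ≫ biprod.inr) ≫ r = 𝟙 _ ∧
      σ ≫ (biprod.fst ≫ c - biprod.snd ≫ d) = 𝟙 _ ∧
      (a ≫ biprod.inl + b ≫ biprod.inr) ≫ (biprod.fst ≫ c - biprod.snd ≫ d) = 0 ∧
      r ≫ (a ≫ biprod.inl + b ≫ biprod.inr) + (biprod.fst ≫ c - biprod.snd ≫ d) ≫ σ = 𝟙 _ := by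
  refine ⟨biprod.desc r₁ r₂, biprod.lift s₁ s₂, by simpa using h₁, ?_, by simp [h₀], ?_⟩
  · simpa using h₂
  · apply biprod.hom_ext <;> apply biprod.hom_ext' <;>
      simpa [← sub_eq_add_neg]

section Sequence

variable {α β ε : ℤ → ℤ} (hα : Monotone α) (hβ : Monotone β) (hε : Monotone ε)
  (hα' : ∀ i, α (i + N) = α i + N) (hβ' : ∀ i, β (i + N) = β i + N)
  (hε' : ∀ i, ε (i + N) = ε i + N)

/-- In each degree the square of transition maps has two opposite sides between equal indices. They
are invertible, and the reverse `dd` supplies the retraction and the section. -/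
lemma termwiseSplit_reindexC (hαn : ∀ n, α n ≤ n) (hnβ : ∀ n, n ≤ β n) (hαε : ∀ n, α n ≤ ε n)
    (hεβ : ∀ n, ε n ≤ β n) (H : ∀ n, (α n = n ∧ β n = ε n) ∨ (β n = n ∧ α n = ε n))
    (X : Cpx B N) :
    TermwiseSplit
      (fromReindexC α hα hα' hαn X ≫ sumInl X ((reindexC ε hε hε').obj X) +
        reindexLe α ε hα hε hα' hε' hαε X ≫ sumInr X ((reindexC ε hε hε').obj X))
      (sumFst X ((reindexC ε hε hε').obj X) ≫ toReindexC β hβ hβ' hnβ X -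
        sumSnd X ((reindexC ε hε hε').obj X) ≫ reindexLe ε β hε hβ hε' hβ' hεβ X) := fun n => by
  have key : ∃ (r₁ : X.obj.obj n ⟶ X.obj.obj (α n)) (r₂ : X.obj.obj (ε n) ⟶ X.obj.obj (α n))
      (s₁ : X.obj.obj (β n) ⟶ X.obj.obj n) (s₂ : X.obj.obj (β n) ⟶ X.obj.obj (ε n)),
      dd X.obj (α n) n ≫ r₁ + dd X.obj (α n) (ε n) ≫ r₂ = 𝟙 _ ∧
      s₁ ≫ dd X.obj n (β n) - s₂ ≫ dd X.obj (ε n) (β n) = 𝟙 _ ∧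
      r₁ ≫ dd X.obj (α n) n + dd X.obj n (β n) ≫ s₁ = 𝟙 _ ∧
      r₁ ≫ dd X.obj (α n) (ε n) + dd X.obj n (β n) ≫ s₂ = 0 ∧
      r₂ ≫ dd X.obj (α n) n - dd X.obj (ε n) (β n) ≫ s₁ = 0 ∧
      r₂ ≫ dd X.obj (α n) (ε n) - dd X.obj (ε n) (β n) ≫ s₂ = 𝟙 _ := by
    have a₁ := hαn n
    have a₂ := hnβ n
    have a₃ := hαε n
    have a₄ := hεβ n
    rcases H n with ⟨b₁, b₂⟩ | ⟨b₁, b₂⟩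
    · refine ⟨dd X.obj n (α n), 0, 0, -dd X.obj (β n) (ε n), ?_, ?_, ?_, ?_, ?_, ?_⟩ <;>
        simp only [zero_comp, comp_zero, Preadditive.comp_neg, Preadditive.neg_comp, add_zero,
          zero_add, sub_zero, sub_neg_eq_add]
      · rw [dd_comp X.obj a₁ b₁.ge, dd_self]
      · rw [dd_comp X.obj b₂.le a₄, dd_self]
      · rw [dd_comp X.obj b₁.ge a₁, dd_self]
      · rw [dd_comp X.obj b₁.ge a₃, dd_comp X.obj a₂ b₂.le, add_neg_cancel]
      · rw [dd_comp X.obj a₄ b₂.le, dd_self]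
    · refine ⟨0, dd X.obj (ε n) (α n), dd X.obj (β n) n, 0, ?_, ?_, ?_, ?_, ?_, ?_⟩ <;>
        try simp only [zero_comp, comp_zero, add_zero, zero_add, sub_zero]
      · rw [dd_comp X.obj a₃ b₂.ge, dd_self]
      · rw [dd_comp X.obj b₁.le a₂, dd_self]
      · rw [dd_comp X.obj a₂ b₁.le, dd_self]
      · rw [dd_comp X.obj b₂.ge a₁, dd_comp X.obj a₄ b₁.le, sub_self]
      · rw [dd_comp X.obj b₂.ge a₃, dd_self]
  obtain ⟨r₁, r₂, s₁, s₂, h₁, h₂, h₃, h₄, h₅, h₆⟩ := key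
  have h₀ : dd X.obj (α n) n ≫ dd X.obj n (β n) = dd X.obj (α n) (ε n) ≫ dd X.obj (ε n) (β n) := by
    rw [dd_comp X.obj (hαn n) (hnβ n), dd_comp X.obj (hαε n) (hεβ n)]
  exact exists_split_biprod h₀ h₁ h₂ h₃ h₄ h₅ h₆

-- Since `X ∘ ε` is contractible, the middle term `X ⊕ X ∘ ε` is isomorphic to `X`; if an outer term
-- is contractible, the middle is isomorphic to the other outer term.
include hα hβ hε hα' hβ' hε' in
lemma isIso_of_isZero_reindex (hN : 0 < N) (hαn : ∀ n, α n ≤ n) (hnβ : ∀ n, n ≤ β n)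
    (H : ∀ n, (α n = n ∧ β n = ε n) ∨ (β n = n ∧ α n = ε n)) (c : ℤ)
    (hc : ε (c + N - 1) = ε c) (X : K B N) :
    (IsZero ((reindex β hβ hβ' : K B N ⥤ K B N).obj X) →
      Nonempty ((reindex α hα hα' : K B N ⥤ K B N).obj X ≅ X)) ∧
    (IsZero ((reindex α hα hα' : K B N ⥤ K B N).obj X) →
      Nonempty ((reindex β hβ hβ' : K B N ⥤ K B N).obj X ≅ X)) := by
  have hαε : ∀ n, α n ≤ ε n := fun n => by
    have := hαn n
    have := hnβ n
    have := H n
    omega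
  have hεβ : ∀ n, ε n ≤ β n := fun n => by
    have := hαn n
    have := hnβ n
    have := H n
    omega
  have S := termwiseSplit_reindexC hα hβ hε hα' hβ' hε' hαn hnβ hαε hεβ H X.as
  have h₁ := (termwiseSplit_sum X.as ((reindexC ε hε hε').obj X.as)).isIso_right
    (nullHomotopic_id_reindexC hN hN hε hε' c hc X.as)
  refine ⟨fun h => ?_, fun h => ?_⟩
  · have h₂ := S.isIso_left ((isZero_toK_iff _).1 h)
    exact ⟨@asIso _ _ _ _ _ h₂ ≪≫ @asIso _ _ _ _ _ h₁⟩
  · have h₂ := S.isIso_right ((isZero_toK_iff _).1 h)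
    exact ⟨(@asIso _ _ _ _ _ h₂).symm ≪≫ @asIso _ _ _ _ _ h₁⟩

end Sequence

end NCpx

end

/-! ### The relations between the six functors and the recollement. -/

noncomputable section

namespace NCpx

universe v u

variable {B : Type u} [Category.{v} B] [Preadditive B] {N r : ℕ}

/-! ### Properties of iterated prolongations and contractions -/

section Iterated

variable {k M : ℕ} (hM : 0 < M) (h : M + k = N) (s : ℤ)

lemma nonempty_prolong_adj_contract :
    Nonempty (prolong B s k M N h ⊣ contract B s k M N hM h) := by
  rw [prolong_eq, contract_eq]
  exact ⟨reindexAdjunction _ _ _ _ _ _ (fun n => (prolongFun_contractFun hM s k n).ge)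
    (contractFun_prolongFun_le hM s k)⟩

lemma nonempty_contract_adj_prolong {s t : ℤ} (ht : t + 1 = s) :
    Nonempty (contract B t k M N hM h ⊣ prolong B s k M N h) := by
  rw [prolong_eq, contract_eq]
  exact ⟨reindexAdjunction _ _ _ _ _ _ (le_contractFun_pred_prolongFun hM k ht)
    (fun n => (prolongFun_contractFun_pred hM k ht n).le)⟩

include hM in
lemma prolong_full_faithful : (prolong B s k M N h).Full ∧ (prolong B s k M N h).Faithful := by
  rw [prolong_eq]
  exact reindex_full_faithful _ _ (contractFun_monotone s hM k) _ (contractFun_add' s hM h) _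
    (prolongFun_contractFun hM s k) (contractFun_prolongFun_le hM s k)

lemma isTriangleFunctor_prolong [HasFiniteBiproducts B] (hM : 0 < M) :
    IsTriangleFunctor (prolong B s k M N h) := by
  rw [prolong_eq]
  exact isTriangleFunctor_reindex _ _ _ (by omega)

lemma isTriangleFunctor_contract [HasFiniteBiproducts B] :
    IsTriangleFunctor (contract B s k M N hM h) := by
  rw [contract_eq]
  exact isTriangleFunctor_reindex _ _ _ hM

end Iterated

/-- The function with constant value `v` on the period that starts with `c`. -/
def stepFun (N : ℕ) (c v n : ℤ) : ℤ := v + (n - c) / N * N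

lemma stepFun_monotone (hN : 0 < N) (c v : ℤ) : Monotone (stepFun N c v) := fun a b hab => by
  have : (a - c) / (N : ℤ) ≤ (b - c) / N := Int.ediv_le_ediv (by omega) (by omega)
  unfold stepFun
  gcongr

lemma stepFun_add (hN : 0 < N) (c v n : ℤ) : stepFun N c v (n + N) = stepFun N c v n + N := by
  unfold stepFun
  rw [show n + (N : ℤ) - c = n - c + N * 1 by ring, Int.add_mul_ediv_left _ _ (by omega)]
  ring

lemma stepFun_of_mem {c n : ℤ} (v : ℤ) (h : c ≤ n) (h' : n < c + N) : stepFun N c v n = v := by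
  unfold stepFun
  rw [Int.ediv_eq_zero_of_lt (by omega) (by omega)]
  ring

section Composites

variable {P q : ℕ} (hP : 0 < P) (h : P + r = N) (h' : r + 1 + q = N) (s : ℤ)

include hP h h'

/-- On the period from `s` the contraction takes the values `s + r, …, s + N - 1`, exactly the
indices that the prolongation based at `r + s` collapses. The next two lemmas match the values with
collapsed indices in the same way. -/
lemma isZero_contract_prolong_left (X : K B (r + 1)) :
    IsZero ((contract B (s - 1) r P N hP h).obj
      ((prolong B (r + s) q (r + 1) N h').obj X)) := by
  rw [prolong_eq, contract_eq]
  refine isZero_reindex_reindex_obj (by omega) (by omega) _ _ _ _ s ?_ X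
  rw [contractFun_pred_of_mem (by omega) _ (sub_add_cancel s 1) (by omega) (by omega),
    contractFun_pred_of_mem (by omega) _ (sub_add_cancel s 1) (by omega) (by omega),
    prolongFun_of_mem (by omega) (by omega) (by omega),
    prolongFun_of_mem (by omega) (by omega) (by omega)]
  omega

lemma isZero_contract_prolong_middle (X : K B P) :
    IsZero ((contract B (r + s) q (r + 1) N r.succ_pos h').obj
      ((prolong B s r P N h).obj X)) := by
  rw [prolong_eq, contract_eq]
  refine isZero_reindex_reindex_obj (by omega) (by omega) _ _ _ _ (r + s + 1) ?_ X
  rw [contractFun_pred_of_mem (by omega) _ rfl (by omega) (by omega),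
    contractFun_pred_of_mem (by omega) _ rfl (by omega) (by omega)]
  have e₁ := prolongFun_add' s h s
  have e₂ := prolongFun_add' s h (s + r)
  rw [show (r : ℤ) + s + 1 + ((r + 1 : ℕ) : ℤ) - 1 + (q : ℤ) = s + r + N by omega,
    show (r : ℤ) + s + 1 + (q : ℤ) = s + N by omega, e₁, e₂,
    prolongFun_of_mem (by omega) le_rfl (by omega),
    prolongFun_of_mem (by omega) (by omega) (by omega)]
  omega

lemma isZero_contract_prolong_right (X : K B (r + 1)) :
    IsZero ((contract B s r P N hP h).obj
      ((prolong B (r + s + 1) q (r + 1) N h').obj X)) := by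
  rw [prolong_eq, contract_eq]
  refine isZero_reindex_reindex_obj (by omega) (by omega) _ _ _ _ (s + 1) ?_ X
  rw [contractFun_pred_of_mem (by omega) _ rfl (by omega) (by omega),
    contractFun_pred_of_mem (by omega) _ rfl (by omega) (by omega),
    prolongFun_of_mem (by omega) (by omega) (by omega),
    prolongFun_of_mem (by omega) (by omega) (by omega)]
  omega

/-- On `[s, s + N)` the two composites are `min n (r + s)` and `max n (r + s)`. -/
lemma left_relations : ∀ n : ℤ,
    (contractFun (r + s) (r + 1) q (prolongFun (r + s) (r + 1) q n) = n ∧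
      contractFun (s - 1) P r (prolongFun s P r n) = stepFun N s (r + s) n) ∨
    (contractFun (s - 1) P r (prolongFun s P r n) = n ∧
      contractFun (r + s) (r + 1) q (prolongFun (r + s) (r + 1) q n) =
        stepFun N s (r + s) n) := by
  have per : ∀ n : ℤ, contractFun (r + s) (r + 1) q
      (prolongFun (r + s) (r + 1) q (n + N)) = contractFun (r + s) (r + 1) q
      (prolongFun (r + s) (r + 1) q n) + N := fun n => by
    rw [prolongFun_add' _ (by omega), contractFun_add' _ (by omega) (show _ = N by omega)]
  refine forall_of_window (P := N) (by omega) (fun n => ?_) s (fun n hn hn' => ?_)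
  · rw [per, prolongFun_add' s (by omega),
      contractFun_add' _ (by omega) (show _ = N by omega), stepFun_add (by omega)]
    omega
  · rw [stepFun_of_mem _ hn hn',
      contractFun_pred_prolongFun_of_mem (by omega) _ (sub_add_cancel s 1) hn (by omega)]
    by_cases hn₀ : r + s ≤ n
    · rw [contractFun_prolongFun_of_mem (by omega) _ _ hn₀ (by omega), if_pos (by omega)]
      omega
    -- The formula for the composite is known on the period from `r + s`, so it is applied to `n +
    -- N`, which is a fixed point.
    · have e := per n
      rw [contractFun_prolongFun_of_mem (by omega) _ _ (by omega) (by omega),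
        if_neg (by omega)] at e
      omega

/-- On `[r + s + 1 - N, r + s + 1)` the two composites are `min n s` and `max n s`. The period ends
at `r + s` because `s, …, r + s` are the indices collapsed by the prolongation based at `s`. -/
lemma right_relations : ∀ n : ℤ,
    (contractFun s P r (prolongFun s P r n) = n ∧
      contractFun (r + s) (r + 1) q (prolongFun (r + s + 1) (r + 1) q n) =
        stepFun N (r + s + 1 - N) s n) ∨
    (contractFun (r + s) (r + 1) q (prolongFun (r + s + 1) (r + 1) q n) = n ∧
      contractFun s P r (prolongFun s P r n) = stepFun N (r + s + 1 - N) s n) := by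
  have per : ∀ n : ℤ, contractFun s P r (prolongFun s P r (n + N)) =
      contractFun s P r (prolongFun s P r n) + N := fun n => by
    rw [prolongFun_add' _ (by omega), contractFun_add' _ (by omega) (show _ = N by omega)]
  have per' : ∀ n : ℤ, contractFun (r + s) (r + 1) q
      (prolongFun (r + s + 1) (r + 1) q (n + N)) =
      contractFun (r + s) (r + 1) q
        (prolongFun (r + s + 1) (r + 1) q n) + N := fun n => by
    rw [prolongFun_add' _ (by omega), contractFun_add' _ (by omega) (show _ = N by omega)]
  refine forall_of_window (P := N) (by omega) (fun n => ?_) (r + s + 1 - N) (fun n hn hn' => ?_)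
  · rw [per, per', stepFun_add (by omega)]
    omega
  · rw [stepFun_of_mem _ hn hn']
    have e' := per' n
    rw [contractFun_pred_prolongFun_of_mem (by omega) _ rfl (by omega) (by omega)] at e'
    by_cases hn₀ : s ≤ n
    · rw [contractFun_prolongFun_of_mem (by omega) _ _ hn₀ (by omega), if_pos (by omega)]
      omega
    · have e := per n
      rw [contractFun_prolongFun_of_mem (by omega) _ _ (by omega) (by omega),
        if_neg (by omega)] at e
      omega

variable [HasFiniteBiproducts B]

/-- The termwise split sequence realises `j_! j^* X ⟶ X ⟶ i_* i^* X`, so each kernel lies in the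
opposite image. -/
lemma nonempty_iso_of_isZero_left (X : K B N) :
    (IsZero ((contract B (s - 1) r P N hP h).obj X) →
      Nonempty ((prolong B (r + s) q (r + 1) N h').obj
        ((contract B (r + s) q (r + 1) N r.succ_pos h').obj X) ≅ X)) ∧
    (IsZero ((contract B (r + s) q (r + 1) N r.succ_pos h').obj X) →
      Nonempty ((prolong B s r P N h).obj
        ((contract B (s - 1) r P N hP h).obj X) ≅ X)) := by
  simp only [prolong_eq, contract_eq]
  have key := isIso_of_isZero_reindex
    (α := contractFun (r + s) (r + 1) q ∘ prolongFun (r + s) (r + 1) q)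
    (β := contractFun (s - 1) P r ∘ prolongFun s P r)
    (ε := stepFun N s (r + s))
    ((contractFun_monotone _ (by omega) _).comp (prolongFun_monotone _ _ _))
    ((contractFun_monotone _ (by omega) _).comp (prolongFun_monotone _ _ _))
    (stepFun_monotone (by omega) _ _)
    (fun n => by
      rw [Function.comp_apply, prolongFun_add' _ (by omega),
        contractFun_add' _ (by omega) (show _ = N by omega)]; rfl)
    (fun n => by
      rw [Function.comp_apply, prolongFun_add' _ (by omega),
        contractFun_add' _ (by omega) (show _ = N by omega)]; rfl)
    (stepFun_add (by omega) _ _) (by omega) (contractFun_prolongFun_le (by omega) _ _)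
    (le_contractFun_pred_prolongFun (by omega) _ (sub_add_cancel s 1)) (left_relations hP h h' s) s
    (by rw [stepFun_of_mem _ (by omega) (by omega), stepFun_of_mem _ (by omega) (by omega)]) X
  -- The hypothesis concerns the contraction alone; applying the prolongation gives the vanishing of
  -- the composite that the sequence involves.
  exact ⟨fun hX => key.1 (Functor.map_isZero (reindex (N := P) (P := N)
    (prolongFun s P r) (prolongFun_monotone _ _ _) (prolongFun_add' _ (by omega))) hX),
    fun hX => key.2 (Functor.map_isZero (reindex (N := r + 1) (P := N)
    (prolongFun (r + s) (r + 1) q) (prolongFun_monotone _ _ _)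
    (prolongFun_add' _ (by omega))) hX)⟩

/-- Here the sequence realises `i_* i^! X ⟶ X ⟶ j_* j^* X`. -/
lemma nonempty_iso_of_isZero_right (X : K B N)
    (hX : IsZero ((contract B s r P N hP h).obj X)) :
    Nonempty ((prolong B (r + s + 1) q (r + 1) N h').obj
      ((contract B (r + s) q (r + 1) N r.succ_pos h').obj X) ≅ X) := by
  rw [contract_eq] at hX
  rw [prolong_eq, contract_eq]
  have key := isIso_of_isZero_reindex
    (α := contractFun s P r ∘ prolongFun s P r)
    (β := contractFun (r + s) (r + 1) q ∘ prolongFun (r + s + 1) (r + 1) q)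
    (ε := stepFun N (r + s + 1 - N) s)
    ((contractFun_monotone _ (by omega) _).comp (prolongFun_monotone _ _ _))
    ((contractFun_monotone _ (by omega) _).comp (prolongFun_monotone _ _ _))
    (stepFun_monotone (by omega) _ _)
    (fun n => by
      rw [Function.comp_apply, prolongFun_add' _ (by omega),
        contractFun_add' _ (by omega) (show _ = N by omega)]; rfl)
    (fun n => by
      rw [Function.comp_apply, prolongFun_add' _ (by omega),
        contractFun_add' _ (by omega) (show _ = N by omega)]; rfl)
    (stepFun_add (by omega) _ _) (by omega) (contractFun_prolongFun_le (by omega) _ _)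
    (le_contractFun_pred_prolongFun (by omega) _ rfl) (right_relations hP h h' s) (r + s + 1 - N)
    (by rw [stepFun_of_mem _ (by omega) (by omega), stepFun_of_mem _ (by omega) (by omega)]) X
  exact key.2 (Functor.map_isZero (reindex (N := P) (P := N)
    (prolongFun s P r) (prolongFun_monotone _ _ _) (prolongFun_add' _ (by omega))) hX)

end Composites

end NCpx

end

theorem mainTheorem5 {B : Type*} [Category* B] [Preadditive B] [HasFiniteBiproducts B]
    (N r : ℕ) (hr : 1 ≤ r) (hrN : r < N) (s : ℤ) :
    NCpx.IsRecollement
      (D' := NCpx.K B (N - r)) (D := NCpx.K B N) (D'' := NCpx.K B (r + 1))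
      (iUpperStar := NCpx.contract B (s - 1) r (N - r) N (by omega) (by omega))
      (iLowerStar := NCpx.prolong B s r (N - r) N (by omega))
      (iUpperShriek := NCpx.contract B s r (N - r) N (by omega) (by omega))
      (jLowerShriek := NCpx.prolong B (r + s) (N - r - 1) (r + 1) N (by omega))
      (jUpperStar := NCpx.contract B (r + s) (N - r - 1) (r + 1) N (by omega) (by omega))
      (jLowerStar := NCpx.prolong B (r + s + 1) (N - r - 1) (r + 1) N (by omega)) := by
  have hP : 0 < N - r := Nat.sub_pos_of_lt hrN
  have h : N - r + r = N := Nat.sub_add_cancel hrN.le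
  have h' : r + 1 + (N - r - 1) = N := by omega
  exact {
    triangulated_left := (NCpx.triangulationAxioms (by omega)).isTriangulatedCategory
    triangulated_middle := (NCpx.triangulationAxioms (by omega)).isTriangulatedCategory
    triangulated_right := (NCpx.triangulationAxioms (by omega)).isTriangulatedCategory
    triangle_iUpperStar := NCpx.isTriangleFunctor_contract _ _ _
    triangle_iLowerStar := NCpx.isTriangleFunctor_prolong _ _ (by omega)
    triangle_iUpperShriek := NCpx.isTriangleFunctor_contract _ _ _
    triangle_jLowerShriek := NCpx.isTriangleFunctor_prolong _ _ (by omega)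
    triangle_jUpperStar := NCpx.isTriangleFunctor_contract _ _ _
    triangle_jLowerStar := NCpx.isTriangleFunctor_prolong _ _ (by omega)
    full_iLowerStar := (NCpx.prolong_full_faithful (by omega) _ _).1
    faithful_iLowerStar := (NCpx.prolong_full_faithful (by omega) _ _).2
    full_jLowerShriek := (NCpx.prolong_full_faithful (by omega) _ _).1
    faithful_jLowerShriek := (NCpx.prolong_full_faithful (by omega) _ _).2
    full_jLowerStar := (NCpx.prolong_full_faithful (by omega) _ _).1
    faithful_jLowerStar := (NCpx.prolong_full_faithful (by omega) _ _).2
    adj_iUpperStar_iLowerStar := NCpx.nonempty_contract_adj_prolong _ _ (sub_add_cancel s 1)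
    adj_iLowerStar_iUpperShriek := NCpx.nonempty_prolong_adj_contract _ _ _
    adj_jLowerShriek_jUpperStar := NCpx.nonempty_prolong_adj_contract _ _ _
    adj_jUpperStar_jLowerStar := NCpx.nonempty_contract_adj_prolong _ _ rfl
    image_jLowerShriek X := by
      refine ⟨fun ⟨Y, ⟨e⟩⟩ => ?_, fun hX => ⟨_, (NCpx.nonempty_iso_of_isZero_left hP h h' s X).1 hX⟩⟩
      exact (NCpx.isZero_contract_prolong_left hP h h' s Y).of_iso (Functor.mapIso _ e.symm)
    image_iLowerStar X := by
      refine ⟨fun ⟨Y, ⟨e⟩⟩ => ?_, fun hX => ⟨_, (NCpx.nonempty_iso_of_isZero_left hP h h' s X).2 hX⟩⟩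
      exact (NCpx.isZero_contract_prolong_middle hP h h' s Y).of_iso (Functor.mapIso _ e.symm)
    image_jLowerStar X := by
      refine ⟨fun ⟨Y, ⟨e⟩⟩ => ?_, fun hX => ⟨_, NCpx.nonempty_iso_of_isZero_right hP h h' s X hX⟩⟩
      exact (NCpx.isZero_contract_prolong_right hP h h' s Y).of_iso (Functor.mapIso _ e.symm) }
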